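/- Let $\mathcal M$ be a compact smooth 3-manifold and $\phi^t$ the flow of a $C^1$ vector field $X$ on $\mathcal M$ with a periodic orbit $\Gamma$ of length $\ell>0$ that has tubular coordinates $(x,y,z)$, $|x|,|y|<r$, $z\in\mathbb R/\ell\mathbb Z$ (a $C^1$ diffeomorphism $\Psi$ onto a neighbourhood of $\Gamma=\{x=y=0\}$), in which $$ \dot x = x\,(a_0x^2+a_1xy+a_2y^2+R_1),\qquad \dot y = -y\,(b_0x^2+b_1xy+b_2y^2+R_2),\qquad \dot z = 1+W , $$ where $R_1,R_2,W$ are continuous functions of $(x,y,z)$, $R_1,R_2=O(|(x,y)|^3)$, and $W=0$ on $\Gamma$. Assume $a_0,b_2>0$, $a_2,b_0\ge 0$, $a_1,b_1\in\mathbb R$ and $(a_1+b_1)^2<4(a_0+b_0)(a_2+b_2)$, and put $\beta_2=\frac{a_2+b_2}{2b_2}$. Let $\Sigma\subset\mathcal M$ be a closed section which inside the tube is the disc $\{z=0\}$ and whose first return time $h(q)=\min\{t>0:\phi^t(q)\in\Sigma\}$, $q\in\Sigma$, is bounded and bounded away from $0$. Let $\mu$ be a measure on $\Sigma$ that near $p=\Gamma\cap\Sigma$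 has a continuous positive density with respect to $dx\,dy$; for example $\mu=\mathrm{Leb}$, or, when $\phi^t$ preserves the volume $dx\,dy\,dz$ and $|W|<1$ in the tube, the measure $(1+W)\,dx\,dy$, which is invariant under the Poincaré map. Then every sufficiently small rectangle $P_0\subset\Sigma$ around $p$ has the following property; more generally, there is a neighbourhood $V$ of $p$ in $\Sigma$ such that it holds for every compact $P_0\subset V$ that contains $p$ in its interior and whose boundary meets the local stable manifold $\{x=0\}$ of $p$ in finitely many points (two points for a Markov rectangle bounded by two stable and two unstable leaves). Let $Y=\Sigma\setminus P_0$ and let $$\tau(q)=\min\{t>0:\phi^t(q)\in Y\}\in(0,\infty],\qquad q\in Y,$$ be the first return time of the induced Poincaré map $F=\phi^\tau:Y\to Y$. Then there exists $C^*>0$ such that $$ \mu(\{q\in Y:\tau(q)>t\}) = C^*\,t^{-\beta_2}\,(1+o(1))\qquad\text{as } t\to\infty . $$ -/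

import Mathlib

open Filter Topology MeasureTheory Manifold Asymptotics
open scoped ENNReal ContDiff

/-- The open square `{(x, y) : |x| < r, |y| < r}`. -/
def openSquare (r : ℝ) : Set (ℝ × ℝ) :=
  {p | |p.1| < r ∧ |p.2| < r}

/-- The open solid tube `{(x, y, z) : |x| < r, |y| < r}` around the `z`-axis. -/
def openTube (r : ℝ) : Set (ℝ × ℝ × ℝ) :=
  {p | |p.1| < r ∧ |p.2.1| < r}

/-- The first time `t > 0` at which the `φ`-orbit of `q` is in `A` (it is `∞` if there is none). -/
noncomputable def firstHit {M : Type*} [TopologicalSpace M]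
    (φ : Flow ℝ M) (A : Set M) (q : M) : ℝ≥0∞ :=
  ⨅ (t : ℝ) (_ : 0 < t) (_ : φ t q ∈ A), ENNReal.ofReal t

section

variable {M : Type*} [TopologicalSpace M] [ChartedSpace (EuclideanSpace ℝ (Fin 3)) M]
  [IsManifold (𝓡 3) ∞ M]

/-- `Ψ` is a system of tubular coordinates `(x, y, z)`, `|x|, |y| < r`, `z ∈ ℝ / ℓℤ`, around the
periodic orbit `Γ = {x = y = 0}`, in which the vector field `X` reads
`(x (a₀ x² + a₁ x y + a₂ y²), -y (b₀ x² + b₁ x y + b₂ y²), 1 + w)` plus terms of order four and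
higher.  The horizontal higher order terms are `x R₁` and `-y R₂` with `R₁, R₂` of order three,
since the planes `x = 0` and `y = 0` are the local stable and unstable manifolds of `Γ`.
The function `W` is the sum of `w`, which vanishes on `Γ`, and of the vertical higher order terms.
The norm of `(x, y)` is the maximum norm. -/
structure IsCubicSaddleChart (X : ∀ q : M, TangentSpace (𝓡 3) q)
    (a₀ a₁ a₂ b₀ b₁ b₂ r ℓ : ℝ) (Ψ : ℝ × ℝ × ℝ → M) : Prop where
  radius_pos : 0 < r
  length_pos : 0 < ℓ
  periodic : ∀ x y z : ℝ, Ψ (x, y, z + ℓ) = Ψ (x, y, z)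
  injective : ∀ p ∈ openTube r, ∀ p' ∈ openTube r, Ψ p = Ψ p' →
    p.1 = p'.1 ∧ p.2.1 = p'.2.1 ∧ ∃ k : ℤ, p'.2.2 = p.2.2 + k * ℓ
  localDiffeo : IsLocalDiffeomorphOn 𝓘(ℝ, ℝ × ℝ × ℝ) (𝓡 3) 1 Ψ (openTube r)
  localForm : ∃ R₁ R₂ W : ℝ × ℝ × ℝ → ℝ,
    ContinuousOn R₁ (openTube r) ∧ ContinuousOn R₂ (openTube r) ∧ ContinuousOn W (openTube r) ∧
    (∃ K : ℝ, ∀ x y z : ℝ, (x, y, z) ∈ openTube r →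
      |R₁ (x, y, z)| ≤ K * ‖(x, y)‖ ^ 3 ∧ |R₂ (x, y, z)| ≤ K * ‖(x, y)‖ ^ 3) ∧
    (∀ z : ℝ, W (0, 0, z) = 0) ∧
    ∀ x y z : ℝ, (x, y, z) ∈ openTube r →
      X (Ψ (x, y, z)) = mfderiv 𝓘(ℝ, ℝ × ℝ × ℝ) (𝓡 3) Ψ (x, y, z)
        ((x * (a₀ * x ^ 2 + a₁ * x * y + a₂ * y ^ 2 + R₁ (x, y, z)),
          -(y * (b₀ * x ^ 2 + b₁ * x * y + b₂ * y ^ 2 + R₂ (x, y, z))),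
          1 + W (x, y, z)) : ℝ × ℝ × ℝ)

end

section

variable {M : Type*} [TopologicalSpace M]

/-- `S` is a section for the flow `φ`: its first return time is bounded and bounded away from zero,
and inside the tube with coordinates `Ψ` it is the disc `z = 0` (modulo the period `ℓ`). -/
structure IsFlowSection (φ : Flow ℝ M) (Ψ : ℝ × ℝ × ℝ → M) (r ℓ : ℝ) (S : Set M) : Prop where
  isClosed : IsClosed S
  mem_iff : ∀ p ∈ openTube r, Ψ p ∈ S ↔ ∃ k : ℤ, p.2.2 = k * ℓ
  returnTime : ∃ hmin hmax : ℝ, 0 < hmin ∧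
    ∀ q ∈ S, ENNReal.ofReal hmin ≤ firstHit φ S q ∧ firstHit φ S q ≤ ENNReal.ofReal hmax

/-- The subset of the section that has the coordinates `(x, y) ∈ A`, `z = 0`. -/
def sectionImage (Ψ : ℝ × ℝ × ℝ → M) (A : Set (ℝ × ℝ)) : Set M :=
  (fun p : ℝ × ℝ => Ψ (p.1, p.2, 0)) '' A

/-- In the coordinates `(x, y)` near the periodic orbit, the measure `μ` on the section has a
continuous positive density with respect to `dx dy` (density `1` is Lebesgue measure in these
coordinates). -/
def HasContinuousPositiveDensity [MeasurableSpace M] (μ : Measure M)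
    (Ψ : ℝ × ℝ × ℝ → M) (r : ℝ) : Prop :=
  ∃ ρ : ℝ × ℝ → ℝ, ContinuousOn ρ (openSquare r) ∧ (∀ p ∈ openSquare r, 0 < ρ p) ∧
    ∀ A ⊆ openSquare r, MeasurableSet A →
      μ (sectionImage Ψ A) = ∫⁻ p in A, ENNReal.ofReal (ρ p)

end

/-- Coefficients of the cubic part of a degenerate saddle
`ẋ = x (a₀ x² + a₁ x y + a₂ y²)`, `ẏ = -y (b₀ x² + b₁ x y + b₂ y²)`. -/
structure SaddleCoeffs where
  a₀ : ℝ
  a₁ : ℝ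
  a₂ : ℝ
  b₀ : ℝ
  b₁ : ℝ
  b₂ : ℝ
  a₀_pos : 0 < a₀
  a₂_nonneg : 0 ≤ a₂
  b₀_nonneg : 0 ≤ b₀
  b₂_pos : 0 < b₂
  disc_neg : (a₁ + b₁) ^ 2 < 4 * (a₀ + b₀) * (a₂ + b₂)

namespace SaddleCoeffs

noncomputable section

variable (k : SaddleCoeffs)

/-- The exponent governing the passage along the stable direction. -/
def alpha : ℝ := k.b₂ / (k.a₂ + k.b₂)

/-- The exponent governing the passage along the unstable direction. -/
def gamma : ℝ := k.a₀ / (k.a₀ + k.b₀)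

/-- The quadratic polynomial with `(x / y)˙ = (x / y) y² quad (x / y)` for the cubic field. -/
def quad (w : ℝ) : ℝ := (k.a₀ + k.b₀) * w ^ 2 + (k.a₁ + k.b₁) * w + (k.a₂ + k.b₂)

/-- The quadratic polynomial with `ẏ = -y³ numer (x / y)` for the cubic field. -/
def numer (w : ℝ) : ℝ := k.b₀ * w ^ 2 + k.b₁ * w + k.b₂

/-- The absolute value of the discriminant of `quad`. -/
def disc : ℝ := 4 * (k.a₀ + k.b₀) * (k.a₂ + k.b₂) - (k.a₁ + k.b₁) ^ 2

/-- The leading coefficient of `(numer w - alpha * quad w) / w`. -/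
def corrLead : ℝ := k.b₀ - k.alpha * (k.a₀ + k.b₀)

/-- The constant coefficient of `(numer w - alpha * quad w) / w`. -/
def corrConst : ℝ := k.b₁ - k.alpha * (k.a₁ + k.b₁)

/-- A primitive of `(corrLead * w + corrConst) / quad w`. -/
def corr (w : ℝ) : ℝ :=
  k.corrLead / (2 * (k.a₀ + k.b₀)) * Real.log (k.quad w) +
    (k.corrConst - k.corrLead * (k.a₁ + k.b₁) / (2 * (k.a₀ + k.b₀))) *
      (2 / √k.disc * Real.arctan ((2 * (k.a₀ + k.b₀) * w + (k.a₁ + k.b₁)) / √k.disc))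

/-- The logarithm of the ratio between the first integral and `y`, where `s = log (x / y)`. -/
def logProfile (s : ℝ) : ℝ := k.alpha * s + k.corr (Real.exp s)

/-- The weight comparable to `(1 + exp s) / exp (logProfile s)`. -/
def weight (s : ℝ) : ℝ := Real.exp (-k.alpha * s) + Real.exp (k.gamma * s)

/-- The decreasing function whose derivative is comparable to `-weight`. -/
def lyap (s : ℝ) : ℝ := Real.exp (-k.alpha * s) - Real.exp (k.gamma * s)

/-- The density of the passage time with respect to `s`. -/
def timeDensity (s : ℝ) : ℝ := Real.exp (2 * k.logProfile s) / k.quad (Real.exp s)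

/-- The normalized passage time from slope `0` to slope `s`. -/
def passTime (s : ℝ) : ℝ := ∫ σ in (0 : ℝ)..s, k.timeDensity σ

theorem lead_pos : 0 < k.a₀ + k.b₀ := add_pos_of_pos_of_nonneg k.a₀_pos k.b₀_nonneg

theorem tail_pos : 0 < k.a₂ + k.b₂ := add_pos_of_nonneg_of_pos k.a₂_nonneg k.b₂_pos

theorem disc_pos : 0 < k.disc := sub_pos.2 k.disc_neg

theorem alpha_pos : 0 < k.alpha := div_pos k.b₂_pos k.tail_pos

theorem gamma_pos : 0 < k.gamma := div_pos k.a₀_pos k.lead_pos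

theorem alpha_le_one : k.alpha ≤ 1 :=
  (div_le_one k.tail_pos).2 (by linarith [k.a₂_nonneg])

theorem gamma_le_one : k.gamma ≤ 1 :=
  (div_le_one k.lead_pos).2 (by linarith [k.b₀_nonneg])

theorem alpha_mul : k.alpha * (k.a₂ + k.b₂) = k.b₂ :=
  div_mul_cancel₀ _ k.tail_pos.ne'

theorem four_mul_quad (w : ℝ) :
    4 * (k.a₀ + k.b₀) * k.quad w = k.disc + (2 * (k.a₀ + k.b₀) * w + (k.a₁ + k.b₁)) ^ 2 := by
  unfold quad disc; ring

theorem quad_pos (w : ℝ) : 0 < k.quad w := by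
  have h := k.four_mul_quad w
  have : 0 < 4 * (k.a₀ + k.b₀) * k.quad w := by
    rw [h]; have := k.disc_pos; positivity
  exact pos_of_mul_pos_right this (by have := k.lead_pos; positivity)

theorem hasDerivAt_quad (w : ℝ) :
    HasDerivAt k.quad (2 * (k.a₀ + k.b₀) * w + (k.a₁ + k.b₁)) w := by
  have h1 := ((hasDerivAt_id w).pow 2).const_mul (k.a₀ + k.b₀)
  have h2 := (hasDerivAt_id w).const_mul (k.a₁ + k.b₁)
  have := (h1.add h2).add_const (k.a₂ + k.b₂)
  refine this.congr_deriv ?_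
  simp; ring

theorem hasDerivAt_corr (w : ℝ) :
    HasDerivAt k.corr ((k.corrLead * w + k.corrConst) / k.quad w) w := by
  have hq := k.quad_pos w
  have hl := k.lead_pos
  have hd := Real.sqrt_pos.2 k.disc_pos
  have hsq := Real.sq_sqrt k.disc_pos.le
  have h1 := ((k.hasDerivAt_quad w).log hq.ne').const_mul
    (k.corrLead / (2 * (k.a₀ + k.b₀)))
  have h2 : HasDerivAt (fun w => (2 * (k.a₀ + k.b₀) * w + (k.a₁ + k.b₁)) / √k.disc)
      (2 * (k.a₀ + k.b₀) / √k.disc) w := by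
    have := (((hasDerivAt_id w).const_mul (2 * (k.a₀ + k.b₀))).add_const
      (k.a₁ + k.b₁)).div_const (√k.disc)
    simpa using this
  have h3 := (h2.arctan.const_mul (2 / √k.disc)).const_mul
    (k.corrConst - k.corrLead * (k.a₁ + k.b₁) / (2 * (k.a₀ + k.b₀)))
  refine (h1.add h3).congr_deriv ?_
  have h4 : 2 / √k.disc * (1 / (1 + ((2 * (k.a₀ + k.b₀) * w + (k.a₁ + k.b₁)) / √k.disc) ^ 2) *
      (2 * (k.a₀ + k.b₀) / √k.disc)) = 1 / k.quad w := by
    have h5 := k.four_mul_quad w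
    rw [div_pow, hsq]
    have h6 : 1 + (2 * (k.a₀ + k.b₀) * w + (k.a₁ + k.b₁)) ^ 2 / k.disc =
        4 * (k.a₀ + k.b₀) * k.quad w / k.disc := by
      rw [h5]; field_simp [k.disc_pos.ne']
    rw [h6]
    have h7 := k.disc_pos.ne'
    rw [eq_div_iff hq.ne']
    field_simp
    rw [hsq]; field_simp; norm_num
  rw [h4]
  field_simp
  ring

theorem continuous_corr : Continuous k.corr :=
  continuous_iff_continuousAt.2 fun w => (k.hasDerivAt_corr w).continuousAt

theorem hasDerivAt_logProfile (s : ℝ) :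
    HasDerivAt k.logProfile (k.numer (Real.exp s) / k.quad (Real.exp s)) s := by
  have h1 := (hasDerivAt_id s).const_mul k.alpha
  have h2 := (k.hasDerivAt_corr (Real.exp s)).comp s (Real.hasDerivAt_exp s)
  refine (h1.add h2).congr_deriv ?_
  have hq := (k.quad_pos (Real.exp s)).ne'
  have := k.alpha_mul
  field_simp
  unfold corrLead corrConst numer quad
  linear_combination this

theorem continuous_logProfile : Continuous k.logProfile :=
  continuous_iff_continuousAt.2 fun s => (k.hasDerivAt_logProfile s).continuousAt

theorem continuous_quad : Continuous k.quad :=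
  continuous_iff_continuousAt.2 fun s => (k.hasDerivAt_quad s).continuousAt

theorem timeDensity_pos (s : ℝ) : 0 < k.timeDensity s :=
  div_pos (Real.exp_pos _) (k.quad_pos _)

theorem continuous_timeDensity : Continuous k.timeDensity :=
  (Real.continuous_exp.comp (continuous_const.mul k.continuous_logProfile)).div
    (k.continuous_quad.comp Real.continuous_exp) fun _ => (k.quad_pos _).ne'

theorem hasDerivAt_passTime (s : ℝ) : HasDerivAt k.passTime (k.timeDensity s) s :=
  intervalIntegral.integral_hasDerivAt_right (k.continuous_timeDensity.intervalIntegrable _ _)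
    (k.continuous_timeDensity.stronglyMeasurableAtFilter _ _) k.continuous_timeDensity.continuousAt

theorem strictMono_passTime : StrictMono k.passTime :=
  strictMono_of_hasDerivAt_pos k.hasDerivAt_passTime k.timeDensity_pos

/-- The lower ellipticity constant of the quadratic form associated with `quad`. -/
def ell : ℝ := k.disc / (4 * ((k.a₀ + k.b₀) + (k.a₂ + k.b₂)))

theorem ell_pos : 0 < k.ell :=
  div_pos k.disc_pos (by have := k.lead_pos; have := k.tail_pos; positivity)

theorem ell_mul_le_form (x y : ℝ) :
    k.ell * (x ^ 2 + y ^ 2) ≤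
      (k.a₀ + k.b₀) * x ^ 2 + (k.a₁ + k.b₁) * x * y + (k.a₂ + k.b₂) * y ^ 2 := by
  have h0 := k.lead_pos
  have h2 := k.tail_pos
  have he : k.ell * ((k.a₀ + k.b₀) + (k.a₂ + k.b₂)) =
      (k.a₀ + k.b₀) * (k.a₂ + k.b₂) - (k.a₁ + k.b₁) ^ 2 / 4 := by
    unfold ell disc; field_simp
  have hpos := k.ell_pos
  generalize k.a₀ + k.b₀ = A at *
  generalize k.a₂ + k.b₂ = D at *
  generalize k.a₁ + k.b₁ = E at *
  generalize k.ell = c at *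
  have hA : c < A := by
    by_contra! hcon
    nlinarith [mul_le_mul_of_nonneg_right hcon (by positivity : 0 ≤ A + D), sq_nonneg E, sq_nonneg A]
  have h3 : 0 ≤ (A - c) * ((A - c) * x ^ 2 + E * x * y + (D - c) * y ^ 2) := by
    have : (A - c) * ((A - c) * x ^ 2 + E * x * y + (D - c) * y ^ 2) =
        ((A - c) * x + E / 2 * y) ^ 2 + c ^ 2 * y ^ 2 := by
      linear_combination (-y ^ 2) * he
    rw [this]; positivity
  have := nonneg_of_mul_nonneg_right h3 (sub_pos.2 hA)
  nlinarith

theorem ell_le_quad (w : ℝ) : k.ell / 2 * (1 + w) ^ 2 ≤ k.quad w := by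
  have := k.ell_mul_le_form w 1
  have h2 := k.ell_pos
  unfold quad
  nlinarith [mul_nonneg h2.le (sq_nonneg (1 - w))]

theorem exists_quad_le : ∃ C, 0 < C ∧ ∀ w, 0 ≤ w → k.quad w ≤ C * (1 + w) ^ 2 := by
  refine ⟨(k.a₀ + k.b₀) + |k.a₁ + k.b₁| + (k.a₂ + k.b₂), ?_, fun w hw => ?_⟩
  · have := k.lead_pos; have := k.tail_pos; positivity
  · have h1 := k.lead_pos; have h2 := k.tail_pos
    have h3 := le_abs_self (k.a₁ + k.b₁)
    have h4 := abs_nonneg (k.a₁ + k.b₁)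
    unfold quad
    nlinarith [mul_nonneg h1.le hw, mul_nonneg h2.le hw, mul_nonneg h4 hw,
      mul_le_mul_of_nonneg_right h3 hw, mul_nonneg h2.le (sq_nonneg w), mul_nonneg h4 (sq_nonneg w)]

theorem exists_numer_le : ∃ C, 0 < C ∧ ∀ w, 0 ≤ w → |k.numer w / k.quad w| ≤ C := by
  have hb := k.b₀_nonneg
  have hb2 := k.b₂_pos
  have he := k.ell_pos
  refine ⟨(k.b₀ + |k.b₁| + k.b₂) / (k.ell / 2), by positivity, fun w hw => ?_⟩
  have h1 : |k.numer w| ≤ (k.b₀ + |k.b₁| + k.b₂) * (1 + w) ^ 2 := by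
    have h4 := abs_nonneg k.b₁
    have : |k.numer w| ≤ k.b₀ * w ^ 2 + |k.b₁| * w + k.b₂ := by
      unfold numer
      refine (abs_add_le _ _).trans (add_le_add ((abs_add_le _ _).trans (add_le_add ?_ ?_)) ?_)
      · rw [abs_of_nonneg (by positivity)]
      · rw [abs_mul, abs_of_nonneg hw]
      · rw [abs_of_pos hb2]
    nlinarith [mul_nonneg hb hw, mul_nonneg hb2.le hw, mul_nonneg h4 hw,
      mul_nonneg hb2.le (sq_nonneg w), mul_nonneg h4 (sq_nonneg w)]
  rw [abs_div, abs_of_pos (k.quad_pos w), div_le_div_iff₀ (k.quad_pos w) (by positivity)]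
  have h5 := k.ell_le_quad w
  calc |k.numer w| * (k.ell / 2) ≤ (k.b₀ + |k.b₁| + k.b₂) * (1 + w) ^ 2 * (k.ell / 2) := by gcongr
    _ = (k.b₀ + |k.b₁| + k.b₂) * (k.ell / 2 * (1 + w) ^ 2) := by ring
    _ ≤ _ := by gcongr

theorem weight_pos (s : ℝ) : 0 < k.weight s := by unfold weight; positivity

theorem abs_lyap_le (s : ℝ) : |k.lyap s| ≤ k.weight s := by
  have h1 := Real.exp_pos (-k.alpha * s)
  have h2 := Real.exp_pos (k.gamma * s)
  unfold lyap weight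
  rw [abs_le]; constructor <;> linarith

theorem hasDerivAt_lyap (s : ℝ) :
    HasDerivAt k.lyap (-(k.alpha * Real.exp (-k.alpha * s) + k.gamma * Real.exp (k.gamma * s))) s := by
  have h1 := ((hasDerivAt_id s).const_mul (-k.alpha)).exp
  have h2 := ((hasDerivAt_id s).const_mul (k.gamma)).exp
  refine (h1.sub h2).congr_deriv ?_
  simp; ring

theorem min_mul_weight_le (s : ℝ) : min k.alpha k.gamma * k.weight s ≤
    k.alpha * Real.exp (-k.alpha * s) + k.gamma * Real.exp (k.gamma * s) := by
  unfold weight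
  rw [mul_add]
  gcongr
  · exact min_le_left _ _
  · exact min_le_right _ _

/-- The logarithm of `weight` differs by a bounded amount from an explicit function. -/
theorem exists_log_weight : ∃ C, ∀ s, |Real.log (k.weight s) -
    (-k.alpha * s + (k.alpha + k.gamma) * Real.log (1 + Real.exp s))| ≤ C := by
  refine ⟨Real.log 4, fun s => ?_⟩
  set p := k.alpha + k.gamma with hp
  have hp0 : 0 < p := add_pos k.alpha_pos k.gamma_pos
  have hp2 : p ≤ 2 := by linarith [k.alpha_le_one, k.gamma_le_one]
  have e1 : k.weight s = Real.exp (-k.alpha * s) * (1 + Real.exp (p * s)) := by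
    unfold weight; rw [mul_add, mul_one, ← Real.exp_add]; congr 2; rw [hp]; ring
  rw [e1, Real.log_mul (Real.exp_pos _).ne' (by positivity), Real.log_exp]
  have h1 : Real.log (1 + Real.exp (p * s)) ≤ Real.log 4 + p * Real.log (1 + Real.exp s) := by
    have : Real.log 4 + p * Real.log (1 + Real.exp s) = Real.log (4 * (1 + Real.exp s) ^ p) := by
      rw [Real.log_mul (by norm_num) (by positivity), Real.log_rpow (by positivity)]
    rw [this]
    apply Real.log_le_log (by positivity)
    have a1 : 1 ≤ (1 + Real.exp s) ^ p :=
      Real.one_le_rpow (by linarith [Real.exp_pos s]) hp0.le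
    have a2 : Real.exp (p * s) ≤ (1 + Real.exp s) ^ p := by
      rw [mul_comm, Real.exp_mul]
      exact Real.rpow_le_rpow (Real.exp_pos _).le (by linarith) hp0.le
    linarith
  have h2 : p * Real.log (1 + Real.exp s) ≤ Real.log 4 + Real.log (1 + Real.exp (p * s)) := by
    rw [← Real.log_mul (by norm_num) (by positivity), ← Real.log_rpow (by positivity)]
    apply Real.log_le_log (by positivity)
    have b4 : (2 : ℝ) ^ p ≤ 4 := by
      calc (2 : ℝ) ^ p ≤ 2 ^ (2 : ℝ) := Real.rpow_le_rpow_of_exponent_le (by norm_num) hp2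
        _ = 4 := by norm_num
    rcases le_total s 0 with hs | hs
    · have : Real.exp s ≤ 1 := Real.exp_le_one_iff.2 hs
      calc (1 + Real.exp s) ^ p ≤ 2 ^ p :=
            Real.rpow_le_rpow (by positivity) (by linarith) hp0.le
        _ ≤ 4 * 1 := by linarith
        _ ≤ _ := by gcongr; linarith [Real.exp_pos (p * s)]
    · have : 1 ≤ Real.exp s := Real.one_le_exp hs
      calc (1 + Real.exp s) ^ p ≤ (2 * Real.exp s) ^ p :=
            Real.rpow_le_rpow (by positivity) (by linarith) hp0.le
        _ = 2 ^ p * Real.exp (p * s) := by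
            rw [Real.mul_rpow (by norm_num) (by positivity), ← Real.exp_mul, mul_comm s]
        _ ≤ 4 * Real.exp (p * s) := by gcongr
        _ ≤ _ := by gcongr; linarith
  rw [abs_le]; constructor <;> linarith

theorem exists_log_quad : ∃ C, ∀ w, 0 ≤ w → |Real.log (k.quad w) - 2 * Real.log (1 + w)| ≤ C := by
  obtain ⟨C, hC, h⟩ := k.exists_quad_le
  have he := k.ell_pos
  refine ⟨max (Real.log C) (-Real.log (k.ell / 2)), fun w hw => ?_⟩
  have h1 := Real.log_le_log (k.quad_pos w) (h w hw)
  have h2 := Real.log_le_log (by positivity) (k.ell_le_quad w)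
  rw [Real.log_mul (by positivity) (by positivity), Real.log_pow] at h1 h2
  push_cast at h1 h2
  rw [abs_le]
  constructor
  · linarith [le_max_right (Real.log C) (-Real.log (k.ell / 2))]
  · linarith [le_max_left (Real.log C) (-Real.log (k.ell / 2))]

/-- Along the first integral, `exp (logProfile s)` is comparable to `(1 + exp s) / weight s`. -/
theorem exists_profile_bounds : ∃ C, 1 ≤ C ∧ ∀ s,
    Real.exp (k.logProfile s) * k.weight s ≤ C * (1 + Real.exp s) ∧
    1 + Real.exp s ≤ C * (Real.exp (k.logProfile s) * k.weight s) := by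
  obtain ⟨C1, h1⟩ := k.exists_log_weight
  obtain ⟨C2, h2⟩ := k.exists_log_quad
  have hl := k.lead_pos
  set e := k.corrConst - k.corrLead * (k.a₁ + k.b₁) / (2 * (k.a₀ + k.b₀)) with he
  set f := k.corrLead / (2 * (k.a₀ + k.b₀)) with hf
  have hf' : 2 * f = 1 - k.gamma - k.alpha := by
    rw [hf]; unfold corrLead gamma; field_simp; ring
  set D := |f| * C2 + |e| * |2 / √k.disc| * (Real.pi / 2) + C1 with hD
  have key : ∀ s, |k.logProfile s + Real.log (k.weight s) - Real.log (1 + Real.exp s)| ≤ D := by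
    intro s
    have e1 := h1 s
    have e2 := h2 (Real.exp s) (Real.exp_pos s).le
    set at' := Real.arctan ((2 * (k.a₀ + k.b₀) * Real.exp s + (k.a₁ + k.b₁)) / √k.disc) with hat
    have e3 : |at'| ≤ Real.pi / 2 := abs_le.2 ⟨(Real.neg_pi_div_two_lt_arctan _).le, (Real.arctan_lt_pi_div_two _).le⟩
    have : k.logProfile s + Real.log (k.weight s) - Real.log (1 + Real.exp s) =
        f * (Real.log (k.quad (Real.exp s)) - 2 * Real.log (1 + Real.exp s)) +
        e * (2 / √k.disc) * at' + (Real.log (k.weight s) -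
    (-k.alpha * s + (k.alpha + k.gamma) * Real.log (1 + Real.exp s))) := by
      unfold logProfile corr
      rw [← he, ← hf, ← hat]
      linear_combination (Real.log (1 + Real.exp s)) * hf'
    rw [this, hD]
    refine (abs_add_le _ _).trans (add_le_add ((abs_add_le _ _).trans (add_le_add ?_ ?_)) e1)
    · rw [abs_mul]; gcongr
    · rw [abs_mul, abs_mul]; gcongr
  have hD0 : 0 ≤ D := (abs_nonneg _).trans (key 0)
  refine ⟨Real.exp D, Real.one_le_exp hD0, fun s => ?_⟩
  have hw := k.weight_pos s
  have h3 := abs_le.1 (key s)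
  have hE : 0 < 1 + Real.exp s := by positivity
  have e1 : k.weight s = Real.exp (Real.log (k.weight s)) := (Real.exp_log hw).symm
  have e2 : 1 + Real.exp s = Real.exp (Real.log (1 + Real.exp s)) := (Real.exp_log hE).symm
  rw [e1, e2, ← Real.exp_add, ← Real.exp_add, ← Real.exp_add]
  constructor <;> apply Real.exp_le_exp.2 <;> linarith

theorem exists_timeDensity_le : ∃ C, 0 < C ∧ ∀ s,
    k.timeDensity s ≤ C * Real.exp (2 * k.alpha * s) ∧
    k.timeDensity s ≤ C * Real.exp (-(2 * k.gamma * s)) := by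
  obtain ⟨C, hC, h⟩ := k.exists_profile_bounds
  have he := k.ell_pos
  refine ⟨C ^ 2 / (k.ell / 2), by positivity, fun s => ?_⟩
  have h1 := (h s).1
  have hw := k.weight_pos s
  have h2 : Real.exp (k.logProfile s) ≤ C * (1 + Real.exp s) / k.weight s := by
    rwa [le_div_iff₀ hw]
  have h3 : k.timeDensity s ≤ C ^ 2 / (k.ell / 2) * (1 / k.weight s) ^ 2 := by
    unfold timeDensity
    rw [div_le_iff₀ (k.quad_pos _), mul_comm 2, Real.exp_mul]
    have h4 := k.ell_le_quad (Real.exp s)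
    calc Real.exp (k.logProfile s) ^ (2 : ℝ) = Real.exp (k.logProfile s) ^ 2 := by norm_num
      _ ≤ (C * (1 + Real.exp s) / k.weight s) ^ 2 := by gcongr
      _ = C ^ 2 / (k.ell / 2) * (1 / k.weight s) ^ 2 * (k.ell / 2 * (1 + Real.exp s) ^ 2) := by
        field_simp
      _ ≤ _ := by gcongr
  have h5 : 1 / k.weight s ≤ Real.exp (k.alpha * s) := by
    rw [div_le_iff₀ hw]; unfold weight; rw [mul_add, ← Real.exp_add]
    have : k.alpha * s + -k.alpha * s = 0 := by ring
    rw [this, Real.exp_zero]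
    have := mul_pos (Real.exp_pos (k.alpha * s)) (Real.exp_pos (k.gamma * s))
    linarith
  have h6 : 1 / k.weight s ≤ Real.exp (-(k.gamma * s)) := by
    rw [div_le_iff₀ hw]; unfold weight; rw [mul_add, ← Real.exp_add, ← Real.exp_add]
    have : -(k.gamma * s) + k.gamma * s = 0 := by ring
    rw [this, Real.exp_zero]
    linarith [Real.exp_pos (-(k.gamma * s) + -k.alpha * s)]
  constructor
  · refine h3.trans ?_
    calc _ ≤ C ^ 2 / (k.ell / 2) * Real.exp (k.alpha * s) ^ 2 := by gcongr
      _ = _ := by rw [← Real.exp_nat_mul]; push_cast; ring_nf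
  · refine h3.trans ?_
    calc _ ≤ C ^ 2 / (k.ell / 2) * Real.exp (-(k.gamma * s)) ^ 2 := by gcongr
      _ = _ := by rw [← Real.exp_nat_mul]; push_cast; ring_nf

/-- The normalized passage time has finite limits at both ends, and its tail at the unstable end is
exponentially small. -/
theorem exists_passTime_limits : ∃ L₀ L₁ C, L₀ < L₁ ∧ 0 < C ∧
    Tendsto k.passTime atBot (𝓝 L₀) ∧ Tendsto k.passTime atTop (𝓝 L₁) ∧
    (∀ s, L₀ ≤ k.passTime s) ∧
    (∀ s, k.passTime s ≤ L₁) ∧ ∀ s, L₁ - k.passTime s ≤ C * Real.exp (-(2 * k.gamma * s)) := by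
  obtain ⟨C, hC, h⟩ := k.exists_timeDensity_le
  have ha := k.alpha_pos
  have hg := k.gamma_pos
  have hm := k.strictMono_passTime
  have m1 : Antitone fun s => k.passTime s - C / (2 * k.alpha) * Real.exp (2 * k.alpha * s) := by
    refine antitone_of_hasDerivAt_nonpos (f' := fun s => k.timeDensity s -
      C * Real.exp (2 * k.alpha * s)) (fun s => ?_) fun s => sub_nonpos.2 (h s).1
    have h1 := (((hasDerivAt_id s).const_mul (2 * k.alpha)).exp).const_mul (C / (2 * k.alpha))
    refine ((k.hasDerivAt_passTime s).sub h1).congr_deriv ?_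
    simp; field_simp
  have m2 : Antitone fun s => k.passTime s + C / (2 * k.gamma) *
      Real.exp (-(2 * k.gamma * s)) := by
    refine antitone_of_hasDerivAt_nonpos (f' := fun s => k.timeDensity s -
      C * Real.exp (-(2 * k.gamma * s))) (fun s => ?_) fun s => sub_nonpos.2 (h s).2
    have h1 := (((hasDerivAt_id s).const_mul (2 * k.gamma)).neg.exp).const_mul (C / (2 * k.gamma))
    refine ((k.hasDerivAt_passTime s).add h1).congr_deriv ?_
    simp; field_simp; ring
  have bdB : BddBelow (Set.range k.passTime) := by
    refine ⟨k.passTime 0 - C / (2 * k.alpha) * Real.exp (2 * k.alpha * 0), ?_⟩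
    rintro _ ⟨s, rfl⟩
    rcases le_total s 0 with hs | hs
    · have := m1 hs
      simp only at this
      have h2 : 0 < C / (2 * k.alpha) * Real.exp (2 * k.alpha * s) := by positivity
      linarith
    · have := hm.monotone hs
      have h2 : 0 < C / (2 * k.alpha) * Real.exp (2 * k.alpha * 0) := by positivity
      linarith
  have tail : ∀ s s', k.passTime s' ≤ k.passTime s + C / (2 * k.gamma) *
      Real.exp (-(2 * k.gamma * s)) := by
    intro s s'
    have p1 : 0 < C / (2 * k.gamma) * Real.exp (-(2 * k.gamma * s)) := by positivity
    have p2 : 0 < C / (2 * k.gamma) * Real.exp (-(2 * k.gamma * s')) := by positivity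
    rcases le_total s s' with hs | hs
    · have := m2 hs
      simp only at this
      linarith
    · linarith [hm.monotone hs]
  have bdA : BddAbove (Set.range k.passTime) := by
    refine ⟨k.passTime 0 + C / (2 * k.gamma) * Real.exp (-(2 * k.gamma * 0)), ?_⟩
    rintro _ ⟨s, rfl⟩
    exact tail 0 s
  refine ⟨⨅ s, k.passTime s, ⨆ s, k.passTime s, C / (2 * k.gamma), ?_, by positivity,
    tendsto_atBot_ciInf hm.monotone bdB, tendsto_atTop_ciSup hm.monotone bdA,
    fun s => ciInf_le bdB s, fun s => le_ciSup bdA s, fun s => ?_⟩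
  · calc _ ≤ k.passTime 0 := ciInf_le bdB 0
      _ < k.passTime 1 := hm one_pos
      _ ≤ _ := le_ciSup bdA 1
  · have := ciSup_le (tail s)
    linarith

end

end SaddleCoeffs

theorem le_of_hasDerivAt_nonpos {f : ℝ → ℝ} {a b : ℝ} (hab : a ≤ b)
    (h : ∀ t ∈ Set.Icc a b, ∃ d, HasDerivAt f d t ∧ d ≤ 0) : f b ≤ f a := by
  refine antitoneOn_of_deriv_nonpos (convex_Icc a b) (fun t ht => ?_) (fun t ht => ?_)
    (fun t ht => ?_) (Set.left_mem_Icc.2 hab) (Set.right_mem_Icc.2 hab) hab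
  · obtain ⟨d, hd, -⟩ := h t ht
    exact hd.continuousAt.continuousWithinAt
  · obtain ⟨d, hd, -⟩ := h t (interior_subset ht)
    exact hd.differentiableAt.differentiableWithinAt
  · obtain ⟨d, hd, h0⟩ := h t (interior_subset ht)
    rwa [hd.deriv]

namespace SaddleCoeffs

noncomputable section

variable (k : SaddleCoeffs)

/-- At time `t` the curve `(x, y)` lies in the open positive quadrant and solves the cubic saddle
equation up to relative errors of size `K max(x, y)³`. -/
def IsOrbitAt (K : ℝ) (x y : ℝ → ℝ) (t : ℝ) : Prop :=
  0 < x t ∧ 0 < y t ∧ ∃ r₁ r₂ : ℝ, |r₁| ≤ K * max (x t) (y t) ^ 3 ∧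
    |r₂| ≤ K * max (x t) (y t) ^ 3 ∧
    HasDerivAt x (x t * (k.a₀ * x t ^ 2 + k.a₁ * x t * y t + k.a₂ * y t ^ 2 + r₁)) t ∧
    HasDerivAt y (-(y t * (k.b₀ * x t ^ 2 + k.b₁ * x t * y t + k.b₂ * y t ^ 2 + r₂))) t

/-- The logarithm of the first integral of the cubic field. -/
def energy (x y : ℝ) : ℝ := Real.log y + k.logProfile (Real.log x - Real.log y)

theorem sq_mul_quad_eq {x y : ℝ} (hx : 0 < x) (hy : 0 < y) :
    y ^ 2 * k.quad (Real.exp (Real.log x - Real.log y)) =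
      (k.a₀ + k.b₀) * x ^ 2 + (k.a₁ + k.b₁) * x * y + (k.a₂ + k.b₂) * y ^ 2 := by
  rw [Real.exp_sub, Real.exp_log hx, Real.exp_log hy]
  unfold quad; field_simp

theorem ell_mul_max_le {x y : ℝ} (hx : 0 < x) (hy : 0 < y) :
    k.ell * max x y ^ 2 ≤ y ^ 2 * k.quad (Real.exp (Real.log x - Real.log y)) := by
  rw [k.sq_mul_quad_eq hx hy]
  refine le_trans ?_ (k.ell_mul_le_form x y)
  have := k.ell_pos
  gcongr
  rcases max_cases x y with ⟨h, -⟩ | ⟨h, -⟩ <;> rw [h] <;> nlinarith [sq_nonneg x, sq_nonneg y]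

/-- The product of first integral and weight is comparable to the distance from the origin. -/
theorem exists_energy_bounds : ∃ C, 1 ≤ C ∧ ∀ x y : ℝ, 0 < x → 0 < y →
    Real.exp (k.energy x y) * k.weight (Real.log x - Real.log y) ≤ C * max x y ∧
    max x y ≤ C * (Real.exp (k.energy x y) * k.weight (Real.log x - Real.log y)) := by
  obtain ⟨C, hC, h⟩ := k.exists_profile_bounds
  refine ⟨2 * C, by linarith, fun x y hx hy => ?_⟩
  obtain ⟨h1, h2⟩ := h (Real.log x - Real.log y)
  have e : y * (1 + Real.exp (Real.log x - Real.log y)) = x + y := by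
    rw [Real.exp_sub, Real.exp_log hx, Real.exp_log hy]; field_simp; ring
  have m1 : x + y ≤ 2 * max x y := by linarith [le_max_left x y, le_max_right x y]
  have m2 : max x y ≤ x + y := max_le (by linarith) (by linarith)
  have m3 : 0 < max x y := lt_max_of_lt_left hx
  have h1' := mul_le_mul_of_nonneg_left h1 hy.le
  have h2' := mul_le_mul_of_nonneg_left h2 hy.le
  unfold energy
  rw [Real.exp_add, Real.exp_log hy]
  have := mul_le_mul_of_nonneg_left m1 (by linarith : 0 ≤ C)
  have e' : C * (y * (1 + Real.exp (Real.log x - Real.log y))) = C * (x + y) := by rw [e]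
  constructor
  · calc _ = y * (Real.exp (k.logProfile (Real.log x - Real.log y)) *
          k.weight (Real.log x - Real.log y)) := by ring
      _ ≤ y * (C * (1 + Real.exp (Real.log x - Real.log y))) := h1'
      _ = C * (x + y) := by rw [← e']; ring
      _ ≤ _ := by linarith
  · have w0 := k.weight_pos (Real.log x - Real.log y)
    calc _ ≤ x + y := m2
      _ = y * (1 + Real.exp (Real.log x - Real.log y)) := e.symm
      _ ≤ _ := h2'
      _ = C * (y * Real.exp (k.logProfile (Real.log x - Real.log y)) *
          k.weight (Real.log x - Real.log y)) := by ring
      _ ≤ _ := by gcongr; linarith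

theorem exists_orbit_derivs : ∃ C, 0 < C ∧ ∀ K x y t, 0 ≤ K → k.IsOrbitAt K x y t →
    ∃ S J : ℝ, HasDerivAt (fun t => Real.log (x t) - Real.log (y t)) S t ∧
      HasDerivAt (fun t => k.energy (x t) (y t)) J t ∧
      |S - y t ^ 2 * k.quad (Real.exp (Real.log (x t) - Real.log (y t)))| ≤
        2 * K * max (x t) (y t) ^ 3 ∧
      |J| ≤ C * K * max (x t) (y t) ^ 3 := by
  obtain ⟨C, hC, h⟩ := k.exists_numer_le
  refine ⟨1 + 2 * C, by positivity, fun K x y t hK ⟨hx, hy, r₁, r₂, h1, h2, dx, dy⟩ => ?_⟩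
  set s := Real.log (x t) - Real.log (y t) with hs
  have dlx := dx.log hx.ne'
  have dly := dy.log hy.ne'
  have ds := dlx.sub dly
  have eS : x t * (k.a₀ * x t ^ 2 + k.a₁ * x t * y t + k.a₂ * y t ^ 2 + r₁) / x t -
      -(y t * (k.b₀ * x t ^ 2 + k.b₁ * x t * y t + k.b₂ * y t ^ 2 + r₂)) / y t =
      y t ^ 2 * k.quad (Real.exp s) + (r₁ + r₂) := by
    rw [k.sq_mul_quad_eq hx hy]; field_simp; ring
  rw [eS] at ds
  have dJ := dly.add ((k.hasDerivAt_logProfile s).comp t ds)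
  refine ⟨_, _, ds, dJ, ?_, ?_⟩
  · rw [add_sub_cancel_left]
    exact (abs_add_le _ _).trans (by linarith)
  · have hq := (k.quad_pos (Real.exp s)).ne'
    have en : y t ^ 2 * k.numer (Real.exp s) =
        k.b₀ * x t ^ 2 + k.b₁ * x t * y t + k.b₂ * y t ^ 2 := by
      rw [hs, Real.exp_sub, Real.exp_log hx, Real.exp_log hy]; unfold numer; field_simp
    have e2 : -(y t * (k.b₀ * x t ^ 2 + k.b₁ * x t * y t + k.b₂ * y t ^ 2 + r₂)) / y t +
        k.numer (Real.exp s) / k.quad (Real.exp s) * (y t ^ 2 * k.quad (Real.exp s) + (r₁ + r₂)) =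
        -r₂ + k.numer (Real.exp s) / k.quad (Real.exp s) * (r₁ + r₂) := by
      rw [← en]; field_simp; ring
    rw [e2]
    refine (abs_add_le _ _).trans ?_
    rw [abs_neg, abs_mul]
    have b := h (Real.exp s) (Real.exp_pos s).le
    have b2 : |r₁ + r₂| ≤ 2 * (K * max (x t) (y t) ^ 3) := (abs_add_le _ _).trans (by linarith)
    have := mul_le_mul b b2 (abs_nonneg _) hC.le
    linarith

/-- Derivatives along an orbit of the first integral, of the Lyapunov function, and of the
normalized passage time. -/
theorem exists_deriv_bounds (K : ℝ) (hK : 0 ≤ K) : ∃ ε₁ A c, 0 < ε₁ ∧ 0 ≤ A ∧ 0 < c ∧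
    ∀ (x y : ℝ → ℝ) (t : ℝ), k.IsOrbitAt K x y t → max (x t) (y t) ≤ ε₁ →
    ∃ J d p, HasDerivAt (fun t => k.energy (x t) (y t)) J t ∧
      HasDerivAt (fun t => Real.exp (k.energy (x t) (y t)) *
        k.lyap (Real.log (x t) - Real.log (y t))) d t ∧
      HasDerivAt (fun t => k.passTime (Real.log (x t) - Real.log (y t))) p t ∧
      |J| ≤ A * max (x t) (y t) ^ 3 ∧ d ≤ -(c * max (x t) (y t) ^ 3) ∧
      |p - Real.exp (2 * k.energy (x t) (y t))| ≤
        A * max (x t) (y t) * Real.exp (2 * k.energy (x t) (y t)) := by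
  obtain ⟨C₁, hC₁, hder⟩ := k.exists_orbit_derivs
  obtain ⟨C₂, hC₂, hen⟩ := k.exists_energy_bounds
  have he := k.ell_pos
  obtain ⟨m, hm⟩ : ∃ m, m = min k.alpha k.gamma := ⟨_, rfl⟩
  have hm0 : 0 < m := hm ▸ lt_min k.alpha_pos k.gamma_pos
  refine ⟨min (k.ell / (4 * K + 1)) (m * k.ell / (4 * C₁ * K + 1)), C₁ * K + 2 * K / k.ell,
    m * k.ell / (4 * C₂), lt_min (by positivity) (by positivity), by positivity, by positivity,
    fun x y t horb hρ => ?_⟩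
  obtain ⟨S, J, dS, dJ, bS, bJ⟩ := hder K x y t hK horb
  obtain ⟨hx, hy, -⟩ := horb
  have hell := k.ell_mul_max_le hx hy
  have hel := (hen (x t) (y t) hx hy).2
  have ρ0 : 0 < max (x t) (y t) := lt_max_of_lt_left hx
  generalize hρdef : max (x t) (y t) = ρ at *
  have hρ1 : 4 * K * ρ ≤ k.ell := by
    have := hρ.trans (min_le_left _ _)
    rw [le_div_iff₀ (by positivity)] at this
    linarith
  have hρ2 : 4 * C₁ * K * ρ ≤ m * k.ell := by
    have := hρ.trans (min_le_right _ _)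
    rw [le_div_iff₀ (by positivity)] at this
    linarith
  have dg := dJ.exp.mul ((k.hasDerivAt_lyap _).comp t dS)
  have dp := (k.hasDerivAt_passTime _).comp t dS
  refine ⟨J, _, _, dJ, dg, dp, bJ.trans ?_, ?_, ?_⟩
  · gcongr
    have : 0 ≤ 2 * K / k.ell := by positivity
    linarith
  · simp only [Function.comp]
    generalize Real.log (x t) - Real.log (y t) = s at *
    generalize k.energy (x t) (y t) = E at *
    have w0 := k.weight_pos s
    have l1 := k.abs_lyap_le s
    have l2 := k.min_mul_weight_le s
    rw [← hm] at l2
    have S1 : k.ell / 2 * ρ ^ 2 ≤ S := by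
      have h2 := (abs_le.1 bS).1
      have h3 := mul_le_mul_of_nonneg_right hρ1 (sq_nonneg ρ)
      have h4 : 4 * K * ρ * ρ ^ 2 = 2 * (2 * K * ρ ^ 3) := by ring
      linarith
    have t1 : k.lyap s * J ≤ k.weight s * (C₁ * K * ρ ^ 3) := by
      refine (le_abs_self _).trans ?_
      rw [abs_mul]
      exact mul_le_mul l1 bJ (abs_nonneg _) w0.le
    have t2 : m * k.weight s * (k.ell / 2 * ρ ^ 2) ≤
        (k.alpha * Real.exp (-k.alpha * s) + k.gamma * Real.exp (k.gamma * s)) * S := by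
      apply mul_le_mul l2 S1 (by positivity)
      have := k.alpha_pos; have := k.gamma_pos; positivity
    have t3 : C₁ * K * ρ ^ 3 ≤ m * k.ell / 4 * ρ ^ 2 := by
      have h3 := mul_le_mul_of_nonneg_right hρ2 (sq_nonneg ρ)
      have h4 : 4 * C₁ * K * ρ * ρ ^ 2 = 4 * (C₁ * K * ρ ^ 3) := by ring
      linarith
    have t4 : k.weight s * (C₁ * K * ρ ^ 3) ≤ k.weight s * (m * k.ell / 4 * ρ ^ 2) := by
      gcongr
    have t5 : k.lyap s * J - (k.alpha * Real.exp (-k.alpha * s) +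
        k.gamma * Real.exp (k.gamma * s)) * S ≤ -(k.weight s * (m * k.ell / 4 * ρ ^ 2)) := by
      have : m * k.weight s * (k.ell / 2 * ρ ^ 2) = 2 * (k.weight s * (m * k.ell / 4 * ρ ^ 2)) := by
        ring
      linarith
    have t6 := mul_le_mul_of_nonneg_left t5 (Real.exp_pos E).le
    have t7 : m * k.ell / (4 * C₂) * ρ ^ 3 ≤
        Real.exp E * (k.weight s * (m * k.ell / 4 * ρ ^ 2)) := by
      calc m * k.ell / (4 * C₂) * ρ ^ 3 = m * k.ell / (4 * C₂) * ρ ^ 2 * ρ := by ring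
        _ ≤ m * k.ell / (4 * C₂) * ρ ^ 2 * (C₂ * (Real.exp E * k.weight s)) := by gcongr
        _ = _ := by field_simp
    calc _ = Real.exp E * (k.lyap s * J - (k.alpha * Real.exp (-k.alpha * s) +
        k.gamma * Real.exp (k.gamma * s)) * S) := by ring
      _ ≤ _ := by linarith
  · obtain ⟨F, hF⟩ : ∃ F, F = y t ^ 2 * k.quad (Real.exp (Real.log (x t) - Real.log (y t))) :=
      ⟨_, rfl⟩
    have hF0 : 0 < F := hF ▸ mul_pos (by positivity) (k.quad_pos _)
    have e1 : k.timeDensity (Real.log (x t) - Real.log (y t)) =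
        Real.exp (2 * k.energy (x t) (y t)) / F := by
      simp only [energy, timeDensity, hF]
      rw [mul_add, Real.exp_add, two_mul (Real.log (y t)), Real.exp_add, Real.exp_log hy]
      have := (k.quad_pos (Real.exp (Real.log (x t) - Real.log (y t)))).ne'
      field_simp
    rw [← hF] at bS hell
    have b1 : |S - F| ≤ (C₁ * K + 2 * K / k.ell) * ρ * F := by
      refine bS.trans ?_
      calc 2 * K * ρ ^ 3 = (2 * K / k.ell) * ρ * (k.ell * ρ ^ 2) := by field_simp
        _ ≤ (C₁ * K + 2 * K / k.ell) * ρ * F := by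
          gcongr
          have : 0 ≤ C₁ * K := by positivity
          linarith
    rw [e1]
    have e3 : Real.exp (2 * k.energy (x t) (y t)) / F * S - Real.exp (2 * k.energy (x t) (y t)) =
        Real.exp (2 * k.energy (x t) (y t)) / F * (S - F) := by field_simp
    rw [e3, abs_mul, abs_of_pos (div_pos (Real.exp_pos _) hF0)]
    calc _ ≤ Real.exp (2 * k.energy (x t) (y t)) / F * ((C₁ * K + 2 * K / k.ell) * ρ * F) := by
          gcongr
      _ = _ := by field_simp

/-- Along an orbit inside the square of size `δ`, the first integral is constant up to a relative
error `O(δ)`, and the normalized passage time grows linearly up to the same relative error. -/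
theorem exists_passage_estimates (K : ℝ) (hK : 0 ≤ K) : ∃ ε₀ C, 0 < ε₀ ∧ 0 < C ∧ C * ε₀ ≤ 1 / 2 ∧
    ∀ (δ t₁ t₂ : ℝ) (x y : ℝ → ℝ), δ ≤ ε₀ → t₁ ≤ t₂ →
    (∀ t ∈ Set.Icc t₁ t₂, k.IsOrbitAt K x y t ∧ x t ≤ δ ∧ y t ≤ δ) →
    |k.energy (x t₂) (y t₂) - k.energy (x t₁) (y t₁)| ≤ C * δ ∧
    Real.exp (k.energy (x t₂) (y t₂)) * k.lyap (Real.log (x t₂) - Real.log (y t₂)) ≤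
      Real.exp (k.energy (x t₁) (y t₁)) * k.lyap (Real.log (x t₁) - Real.log (y t₁)) ∧
    (1 - C * δ) * Real.exp (2 * k.energy (x t₁) (y t₁)) * (t₂ - t₁) ≤
      k.passTime (Real.log (x t₂) - Real.log (y t₂)) -
        k.passTime (Real.log (x t₁) - Real.log (y t₁)) ∧
    k.passTime (Real.log (x t₂) - Real.log (y t₂)) -
        k.passTime (Real.log (x t₁) - Real.log (y t₁)) ≤
      (1 + C * δ) * Real.exp (2 * k.energy (x t₁) (y t₁)) * (t₂ - t₁) := by
  obtain ⟨ε₁, A, c, hε₁, hA, hc, hder⟩ := k.exists_deriv_bounds K hK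
  obtain ⟨C₂, hC₂, hen⟩ := k.exists_energy_bounds
  obtain ⟨B, hB⟩ : ∃ B, B = A / c * (2 * C₂) := ⟨_, rfl⟩
  have hB0 : 0 ≤ B := hB ▸ by positivity
  obtain ⟨C, hC⟩ : ∃ C, C = 1 + A + 5 * B + 4 * A * B := ⟨_, rfl⟩
  have hAB : 0 ≤ A * B := by positivity
  have hC0 : 0 < C := hC ▸ by positivity
  refine ⟨min ε₁ (1 / (2 * C + 1)), C, by positivity, hC0, ?_, ?_⟩
  · have h1 : C * min ε₁ (1 / (2 * C + 1)) ≤ C * (1 / (2 * C + 1)) := by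
      gcongr; exact min_le_right _ _
    refine h1.trans ?_
    rw [mul_one_div, div_le_div_iff₀ (by positivity) two_pos]
    linarith
  intro δ t₁ t₂ x y hδ ht horb
  have hδ0 : 0 < δ := by
    have := horb t₁ (Set.left_mem_Icc.2 ht)
    exact this.1.1.trans_le this.2.1
  have hδ' : (2 * C + 1) * δ ≤ 1 := by
    have := hδ.trans (min_le_right _ _)
    rw [le_div_iff₀ (by positivity)] at this
    linarith
  have hCδ : 0 ≤ C * δ := by positivity
  have hδ1 : δ ≤ 1 := by linarith
  have hδ2 : C * δ ≤ 1 / 2 := by linarith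
  have hAδ : A * δ ≤ 1 := by
    have : A * δ ≤ C * δ := by gcongr; linarith
    linarith
  have hBδ : 2 * B * δ ≤ 1 := by
    have : 2 * B * δ ≤ C * δ := by gcongr; linarith
    linarith
  set s : ℝ → ℝ := fun t => Real.log (x t) - Real.log (y t) with hs
  set E : ℝ → ℝ := fun t => k.energy (x t) (y t) with hE
  set g : ℝ → ℝ := fun t => Real.exp (E t) * k.lyap (s t) with hg
  have hρ : ∀ t ∈ Set.Icc t₁ t₂, 0 < max (x t) (y t) ∧ max (x t) (y t) ≤ δ := fun t h =>
    ⟨lt_max_of_lt_left (horb t h).1.1, max_le (horb t h).2.1 (horb t h).2.2⟩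
  have hgd : ∀ t ∈ Set.Icc t₁ t₂, ∃ J d p, HasDerivAt E J t ∧ HasDerivAt g d t ∧
      HasDerivAt (fun t => k.passTime (s t)) p t ∧
      |J| ≤ A * max (x t) (y t) ^ 3 ∧ d ≤ -(c * max (x t) (y t) ^ 3) ∧
      |p - Real.exp (2 * E t)| ≤ A * max (x t) (y t) * Real.exp (2 * E t) := fun t h =>
    hder x y t (horb t h).1 ((hρ t h).2.trans (hδ.trans (min_le_left _ _)))
  have hgb : ∀ t ∈ Set.Icc t₁ t₂, |g t| ≤ C₂ * δ := by
    intro t h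
    have h1 := (hen (x t) (y t) (horb t h).1.1 (horb t h).1.2.1).1
    simp only [hg]
    rw [abs_mul, abs_of_pos (Real.exp_pos _)]
    calc _ ≤ Real.exp (E t) * k.weight (s t) := by gcongr; exact k.abs_lyap_le _
      _ ≤ _ := h1
      _ ≤ _ := by gcongr; exact (hρ t h).2
  have sub : ∀ {t}, t ∈ Set.Icc t₁ t₂ → ∀ {u}, u ∈ Set.Icc t₁ t → u ∈ Set.Icc t₁ t₂ :=
    fun h _ hu => ⟨hu.1, hu.2.trans h.2⟩
  have hgm : ∀ t ∈ Set.Icc t₁ t₂, g t ≤ g t₁ := by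
    intro t h
    refine le_of_hasDerivAt_nonpos h.1 fun u hu => ?_
    obtain ⟨J, d, p, -, dd, -, -, hd, -⟩ := hgd u (sub h hu)
    refine ⟨d, dd, hd.trans ?_⟩
    have := (hρ u (sub h hu)).1
    rw [neg_nonpos]; positivity
  have hEb : ∀ t ∈ Set.Icc t₁ t₂, |E t - E t₁| ≤ B * δ := by
    intro t h
    have hAc : A / c * c = A := by field_simp
    have hAc0 : 0 ≤ A / c := by positivity
    have u1 : E t + A / c * g t ≤ E t₁ + A / c * g t₁ := by
      refine le_of_hasDerivAt_nonpos (f := fun t => E t + A / c * g t) h.1 fun u hu => ?_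
      obtain ⟨J, d, p, dJ, dd, -, hJ, hd, -⟩ := hgd u (sub h hu)
      refine ⟨_, dJ.add (dd.const_mul (A / c)), ?_⟩
      have := mul_le_mul_of_nonneg_left hd hAc0
      have h3 := (abs_le.1 hJ).2
      rw [mul_neg, ← mul_assoc, hAc] at this
      linarith
    have u2 : -E t + A / c * g t ≤ -E t₁ + A / c * g t₁ := by
      refine le_of_hasDerivAt_nonpos (f := fun t => -E t + A / c * g t) h.1 fun u hu => ?_
      obtain ⟨J, d, p, dJ, dd, -, hJ, hd, -⟩ := hgd u (sub h hu)
      refine ⟨_, dJ.neg.add (dd.const_mul (A / c)), ?_⟩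
      have := mul_le_mul_of_nonneg_left hd hAc0
      have h3 := (abs_le.1 hJ).1
      rw [mul_neg, ← mul_assoc, hAc] at this
      linarith
    have b1 := hgb t h
    have b2 := hgb t₁ (Set.left_mem_Icc.2 ht)
    rw [abs_le] at b1 b2 ⊢
    have : A / c * (g t₁ - g t) ≤ B * δ := by
      rw [hB, mul_assoc]; gcongr; linarith
    constructor <;> linarith
  have hEr : ∀ t ∈ Set.Icc t₁ t₂, (1 - 2 * B * δ) * Real.exp (2 * E t₁) ≤ Real.exp (2 * E t) ∧
      Real.exp (2 * E t) ≤ (1 + 4 * B * δ) * Real.exp (2 * E t₁) := by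
    intro t h
    have b := abs_le.1 (hEb t h)
    have e1 : Real.exp (2 * E t) = Real.exp (2 * (E t - E t₁)) * Real.exp (2 * E t₁) := by
      rw [← Real.exp_add]; ring_nf
    rw [e1]
    constructor
    · gcongr
      have := Real.add_one_le_exp (2 * (E t - E t₁))
      linarith
    · gcongr
      calc Real.exp (2 * (E t - E t₁)) ≤ Real.exp (2 * B * δ) := by
            apply Real.exp_le_exp.2; linarith
        _ ≤ 1 + 2 * B * δ + (2 * B * δ) ^ 2 := by
            have := Real.abs_exp_sub_one_sub_id_le (x := 2 * B * δ)
              (by rw [abs_of_nonneg (by positivity)]; exact hBδ)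
            have := (abs_le.1 this).2
            linarith
        _ ≤ 1 + 4 * B * δ := by
            have : 0 ≤ 2 * B * δ := by positivity
            have := mul_le_mul_of_nonneg_left hBδ this
            linarith
  have hPd : ∀ t ∈ Set.Icc t₁ t₂, ∃ d, HasDerivAt (fun t => k.passTime (s t)) d t ∧
      (1 - A * δ) * Real.exp (2 * E t) ≤ d ∧ d ≤ (1 + A * δ) * Real.exp (2 * E t) := by
    intro t h
    obtain ⟨J, d, p, -, -, dp, -, -, hp⟩ := hgd t h
    have h1 : A * max (x t) (y t) * Real.exp (2 * E t) ≤ A * δ * Real.exp (2 * E t) := by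
      gcongr; exact (hρ t h).2
    have h2 := abs_le.1 (hp.trans h1)
    exact ⟨p, dp, by linarith, by linarith⟩
  have p1 := Real.exp_pos (2 * E t₁)
  have hABδ : 0 ≤ A * B * δ := by positivity
  have hBδ0 : 0 ≤ B * δ := by positivity
  have hABδδ : 0 ≤ A * B * δ * δ := by positivity
  have hABδδ' : A * B * δ * δ ≤ A * B * δ * 1 := by gcongr
  refine ⟨(hEb t₂ (Set.right_mem_Icc.2 ht)).trans ?_, hgm t₂ (Set.right_mem_Icc.2 ht), ?_, ?_⟩
  · gcongr
    linarith
  · have := le_of_hasDerivAt_nonpos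
      (f := fun t => (1 - C * δ) * Real.exp (2 * E t₁) * t - k.passTime (s t)) ht fun u hu => by
        obtain ⟨d, dd, h1, -⟩ := hPd u hu
        refine ⟨_, ((hasDerivAt_id u).const_mul _).sub dd, ?_⟩
        have h3 := mul_le_mul_of_nonneg_left (hEr u hu).1 (sub_nonneg.2 hAδ)
        have h4 : (1 - C * δ) * Real.exp (2 * E t₁) ≤
            (1 - A * δ) * ((1 - 2 * B * δ) * Real.exp (2 * E t₁)) := by
          rw [← mul_assoc]
          refine mul_le_mul_of_nonneg_right ?_ p1.le
          rw [hC]; linarith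
        linarith
    linarith
  · have := le_of_hasDerivAt_nonpos
      (f := fun t => k.passTime (s t) - (1 + C * δ) * Real.exp (2 * E t₁) * t) ht fun u hu => by
        obtain ⟨d, dd, -, h1⟩ := hPd u hu
        refine ⟨_, dd.sub ((hasDerivAt_id u).const_mul _), ?_⟩
        have h3 := mul_le_mul_of_nonneg_left (hEr u hu).2 (by positivity : 0 ≤ 1 + A * δ)
        have h4 : (1 + A * δ) * ((1 + 4 * B * δ) * Real.exp (2 * E t₁)) ≤
            (1 + C * δ) * Real.exp (2 * E t₁) := by
          rw [← mul_assoc]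
          refine mul_le_mul_of_nonneg_right ?_ p1.le
          rw [hC]; linarith
        linarith
    linarith

/-- A uniform bound on the time that an orbit can spend near the origin, in terms of its initial
point. -/
theorem exists_duration_bound (K : ℝ) (hK : 0 ≤ K) : ∃ ε₀ C, 0 < ε₀ ∧ 0 < C ∧
    ∀ (t₁ t₂ : ℝ) (x y : ℝ → ℝ), t₁ ≤ t₂ →
    (∀ t ∈ Set.Icc t₁ t₂, k.IsOrbitAt K x y t ∧ x t ≤ ε₀ ∧ y t ≤ ε₀) →
    (y t₁ ≤ x t₁ → (t₂ - t₁) * x t₁ ^ 2 ≤ C) ∧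
    (x t₁ ≤ y t₁ → (t₂ - t₁) * y t₁ ^ 2 * (x t₁ / y t₁) ^ (2 * k.alpha) ≤ C) := by
  obtain ⟨ε₀, C, hε₀, hC, hCε, h⟩ := k.exists_passage_estimates K hK
  obtain ⟨C₂, hC₂, hen⟩ := k.exists_energy_bounds
  obtain ⟨L₀, L₁, C₃, hL, hC₃, -, -, hL₀, hL₁, htail⟩ := k.exists_passTime_limits
  refine ⟨ε₀, 8 * C₂ ^ 2 * (C₃ + (L₁ - L₀)), hε₀, by have := sub_pos.2 hL; positivity,
    fun t₁ t₂ x y ht horb => ?_⟩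
  obtain ⟨-, -, h1, -⟩ := h ε₀ t₁ t₂ x y le_rfl ht horb
  obtain ⟨⟨hx, hy, -⟩, -, -⟩ := horb t₁ (Set.left_mem_Icc.2 ht)
  have hen' := (hen (x t₁) (y t₁) hx hy).2
  set s := Real.log (x t₁) - Real.log (y t₁) with hs
  set E := k.energy (x t₁) (y t₁) with hE
  have h2 : Real.exp (2 * E) * (t₂ - t₁) ≤ 2 * (L₁ - k.passTime s) := by
    have a1 := hL₁ (Real.log (x t₂) - Real.log (y t₂))
    have a2 : 1 / 2 * (Real.exp (2 * E) * (t₂ - t₁)) ≤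
        (1 - C * ε₀) * (Real.exp (2 * E) * (t₂ - t₁)) := by
      have : 0 ≤ Real.exp (2 * E) * (t₂ - t₁) :=
        mul_nonneg (Real.exp_pos _).le (sub_nonneg.2 ht)
      gcongr; linarith
    linarith
  have e2 : Real.exp (2 * E) = Real.exp E ^ 2 := by rw [← Real.exp_nat_mul]; norm_cast
  have ht' : 0 ≤ t₂ - t₁ := sub_nonneg.2 ht
  constructor
  · intro hxy
    have hs0 : 0 ≤ s := sub_nonneg.2 (Real.log_le_log hy hxy)
    rw [max_eq_left hxy] at hen'
    have hw : k.weight s ≤ 2 * Real.exp (k.gamma * s) := by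
      unfold weight
      have : Real.exp (-k.alpha * s) ≤ Real.exp (k.gamma * s) := by
        apply Real.exp_le_exp.2
        have := mul_nonneg k.alpha_pos.le hs0
        have := mul_nonneg k.gamma_pos.le hs0
        linarith
      linarith
    have a1 : x t₁ ^ 2 ≤ 4 * C₂ ^ 2 * Real.exp (2 * E) * Real.exp (2 * k.gamma * s) := by
      calc x t₁ ^ 2 ≤ (C₂ * (Real.exp E * (2 * Real.exp (k.gamma * s)))) ^ 2 := by
            gcongr; exact hen'.trans (by gcongr)
        _ = _ := by
            have : Real.exp (2 * k.gamma * s) = Real.exp (k.gamma * s) ^ 2 := by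
              rw [← Real.exp_nat_mul]; push_cast; ring_nf
            rw [e2, this]; ring
    have a2 := htail s
    calc (t₂ - t₁) * x t₁ ^ 2 ≤
        (t₂ - t₁) * (4 * C₂ ^ 2 * Real.exp (2 * E) * Real.exp (2 * k.gamma * s)) := by gcongr
      _ = 4 * C₂ ^ 2 * Real.exp (2 * k.gamma * s) * (Real.exp (2 * E) * (t₂ - t₁)) := by ring
      _ ≤ 4 * C₂ ^ 2 * Real.exp (2 * k.gamma * s) * (2 * (C₃ * Real.exp (-(2 * k.gamma * s)))) := by
          refine mul_le_mul_of_nonneg_left ?_ (by positivity)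
          linarith
      _ = 8 * C₂ ^ 2 * C₃ * (Real.exp (2 * k.gamma * s) * Real.exp (-(2 * k.gamma * s))) := by ring
      _ = 8 * C₂ ^ 2 * C₃ := by rw [← Real.exp_add, add_neg_cancel, Real.exp_zero, mul_one]
      _ ≤ _ := by gcongr; linarith
  · intro hxy
    have hs0 : s ≤ 0 := sub_nonpos.2 (Real.log_le_log hx hxy)
    rw [max_eq_right hxy] at hen'
    have hw : k.weight s ≤ 2 * Real.exp (-(k.alpha * s)) := by
      unfold weight
      have : Real.exp (k.gamma * s) ≤ Real.exp (-k.alpha * s) := by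
        apply Real.exp_le_exp.2
        have := mul_nonpos_of_nonneg_of_nonpos k.alpha_pos.le hs0
        have := mul_nonpos_of_nonneg_of_nonpos k.gamma_pos.le hs0
        linarith
      rw [← neg_mul]
      linarith
    have a1 : y t₁ ^ 2 ≤ 4 * C₂ ^ 2 * Real.exp (2 * E) * Real.exp (-(2 * k.alpha * s)) := by
      calc y t₁ ^ 2 ≤ (C₂ * (Real.exp E * (2 * Real.exp (-(k.alpha * s))))) ^ 2 := by
            gcongr; exact hen'.trans (by gcongr)
        _ = _ := by
            have : Real.exp (-(2 * k.alpha * s)) = Real.exp (-(k.alpha * s)) ^ 2 := by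
              rw [← Real.exp_nat_mul]; push_cast; ring_nf
            rw [e2, this]; ring
    have a2 : (x t₁ / y t₁) ^ (2 * k.alpha) = Real.exp (2 * k.alpha * s) := by
      rw [Real.rpow_def_of_pos (div_pos hx hy), Real.log_div hx.ne' hy.ne', mul_comm]
    have a3 := hL₀ s
    rw [a2]
    calc (t₂ - t₁) * y t₁ ^ 2 * Real.exp (2 * k.alpha * s) ≤
        (t₂ - t₁) * (4 * C₂ ^ 2 * Real.exp (2 * E) * Real.exp (-(2 * k.alpha * s))) *
          Real.exp (2 * k.alpha * s) := by gcongr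
      _ = 4 * C₂ ^ 2 * (Real.exp (2 * E) * (t₂ - t₁)) *
          (Real.exp (-(2 * k.alpha * s)) * Real.exp (2 * k.alpha * s)) := by ring
      _ = 4 * C₂ ^ 2 * (Real.exp (2 * E) * (t₂ - t₁)) := by
          rw [← Real.exp_add, neg_add_cancel, Real.exp_zero, mul_one]
      _ ≤ 4 * C₂ ^ 2 * (2 * (L₁ - L₀)) := by
          refine mul_le_mul_of_nonneg_left ?_ (by positivity)
          linarith
      _ ≤ _ := by nlinarith [mul_pos (pow_pos (by linarith : 0 < C₂) 2) hC₃]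

end

end SaddleCoeffs

/-- A flow near a cubic saddle orbit, described by the transverse coordinates `x` and `y` on an open
set `U` of the phase space and by a section `S` parametrized inside `U` by `σ`. -/
structure SaddleTube (k : SaddleCoeffs) {M : Type*} [TopologicalSpace M] (φ : Flow ℝ M)
    (S : Set M) (σ : ℝ × ℝ → M) (r : ℝ) where
  U : Set M
  x : M → ℝ
  y : M → ℝ
  r₁ : M → ℝ
  r₂ : M → ℝ
  K : ℝ
  hmin : ℝ
  hmax : ℝ
  K_nonneg : 0 ≤ K
  r_pos : 0 < r
  isOpen_U : IsOpen U
  abs_lt : ∀ m ∈ U, |x m| < r ∧ |y m| < r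
  continuousOn_x : ContinuousOn x U
  continuousOn_y : ContinuousOn y U
  continuousOn_r₁ : ContinuousOn r₁ U
  continuousOn_r₂ : ContinuousOn r₂ U
  isClosed_tube : ∀ ε < r, IsClosed {m ∈ U | |x m| ≤ ε ∧ |y m| ≤ ε}
  bound₁ : ∀ m ∈ U, |r₁ m| ≤ K * max |x m| |y m| ^ 3
  bound₂ : ∀ m ∈ U, |r₂ m| ≤ K * max |x m| |y m| ^ 3
  deriv_x : ∀ q t, φ t q ∈ U → HasDerivAt (fun t => x (φ t q))
    (x (φ t q) * (k.a₀ * x (φ t q) ^ 2 + k.a₁ * x (φ t q) * y (φ t q) + k.a₂ * y (φ t q) ^ 2 +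
      r₁ (φ t q))) t
  deriv_y : ∀ q t, φ t q ∈ U → HasDerivAt (fun t => y (φ t q))
    (-(y (φ t q) * (k.b₀ * x (φ t q) ^ 2 + k.b₁ * x (φ t q) * y (φ t q) + k.b₂ * y (φ t q) ^ 2 +
      r₂ (φ t q)))) t
  continuousOn_σ : ContinuousOn σ (openSquare r)
  σ_mem : ∀ p ∈ openSquare r, σ p ∈ S ∧ σ p ∈ U ∧ x (σ p) = p.1 ∧ y (σ p) = p.2
  σ_coord : ∀ m ∈ S, m ∈ U → σ (x m, y m) = m
  isClosed_S : IsClosed S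
  hmin_pos : 0 < hmin
  le_firstHit : ∀ q ∈ S, ENNReal.ofReal hmin ≤ firstHit φ S q
  firstHit_le : ∀ q ∈ S, firstHit φ S q ≤ ENNReal.ofReal hmax
  persist : ∀ q s, 0 < s → φ s q ∈ S → φ s q ∈ U → ∀ N ∈ 𝓝 (φ s q),
    ∀ᶠ q' in 𝓝 q, ∃ s', 0 < s' ∧ s' ≤ s + 1 ∧ φ s' q' ∈ S ∧ φ s' q' ∈ N

theorem openTube_mono {r r' : ℝ} (h : r' ≤ r) : openTube r' ⊆ openTube r :=
  fun _ hp => ⟨hp.1.trans_le h, hp.2.trans_le h⟩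

theorem isOpen_openTube (r : ℝ) : IsOpen (openTube r) :=
  (isOpen_lt (continuous_abs.comp continuous_fst) continuous_const).inter
    (isOpen_lt (continuous_abs.comp (continuous_fst.comp continuous_snd)) continuous_const)

theorem isOpen_openSquare (r : ℝ) : IsOpen (openSquare r) :=
  (isOpen_lt (continuous_abs.comp continuous_fst) continuous_const).inter
    (isOpen_lt (continuous_abs.comp continuous_snd) continuous_const)

section Chart

variable {M : Type*} [TopologicalSpace M]
    [ChartedSpace (EuclideanSpace ℝ (Fin 3)) M]
    {Ψ : ℝ × ℝ × ℝ → M}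

theorem exists_local_inverse {r : ℝ}
    (h : IsLocalDiffeomorphOn 𝓘(ℝ, ℝ × ℝ × ℝ) (𝓡 3) 1 Ψ (openTube r))
    {p : ℝ × ℝ × ℝ} (hp : p ∈ openTube r) :
    ∃ Φ : M → ℝ × ℝ × ℝ, Φ (Ψ p) = p ∧ (∀ᶠ m in 𝓝 (Ψ p), ContinuousAt Φ m) ∧
      (∀ᶠ m in 𝓝 (Ψ p), Ψ (Φ m) = m) ∧ ∀ (γ : ℝ → M) (t : ℝ) (X : EuclideanSpace ℝ (Fin 3))
        (v : ℝ × ℝ × ℝ), (hγ : γ t = Ψ p) →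
        HasMFDerivAt 𝓘(ℝ, ℝ) (𝓡 3) γ t ((1 : ℝ →L[ℝ] ℝ).smulRight X) →
        X = mfderiv 𝓘(ℝ, ℝ × ℝ × ℝ) (𝓡 3) Ψ p v →
        HasDerivAt (fun s => Φ (γ s)) v t := by
  have hf := h ⟨p, hp⟩
  have hs := hf.localInverse_open_source.mem_nhds hf.localInverse_mem_source
  refine ⟨hf.localInverse, hf.localInverse_left_inv hf.localInverse_mem_target, ?_, ?_, ?_⟩
  · filter_upwards [hf.localInverse_open_source.mem_nhds hf.localInverse_mem_source] with m hm
    exact hf.localInverse_contMDiffOn.continuousOn.continuousAt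
      (hf.localInverse_open_source.mem_nhds hm)
  · exact hf.localInverse_eventuallyEq_right
  · intro γ t X v hγ hd hX
    have d1 := (hf.localInverse_mdifferentiableAt one_ne_zero).hasMFDerivAt
    have d2 := (hf.mdifferentiableAt one_ne_zero).hasMFDerivAt
    have d3 := (d1.comp p d2)
    have d4 : HasMFDerivAt 𝓘(ℝ, ℝ × ℝ × ℝ) 𝓘(ℝ, ℝ × ℝ × ℝ) (hf.localInverse ∘ Ψ) p
        (ContinuousLinearMap.id ℝ _) :=
      (hasMFDerivAt_id p).congr_of_eventuallyEq hf.localInverse_eventuallyEq_left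
    have d5 := hasMFDerivAt_unique d3 d4
    have d1' : HasMFDerivAt (𝓡 3) 𝓘(ℝ, ℝ × ℝ × ℝ) hf.localInverse (γ t)
        (mfderiv (𝓡 3) 𝓘(ℝ, ℝ × ℝ × ℝ) hf.localInverse (Ψ p)) := by
      have := d1
      rwa [← hγ] at this ⊢
    have d6 := d1'.comp t hd
    have d9 : ∀ v, mfderiv (𝓡 3) 𝓘(ℝ, ℝ × ℝ × ℝ) hf.localInverse (Ψ p)
      (mfderiv 𝓘(ℝ, ℝ × ℝ × ℝ) (𝓡 3) Ψ p v) = v := fun v => DFunLike.congr_fun d5 v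
    obtain ⟨L, hL⟩ : ∃ L : EuclideanSpace ℝ (Fin 3) →L[ℝ] ℝ × ℝ × ℝ,
      L = mfderiv (𝓡 3) 𝓘(ℝ, ℝ × ℝ × ℝ) hf.localInverse (Ψ p) := ⟨_, rfl⟩
    have d7 : HasFDerivAt (fun s => hf.localInverse (γ s))
      (L.comp ((1 : ℝ →L[ℝ] ℝ).smulRight X)) t := by
      rw [hL]; exact d6.hasFDerivAt
    have d8 : HasDerivAt (fun s => hf.localInverse (γ s))
      (L.comp ((1 : ℝ →L[ℝ] ℝ).smulRight X) 1) t := d7.hasDerivAt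
    refine d8.congr_deriv ?_
    rw [ContinuousLinearMap.comp_apply, ContinuousLinearMap.smulRight_apply, hX, hL]
    refine Eq.trans ?_ (d9 v)
    congr 1
    exact one_smul ℝ _

end Chart

/-- A function that is continuous on the tube and whose product with a coordinate is constant on
the fibres of a map of tubular coordinates is itself constant on them. -/
theorem eq_of_mul_eq_on_fibres {M : Type*} {Ψ : ℝ × ℝ × ℝ → M} {r : ℝ} {R : ℝ × ℝ × ℝ → ℝ}
    {c : ℝ × ℝ × ℝ → ℝ} {ι : ℝ → ℝ × ℝ × ℝ → ℝ × ℝ × ℝ}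
    (hι : ∀ p ∈ openTube r, ContinuousAt (fun u => ι u p) 0 ∧ ι 0 p = p ∧
      ∀ u ≠ 0, c p = 0 → c (ι u p) ≠ 0)
    (hΨ : ∀ u, ∀ p ∈ openTube r, ∀ p' ∈ openTube r, Ψ p = Ψ p' → Ψ (ι u p) = Ψ (ι u p'))
    (hR : ContinuousOn R (openTube r))
    (h : ∀ p ∈ openTube r, ∀ p' ∈ openTube r, Ψ p = Ψ p' → c p ≠ 0 → R p = R p') :
    ∀ p ∈ openTube r, ∀ p' ∈ openTube r, Ψ p = Ψ p' → R p = R p' := by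
  intro p hp p' hp' hpp
  by_cases h0 : c p = 0
  · have lim : ∀ q ∈ openTube r, Tendsto (fun u => R (ι u q)) (𝓝[≠] 0) (𝓝 (R q)) ∧
        ∀ᶠ u in 𝓝[≠] (0 : ℝ), ι u q ∈ openTube r := by
      intro q hq
      obtain ⟨c1, c2, -⟩ := hι q hq
      have c3 : Tendsto (fun u => ι u q) (𝓝[≠] 0) (𝓝 q) := by
        have := c1.tendsto.mono_left (nhdsWithin_le_nhds (s := {0}ᶜ))
        rwa [c2] at this
      exact ⟨((hR.continuousAt ((isOpen_openTube r).mem_nhds hq)).tendsto).comp c3,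
        c3 ((isOpen_openTube r).mem_nhds hq)⟩
    refine tendsto_nhds_unique ((lim p hp).1.congr' ?_) (lim p' hp').1
    filter_upwards [(lim p hp).2, (lim p' hp').2, self_mem_nhdsWithin] with u h1 h2 h3
    exact h _ h1 _ h2 (hΨ u p hp p' hp' hpp) ((hι p hp).2.2 u h3 h0)
  · exact h p hp p' hp' hpp h0

theorem exists_saddleTube {M : Type*} [TopologicalSpace M] [T2Space M]
    [ChartedSpace (EuclideanSpace ℝ (Fin 3)) M] [IsManifold (𝓡 3) ∞ M]
    {X : ∀ q : M, TangentSpace (𝓡 3) q}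
    {φ : Flow ℝ M} (hφ : ∀ q : M, IsMIntegralCurve (fun t => φ t q) X)
    (k : SaddleCoeffs) {r ℓ : ℝ} {Ψ : ℝ × ℝ × ℝ → M}
    (hΨ : IsCubicSaddleChart X k.a₀ k.a₁ k.a₂ k.b₀ k.b₁ k.b₂ r ℓ Ψ)
    {S : Set M} (hS : IsFlowSection φ Ψ r ℓ S) :
    ∃ r', r' ≤ r ∧ Nonempty (SaddleTube k φ S (fun p => Ψ (p.1, p.2, 0)) r') := by
  obtain ⟨r_pos, l_pos, periodic, inj, diffeo, R₁, R₂, W, cR₁, cR₂, cW, ⟨K, hK⟩, hW0, hform⟩ := hΨ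
  obtain ⟨hmin, hmax, hmin_pos, hhit⟩ := hS.returnTime
  have per : ∀ x y z (n : ℤ), Ψ (x, y, z + n * ℓ) = Ψ (x, y, z) := fun x y z n =>
    Function.Periodic.int_mul (f := fun z => Ψ (x, y, z)) (periodic x y) n z
  have origin : ((0, 0, 0) : ℝ × ℝ × ℝ) ∈ openTube r := by simp [openTube, r_pos]
  obtain ⟨r', hr'0, hr'r, hr'W⟩ : ∃ r', 0 < r' ∧ r' ≤ r ∧
      ∀ x y : ℝ, |x| < r' → |y| < r' → 0 < 1 + W (x, y, 0) := by
    have c1 : ContinuousAt (fun p : ℝ × ℝ => 1 + W (p.1, p.2, 0)) (0, 0) := by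
      have c2 : ContinuousAt W ((fun p : ℝ × ℝ => (p.1, p.2, (0 : ℝ))) (0, 0)) :=
        cW.continuousAt ((isOpen_openTube r).mem_nhds origin)
      exact continuousAt_const.add (ContinuousAt.comp c2 (by fun_prop))
    have c3 : ∀ᶠ p : ℝ × ℝ in 𝓝 (0, 0), 0 < 1 + W (p.1, p.2, 0) := by
      apply c1.eventually_const_lt
      simp [hW0]
    obtain ⟨e, he, hb⟩ := Metric.eventually_nhds_iff.1 c3
    refine ⟨min e r, lt_min he r_pos, min_le_right _ _, fun x y hx hy => hb (y := (x, y)) ?_⟩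
    rw [Prod.dist_eq]
    simp only [Real.dist_eq, sub_zero]
    exact max_lt (hx.trans_le (min_le_left _ _)) (hy.trans_le (min_le_left _ _))
  -- coordinates on the image of the tube
  have hinv : ∀ m : M, ∃ p : ℝ × ℝ × ℝ, m ∈ Ψ '' openTube r → p ∈ openTube r ∧ Ψ p = m := by
    intro m
    by_cases h : m ∈ Ψ '' openTube r
    · obtain ⟨p, hp⟩ := h
      exact ⟨p, fun _ => hp⟩
    · exact ⟨0, fun h' => absurd h' h⟩
  choose inv hinv using hinv
  have hinv' : ∀ p ∈ openTube r, (inv (Ψ p)).1 = p.1 ∧ (inv (Ψ p)).2.1 = p.2.1 := by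
    intro p hp
    obtain ⟨h1, h2⟩ := hinv (Ψ p) ⟨p, hp, rfl⟩
    obtain ⟨h3, h4, -⟩ := inj _ h1 _ hp h2
    exact ⟨h3, h4⟩
  have hloc : ∀ r'' ≤ r, ∀ p ∈ openTube r'', ∃ Φ : M → ℝ × ℝ × ℝ, Φ (Ψ p) = p ∧
      (∀ᶠ m in 𝓝 (Ψ p), ContinuousAt Φ m ∧ Ψ (Φ m) = m ∧ Φ m ∈ openTube r'') ∧
      ∀ q t, φ t q = Ψ p → HasDerivAt (fun s => Φ (φ s q))
        (p.1 * (k.a₀ * p.1 ^ 2 + k.a₁ * p.1 * p.2.1 + k.a₂ * p.2.1 ^ 2 + R₁ p),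
          -(p.2.1 * (k.b₀ * p.1 ^ 2 + k.b₁ * p.1 * p.2.1 + k.b₂ * p.2.1 ^ 2 + R₂ p)), 1 + W p) t := by
    intro r'' hr'' p hp
    obtain ⟨Φ, h1, h2, h3, h4⟩ := exists_local_inverse diffeo (openTube_mono hr'' hp)
    refine ⟨Φ, h1, ?_, ?_⟩
    · have h5 : ∀ᶠ m in 𝓝 (Ψ p), Φ m ∈ openTube r'' := by
        have := h2.self_of_nhds.tendsto
        rw [h1] at this
        exact this ((isOpen_openTube r'').mem_nhds hp)
      filter_upwards [h2, h3, h5] with m a b c using ⟨a, b, c⟩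
    · intro q t hq
      refine h4 (fun s => φ s q) t (X (φ t q)) _ hq (hφ q t) ?_
      have h6 : ∀ m m' : M, m = m' → (X m : EuclideanSpace ℝ (Fin 3)) = X m' := by
        rintro m _ rfl; rfl
      exact (h6 _ _ hq).trans (hform p.1 p.2.1 p.2.2 (openTube_mono hr'' hp))
  have hder : ∀ p ∈ openTube r, ∀ q t, φ t q = Ψ p →
      HasDerivAt (fun s => (inv (φ s q)).1)
        (p.1 * (k.a₀ * p.1 ^ 2 + k.a₁ * p.1 * p.2.1 + k.a₂ * p.2.1 ^ 2 + R₁ p)) t ∧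
      HasDerivAt (fun s => (inv (φ s q)).2.1)
        (-(p.2.1 * (k.b₀ * p.1 ^ 2 + k.b₁ * p.1 * p.2.1 + k.b₂ * p.2.1 ^ 2 + R₂ p))) t := by
    intro p hp q t hq
    obtain ⟨Φ, h1, h2, h3⟩ := hloc r le_rfl p hp
    have d := h3 q t hq
    have cont : Tendsto (fun s => φ s q) (𝓝 t) (𝓝 (Ψ p)) := by
      rw [← hq]
      exact (φ.continuous continuous_id continuous_const).continuousAt
    have ev := cont.eventually h2
    have e : ∀ m, Ψ (Φ m) = m ∧ Φ m ∈ openTube r →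
        (inv m).1 = (Φ m).1 ∧ (inv m).2.1 = (Φ m).2.1 := by
      rintro m ⟨h5, h6⟩
      have := hinv' _ h6
      rwa [h5] at this
    have d1 := (hasFDerivAt_fst (𝕜 := ℝ)).comp_hasDerivAt t d
    have d2 := (hasFDerivAt_fst (𝕜 := ℝ)).comp_hasDerivAt t
      ((hasFDerivAt_snd (𝕜 := ℝ)).comp_hasDerivAt t d)
    exact ⟨d1.congr_of_eventuallyEq (ev.mono fun s hs => (e _ hs.2).1),
      d2.congr_of_eventuallyEq (ev.mono fun s hs => (e _ hs.2).2)⟩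
  have hfib : ∀ p ∈ openTube r, ∀ p' ∈ openTube r, Ψ p = Ψ p' → p.1 = p'.1 ∧ p.2.1 = p'.2.1 :=
    fun p hp p' hp' h => ⟨(inj p hp p' hp' h).1, (inj p hp p' hp' h).2.1⟩
  have hR₁ : ∀ p ∈ openTube r, ∀ p' ∈ openTube r, Ψ p = Ψ p' → R₁ p = R₁ p' := by
    refine eq_of_mul_eq_on_fibres (c := fun p => p.1) (ι := fun u p => (p.1 + u, p.2.1, p.2.2))
      (fun p hp => ⟨by fun_prop, by simp, fun u hu h0 => by simpa [h0] using hu⟩) ?_ cR₁ ?_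
    · intro u p hp p' hp' h
      obtain ⟨h1, h2, n, h3⟩ := inj p hp p' hp' h
      simp only [h1, h2, h3, per]
    · intro p hp p' hp' h h0
      have d1 := (hder p hp (Ψ p) 0 (φ.map_zero_apply _)).1
      have d2 := (hder p' hp' (Ψ p) 0 ((φ.map_zero_apply _).trans h)).1
      have e := d1.unique d2
      obtain ⟨h1, h2⟩ := hfib p hp p' hp' h
      rw [← h1, ← h2] at e
      have := mul_left_cancel₀ h0 e
      linarith
  have hR₂ : ∀ p ∈ openTube r, ∀ p' ∈ openTube r, Ψ p = Ψ p' → R₂ p = R₂ p' := by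
    refine eq_of_mul_eq_on_fibres (c := fun p => p.2.1) (ι := fun u p => (p.1, p.2.1 + u, p.2.2))
      (fun p hp => ⟨by fun_prop, by simp, fun u hu h0 => by simpa [h0] using hu⟩) ?_ cR₂ ?_
    · intro u p hp p' hp' h
      obtain ⟨h1, h2, n, h3⟩ := inj p hp p' hp' h
      simp only [h1, h2, h3, per]
    · intro p hp p' hp' h h0
      have d1 := (hder p hp (Ψ p) 0 (φ.map_zero_apply _)).2
      have d2 := (hder p' hp' (Ψ p) 0 ((φ.map_zero_apply _).trans h)).2
      have e := neg_injective (d1.unique d2)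
      obtain ⟨h1, h2⟩ := hfib p hp p' hp' h
      rw [← h1, ← h2] at e
      have := mul_left_cancel₀ h0 e
      linarith
  have hcont : ∀ (F : ℝ × ℝ × ℝ → ℝ), ContinuousOn F (openTube r) →
      (∀ p ∈ openTube r, ∀ p' ∈ openTube r, Ψ p = Ψ p' → F p = F p') →
      ContinuousOn (fun m => F (inv m)) (Ψ '' openTube r') := by
    rintro F hF hfF _ ⟨p, hp, rfl⟩
    have hp' := openTube_mono hr'r hp
    obtain ⟨Φ, h1, h2, -⟩ := hloc r le_rfl p hp'
    refine ContinuousAt.continuousWithinAt ?_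
    have c1 : ContinuousAt (fun m => F (Φ m)) (Ψ p) := by
      refine ContinuousAt.comp (g := F) ?_ h2.self_of_nhds.1
      rw [h1]
      exact hF.continuousAt ((isOpen_openTube r).mem_nhds hp')
    refine c1.congr (h2.mono fun m hm => ?_)
    have h3 := hinv m ⟨_, hm.2.2, hm.2.1⟩
    exact hfF _ hm.2.2 _ h3.1 (hm.2.1.trans h3.2.symm)
  have hU : IsOpen (Ψ '' openTube r') := by
    rw [isOpen_iff_mem_nhds]
    rintro _ ⟨p, hp, rfl⟩
    obtain ⟨Φ, -, h2, -⟩ := hloc r' hr'r p hp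
    filter_upwards [h2] with m hm using ⟨Φ m, hm.2.2, hm.2.1⟩
  have hxU : ∀ m ∈ Ψ '' openTube r', |(inv m).1| < r' ∧ |(inv m).2.1| < r' ∧
      inv m ∈ openTube r' ∧ Ψ (inv m) = m := by
    rintro _ ⟨p, hp, rfl⟩
    obtain ⟨h1, h2⟩ := hinv' p (openTube_mono hr'r hp)
    have h3 : |(inv (Ψ p)).1| < r' := by rw [h1]; exact hp.1
    have h4 : |(inv (Ψ p)).2.1| < r' := by rw [h2]; exact hp.2
    exact ⟨h3, h4, ⟨h3, h4⟩, (hinv (Ψ p) ⟨p, openTube_mono hr'r hp, rfl⟩).2⟩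
  have hbd : ∀ m ∈ Ψ '' openTube r', ∀ R : ℝ × ℝ × ℝ → ℝ, (∀ x y z : ℝ, (x, y, z) ∈ openTube r →
      |R (x, y, z)| ≤ K * ‖(x, y)‖ ^ 3) →
      |R (inv m)| ≤ max K 0 * max |(inv m).1| |(inv m).2.1| ^ 3 := by
    intro m hm R hR
    have h1 := hR (inv m).1 (inv m).2.1 (inv m).2.2 (openTube_mono hr'r (hxU m hm).2.2.1)
    refine h1.trans ?_
    rw [Prod.norm_def]
    simp only [Real.norm_eq_abs]
    gcongr
    exact le_max_left _ _
  have cΨ : ContinuousOn Ψ (openTube r) := diffeo.contMDiffOn.continuousOn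
  have sec : ∀ p ∈ openSquare r', (p.1, p.2, (0 : ℝ)) ∈ openTube r' := fun p hp => hp
  refine ⟨r', hr'r, ⟨{
    U := Ψ '' openTube r'
    x := fun m => (inv m).1
    y := fun m => (inv m).2.1
    r₁ := fun m => R₁ (inv m)
    r₂ := fun m => R₂ (inv m)
    K := max K 0
    hmin := hmin
    hmax := hmax
    K_nonneg := le_max_right _ _
    r_pos := hr'0
    isOpen_U := hU
    abs_lt := fun m hm => ⟨(hxU m hm).1, (hxU m hm).2.1⟩
    continuousOn_x := hcont (fun p => p.1) (by fun_prop) fun p hp p' hp' h => (hfib p hp p' hp' h).1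
    continuousOn_y := hcont (fun p => p.2.1) (by fun_prop)
      fun p hp p' hp' h => (hfib p hp p' hp' h).2
    continuousOn_r₁ := hcont R₁ cR₁ hR₁
    continuousOn_r₂ := hcont R₂ cR₂ hR₂
    isClosed_tube := ?_
    bound₁ := fun m hm => hbd m hm R₁ fun x y z h => (hK x y z h).1
    bound₂ := fun m hm => hbd m hm R₂ fun x y z h => (hK x y z h).2
    deriv_x := fun q t h => (hder (inv (φ t q)) (openTube_mono hr'r (hxU _ h).2.2.1) q t
      (hxU _ h).2.2.2.symm).1
    deriv_y := fun q t h => (hder (inv (φ t q)) (openTube_mono hr'r (hxU _ h).2.2.1) q t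
      (hxU _ h).2.2.2.symm).2
    continuousOn_σ := cΨ.comp (f := fun p : ℝ × ℝ => (p.1, p.2, (0 : ℝ))) (by fun_prop)
      fun p hp => openTube_mono hr'r (sec p hp)
    σ_mem := fun p hp => ⟨(hS.mem_iff _ (openTube_mono hr'r (sec p hp))).2 ⟨0, by simp⟩,
      ⟨_, sec p hp, rfl⟩, hinv' _ (openTube_mono hr'r (sec p hp))⟩
    σ_coord := ?_
    isClosed_S := hS.isClosed
    hmin_pos := hmin_pos
    le_firstHit := fun q hq => (hhit q hq).1
    firstHit_le := fun q hq => (hhit q hq).2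
    persist := ?_ }⟩⟩
  · intro ε hε
    have e : {m ∈ Ψ '' openTube r' | |(inv m).1| ≤ ε ∧ |(inv m).2.1| ≤ ε} =
        Ψ '' (Set.Icc (-ε) ε ×ˢ Set.Icc (-ε) ε ×ˢ Set.Icc 0 ℓ) := by
      ext m
      constructor
      · rintro ⟨hm, h1, h2⟩
        obtain ⟨n, hn, -⟩ := existsUnique_sub_zsmul_mem_Ico l_pos (inv m).2.2 0
        refine ⟨((inv m).1, (inv m).2.1, (inv m).2.2 - n • ℓ), ⟨abs_le.1 h1, abs_le.1 h2, ?_⟩, ?_⟩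
        · rw [zero_add] at hn; exact ⟨hn.1, hn.2.le⟩
        · have := per (inv m).1 (inv m).2.1 (inv m).2.2 (-n)
          rw [show (inv m).2.2 - n • ℓ = (inv m).2.2 + ((-n : ℤ) : ℝ) * ℓ by
            push_cast; simp [sub_eq_add_neg], this]
          exact (hxU m hm).2.2.2
      · rintro ⟨p, ⟨h1, h2, -⟩, rfl⟩
        have h1' : |p.1| ≤ ε := abs_le.2 h1
        have h2' : |p.2.1| ≤ ε := abs_le.2 h2
        have hp : p ∈ openTube r' := ⟨h1'.trans_lt hε, h2'.trans_lt hε⟩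
        obtain ⟨h3, h4⟩ := hinv' p (openTube_mono hr'r hp)
        exact ⟨⟨p, hp, rfl⟩, by rwa [h3], by rwa [h4]⟩
    rw [e]
    refine IsCompact.isClosed (IsCompact.image_of_continuousOn
      (isCompact_Icc.prod (isCompact_Icc.prod isCompact_Icc)) (cΨ.mono ?_))
    rintro p ⟨h1, h2, -⟩
    exact openTube_mono hr'r ⟨(abs_le.2 h1).trans_lt hε, (abs_le.2 h2).trans_lt hε⟩
  · intro m hmS hmU
    obtain ⟨h1, h2, h3, h4⟩ := hxU m hmU
    have h5 := (hS.mem_iff _ (openTube_mono hr'r h3)).1 (by rwa [h4])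
    obtain ⟨n, hn⟩ := h5
    have := per (inv m).1 (inv m).2.1 0 n
    rw [zero_add, ← hn] at this
    exact this.symm.trans h4
  · intro q s hs hqS hqU N hN
    obtain ⟨h1, h2, h3, h4⟩ := hxU _ hqU
    obtain ⟨n, hn⟩ := (hS.mem_iff _ (openTube_mono hr'r h3)).1 (by rwa [h4])
    obtain ⟨p, hp⟩ : ∃ p : ℝ × ℝ × ℝ, p = ((inv (φ s q)).1, (inv (φ s q)).2.1, 0) := ⟨_, rfl⟩
    have hpt : p ∈ openTube r' := by rw [hp]; exact ⟨h1, h2⟩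
    have hpq : φ s q = Ψ p := by
      have := per (inv (φ s q)).1 (inv (φ s q)).2.1 0 n
      rw [zero_add, ← hn] at this
      rw [hp]
      exact h4.symm.trans this
    have hW1 : 0 < 1 + W p := by rw [hp]; exact hr'W _ _ h1 h2
    obtain ⟨Φ, hΦ1, hΦ2, hΦ3⟩ := hloc r' hr'r p hpt
    have dz : HasDerivAt (fun u => (Φ (φ u q)).2.2) (1 + W p) s := by
      have d1 := (hasFDerivAt_snd (𝕜 := ℝ)).comp_hasDerivAt s (hΦ3 q s hpq)
      exact (hasFDerivAt_snd (𝕜 := ℝ)).comp_hasDerivAt s d1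
    have z0 : (Φ (φ s q)).2.2 = 0 := by rw [hpq, hΦ1, hp]
    have cφ : Continuous fun z : M × ℝ => φ z.2 z.1 := φ.continuous continuous_snd continuous_fst
    rw [hpq] at hN
    have good : ∀ᶠ m in 𝓝 (Ψ p), (∀ᶠ m' in 𝓝 m, (ContinuousAt Φ m' ∧ Ψ (Φ m') = m' ∧
        Φ m' ∈ openTube r') ∧ m' ∈ N) := eventually_eventually_nhds.2 (hΦ2.and hN)
    have cs : Tendsto (fun u => φ u q) (𝓝 s) (𝓝 (Ψ p)) := by
      rw [← hpq]
      exact (φ.continuous continuous_id continuous_const).continuousAt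
    have ev1 := cs.eventually good
    have ev2 : ∀ᶠ u in 𝓝[>] s, 0 < (Φ (φ u q)).2.2 := by
      have := (hasDerivAt_iff_tendsto_slope.1 dz).eventually (lt_mem_nhds hW1)
      have h5 : 𝓝[>] s ≤ 𝓝[≠] s := nhdsWithin_mono _ fun u hu => ne_of_gt hu
      filter_upwards [this.filter_mono h5, self_mem_nhdsWithin] with u h6 h7
      rw [slope_def_field, z0, sub_zero] at h6
      exact (div_pos_iff_of_pos_right (sub_pos.2 h7)).1 h6
    have ev3 : ∀ᶠ u in 𝓝[<] s, (Φ (φ u q)).2.2 < 0 := by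
      have := (hasDerivAt_iff_tendsto_slope.1 dz).eventually (lt_mem_nhds hW1)
      have h5 : 𝓝[<] s ≤ 𝓝[≠] s := nhdsWithin_mono _ fun u hu => ne_of_lt hu
      filter_upwards [this.filter_mono h5, self_mem_nhdsWithin] with u h6 h7
      rw [slope_def_field, z0, sub_zero] at h6
      have h8 : u - s < 0 := sub_neg.2 h7
      by_contra! h9
      exact absurd h6 (not_lt.2 (div_nonpos_of_nonneg_of_nonpos h9 h8.le))
    obtain ⟨η, hη, hη1⟩ := Metric.eventually_nhds_iff.1 ev1
    obtain ⟨u₂, h5, h6, h7⟩ := (ev2.and (Ioo_mem_nhdsGT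
      (show s < s + min η 1 by have := lt_min hη one_pos; linarith))).exists
    obtain ⟨u₁, h8, h9, h10⟩ := (ev3.and (Ioo_mem_nhdsLT
      (show s - min η s < s by have := lt_min hη hs; linarith))).exists
    have hu₁ : 0 < u₁ := by linarith [min_le_right η s]
    have hu₂ : u₂ ≤ s + 1 := by linarith [min_le_right η 1]
    have hu : ∀ u ∈ Set.Icc u₁ u₂, dist u s < η := by
      intro u hu
      rw [Real.dist_eq, abs_lt]
      constructor <;> linarith [hu.1, hu.2, min_le_left η 1, min_le_left η s]
    have evK : ∀ᶠ q' in 𝓝 q, ∀ u ∈ Set.Icc u₁ u₂, (ContinuousAt Φ (φ u q') ∧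
        Ψ (Φ (φ u q')) = φ u q' ∧ Φ (φ u q') ∈ openTube r') ∧ φ u q' ∈ N := by
      refine isCompact_Icc.eventually_forall_of_forall_eventually fun u hu' => ?_
      exact (cφ.continuousAt (x := (q, u))).eventually (hη1 (hu u hu'))
    have hsm : s ∈ Set.Icc u₁ u₂ := ⟨h10.le, h6.le⟩
    have u₁m : u₁ ∈ Set.Icc u₁ u₂ := ⟨le_rfl, hsm.1.trans hsm.2⟩
    have u₂m : u₂ ∈ Set.Icc u₁ u₂ := ⟨hsm.1.trans hsm.2, le_rfl⟩
    have cz : ∀ u ∈ Set.Icc u₁ u₂, ContinuousAt (fun q' => (Φ (φ u q')).2.2) q := by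
      intro u hu'
      have c1 : ContinuousAt Φ (φ u q) := (hη1 (hu u hu')).self_of_nhds.1.1
      have c2 : ContinuousAt (fun q' => Φ (φ u q')) q :=
        ContinuousAt.comp (g := Φ) c1 (φ.continuous continuous_const continuous_id).continuousAt
      exact (continuous_snd.comp continuous_snd).continuousAt.comp c2
    filter_upwards [evK, (cz u₁ u₁m).eventually_lt_const h8, (cz u₂ u₂m).eventually_const_lt h5]
      with q' e1 e2 e3
    have cq : ContinuousOn (fun u => (Φ (φ u q')).2.2) (Set.Icc u₁ u₂) := by
      intro u hu'
      have c2 : ContinuousAt (fun u => Φ (φ u q')) u :=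
        ContinuousAt.comp (g := Φ) (e1 u hu').1.1
          (φ.continuous continuous_id continuous_const).continuousAt
      exact ((continuous_snd.comp continuous_snd).continuousAt.comp c2).continuousWithinAt
    obtain ⟨u, hu', hz⟩ := intermediate_value_Icc (hsm.1.trans hsm.2) cq ⟨e2.le, e3.le⟩
    obtain ⟨⟨-, e4, e5⟩, e6⟩ := e1 u hu'
    refine ⟨u, hu₁.trans_le hu'.1, hu'.2.trans hu₂, ?_, e6⟩
    rw [← e4]
    exact (hS.mem_iff _ (openTube_mono hr'r e5)).2 ⟨0, by simpa using hz⟩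

namespace SaddleCoeffs

noncomputable section

variable (k : SaddleCoeffs)

/-- The coefficients of the saddle in the coordinates `(e x, y)` or `(x, e y)`. -/
def twist (e : ℤˣ) : SaddleCoeffs where
  a₀ := k.a₀
  a₁ := (e : ℤ) * k.a₁
  a₂ := k.a₂
  b₀ := k.b₀
  b₁ := (e : ℤ) * k.b₁
  b₂ := k.b₂
  a₀_pos := k.a₀_pos
  a₂_nonneg := k.a₂_nonneg
  b₀_nonneg := k.b₀_nonneg
  b₂_pos := k.b₂_pos
  disc_neg := by
    have h := k.disc_neg
    rcases Int.units_eq_one_or e with rfl | rfl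
    · simpa using h
    · simp only [Units.val_neg, Units.val_one, Int.cast_neg, Int.cast_one]
      linarith

@[simp] theorem twist_alpha (e : ℤˣ) : (k.twist e).alpha = k.alpha := rfl

/-- An orbit that starts much closer to the origin than `δ` and leaves the square of size `δ` does so
near the unstable axis, provided that its first integral is small. -/
theorem exists_exit_slope (K : ℝ) (hK : 0 ≤ K) : ∃ ε₀ κ, 0 < ε₀ ∧ 0 < κ ∧
    ∀ δ, 0 < δ → δ ≤ ε₀ → ∀ s₀, ∃ E₀, ∀ (t₁ t₂ : ℝ) (x y : ℝ → ℝ), t₁ ≤ t₂ →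
    (∀ t ∈ Set.Icc t₁ t₂, k.IsOrbitAt K x y t ∧ x t ≤ δ ∧ y t ≤ δ) →
    max (x t₁) (y t₁) ≤ κ * δ → δ ≤ max (x t₂) (y t₂) → k.energy (x t₁) (y t₁) ≤ E₀ →
    s₀ ≤ Real.log (x t₂) - Real.log (y t₂) := by
  obtain ⟨ε₀, C, hε₀, hC, hCε, h⟩ := k.exists_passage_estimates K hK
  obtain ⟨C₂, hC₂, hen⟩ := k.exists_energy_bounds
  refine ⟨ε₀, 1 / (4 * C₂ ^ 2), hε₀, by positivity, fun δ hδ hδε s₀ => ?_⟩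
  obtain ⟨A, hA⟩ : ∃ A, A = δ / (C₂ * (3 * Real.exp (k.gamma * s₀))) := ⟨_, rfl⟩
  have hA0 : 0 < A := by rw [hA]; positivity
  refine ⟨Real.log A - 1, fun t₁ t₂ x y ht horb h1 h2 hE => ?_⟩
  obtain ⟨b1, b2, -, -⟩ := h δ t₁ t₂ x y hδε ht horb
  obtain ⟨⟨hx1, hy1, -⟩, -, -⟩ := horb t₁ (Set.left_mem_Icc.2 ht)
  obtain ⟨⟨hx2, hy2, -⟩, -, -⟩ := horb t₂ (Set.right_mem_Icc.2 ht)
  have e1 := (hen _ _ hx1 hy1).1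
  have e2 := (hen _ _ hx2 hy2).2
  by_contra! hs
  generalize Real.log (x t₂) - Real.log (y t₂) = s at *
  generalize Real.log (x t₁) - Real.log (y t₁) = s₁ at *
  have hE2 : k.energy (x t₂) (y t₂) < Real.log A := by
    have := (abs_le.1 b1).2
    have h3 : C * δ ≤ C * ε₀ := by gcongr
    linarith
  have hE2' : Real.exp (k.energy (x t₂) (y t₂)) < A := by
    rw [← Real.lt_log_iff_exp_lt hA0]; exact hE2
  have hw := k.weight_pos s
  have w1 : 3 * Real.exp (k.gamma * s₀) < k.weight s := by
    have a1 : δ < C₂ * (A * k.weight s) := by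
      refine (h2.trans e2).trans_lt ?_
      gcongr
    rw [hA] at a1
    have a2 : C₂ * (δ / (C₂ * (3 * Real.exp (k.gamma * s₀))) * k.weight s) =
        δ * (k.weight s / (3 * Real.exp (k.gamma * s₀))) := by field_simp
    rw [a2] at a1
    have a3 : 1 < k.weight s / (3 * Real.exp (k.gamma * s₀)) := by
      by_contra! hcon
      have := mul_le_mul_of_nonneg_left hcon hδ.le
      linarith
    rwa [one_lt_div (by positivity)] at a3
  have w2 : Real.exp (k.gamma * s) ≤ Real.exp (k.gamma * s₀) := by
    apply Real.exp_le_exp.2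
    exact mul_le_mul_of_nonneg_left hs.le k.gamma_pos.le
  have w3 : k.weight s ≤ 3 * k.lyap s := by
    unfold weight lyap at *
    linarith
  have l1 := (le_abs_self _).trans (k.abs_lyap_le s₁)
  have f1 : δ ≤ 3 * C₂ ^ 2 * (1 / (4 * C₂ ^ 2) * δ) := by
    calc δ ≤ C₂ * (Real.exp (k.energy (x t₂) (y t₂)) * k.weight s) := h2.trans e2
      _ ≤ C₂ * (Real.exp (k.energy (x t₂) (y t₂)) * (3 * k.lyap s)) := by gcongr
      _ = 3 * C₂ * (Real.exp (k.energy (x t₂) (y t₂)) * k.lyap s) := by ring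
      _ ≤ 3 * C₂ * (Real.exp (k.energy (x t₁) (y t₁)) * k.lyap s₁) := by gcongr
      _ ≤ 3 * C₂ * (Real.exp (k.energy (x t₁) (y t₁)) * k.weight s₁) := by gcongr
      _ ≤ 3 * C₂ * (C₂ * (1 / (4 * C₂ ^ 2) * δ)) := by
          refine mul_le_mul_of_nonneg_left (e1.trans ?_) (by positivity)
          gcongr
      _ = _ := by ring
  have f2 : 3 * C₂ ^ 2 * (1 / (4 * C₂ ^ 2) * δ) = 3 / 4 * δ := by field_simp
  linarith

end

end SaddleCoeffs

section Paths

variable {M : Type*} [TopologicalSpace M]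

/-- A continuous path that starts in an open set and does not stay there has a first exit time. -/
theorem exists_first_exit {c : ℝ → M} (hc : Continuous c) {V : Set M} (hV : IsOpen V) {a b : ℝ}
    (ha : c a ∈ V) (h : ¬ ∀ t ∈ Set.Icc a b, c t ∈ V) :
    ∃ t, a < t ∧ t ≤ b ∧ c t ∉ V ∧ ∀ s, a ≤ s → s < t → c s ∈ V := by
  push Not at h
  obtain ⟨t₀, ht₀, ht₀V⟩ := h
  set A := Set.Icc a b ∩ c ⁻¹' Vᶜ with hA
  have hcl : IsClosed A := isClosed_Icc.inter (hV.isClosed_compl.preimage hc)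
  have hne : A.Nonempty := ⟨t₀, ht₀, ht₀V⟩
  have hbd : BddBelow A := ⟨a, fun t ht => ht.1.1⟩
  have hm := hcl.csInf_mem hne hbd
  refine ⟨sInf A, lt_of_le_of_ne hm.1.1 ?_, hm.1.2, hm.2, fun s h1 h2 => ?_⟩
  · intro heq
    exact hm.2 (heq ▸ ha)
  · by_contra hs
    exact absurd (csInf_le hbd ⟨⟨h1, h2.le.trans hm.1.2⟩, hs⟩) (not_le.2 h2)

theorem mem_of_forall_lt_mem {c : ℝ → M} (hc : Continuous c) {C : Set M} (hC : IsClosed C)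
    {a t : ℝ} (hat : a < t) (h : ∀ s, a ≤ s → s < t → c s ∈ C) : c t ∈ C := by
  have h1 : Set.Ico a t ⊆ c ⁻¹' C := fun s hs => h s hs.1 hs.2
  have h2 := closure_minimal h1 (hC.preimage hc)
  rw [closure_Ico hat.ne] at h2
  exact h2 ⟨hat.le, le_rfl⟩

end Paths

/-- Solution formula for the scalar linear equation `u' = u F`. -/
theorem eq_mul_exp_integral {u F : ℝ → ℝ} {V : Set ℝ} (hV : IsOpen V) (hF : ContinuousOn F V)
    (hu : ∀ t ∈ V, HasDerivAt u (u t * F t) t) {a b : ℝ} (hab : a ≤ b) (h : Set.Icc a b ⊆ V) :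
    u b = u a * Real.exp (∫ s in a..b, F s) := by
  have key : ∀ t ∈ Set.Icc a b,
      HasDerivAt (fun t => u t * Real.exp (-∫ s in a..t, F s)) 0 t := by
    intro t ht
    have hi : IntervalIntegrable F volume a t :=
      (hF.mono (by rw [Set.uIcc_of_le ht.1]; exact fun s hs => h ⟨hs.1, hs.2.trans ht.2⟩)).intervalIntegrable
    have hd : HasDerivAt (fun t => ∫ s in a..t, F s) (F t) t :=
      intervalIntegral.integral_hasDerivAt_right hi
        (hF.stronglyMeasurableAtFilter hV t (h ht)) (hF.continuousAt (hV.mem_nhds (h ht)))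
    refine ((hu t (h ht)).mul hd.neg.exp).congr_deriv ?_
    ring
  have h1 := le_of_hasDerivAt_nonpos hab fun t ht => ⟨0, key t ht, le_rfl⟩
  have h2 := le_of_hasDerivAt_nonpos (f := fun t => -(u t * Real.exp (-∫ s in a..t, F s))) hab
    fun t ht => ⟨_, (key t ht).neg, by simp⟩
  simp only [intervalIntegral.integral_same, neg_zero, Real.exp_zero, mul_one] at h1 h2
  have h3 : u b * Real.exp (-∫ s in a..b, F s) = u a := le_antisymm h1 (by linarith)
  rw [← h3, mul_assoc, ← Real.exp_add, neg_add_cancel, Real.exp_zero, mul_one]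

namespace SaddleTube

noncomputable section

variable {k : SaddleCoeffs} {M : Type*} [TopologicalSpace M] {φ : Flow ℝ M} {S : Set M}
  {σ : ℝ × ℝ → M} {r : ℝ} (T : SaddleTube k φ S σ r)

/-- The open tube of size `ε`. -/
def tube (ε : ℝ) : Set M := {m ∈ T.U | |T.x m| < ε ∧ |T.y m| < ε}

/-- The closed tube of size `ε`. -/
def closedTube (ε : ℝ) : Set M := {m ∈ T.U | |T.x m| ≤ ε ∧ |T.y m| ≤ ε}

/-- The logarithmic derivative of `x` along the flow. -/
def rate₁ (m : M) : ℝ :=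
  k.a₀ * T.x m ^ 2 + k.a₁ * T.x m * T.y m + k.a₂ * T.y m ^ 2 + T.r₁ m

/-- The logarithmic derivative of `y` along the reversed flow. -/
def rate₂ (m : M) : ℝ :=
  k.b₀ * T.x m ^ 2 + k.b₁ * T.x m * T.y m + k.b₂ * T.y m ^ 2 + T.r₂ m

theorem isOpen_tube (ε : ℝ) : IsOpen (T.tube ε) := by
  have h1 := T.continuousOn_x.abs.isOpen_inter_preimage T.isOpen_U (isOpen_Iio (a := ε))
  have h2 := T.continuousOn_y.abs.isOpen_inter_preimage T.isOpen_U (isOpen_Iio (a := ε))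
  convert h1.inter h2 using 1
  ext m
  simp only [tube, Set.mem_ofPred_eq, Set.mem_inter_iff, Set.mem_preimage, Set.mem_Iio]
  tauto

theorem tube_mono {ε ε' : ℝ} (h : ε ≤ ε') : T.tube ε ⊆ T.tube ε' :=
  fun _ hm => ⟨hm.1, hm.2.1.trans_le h, hm.2.2.trans_le h⟩

theorem tube_subset_closedTube (ε : ℝ) : T.tube ε ⊆ T.closedTube ε :=
  fun _ hm => ⟨hm.1, hm.2.1.le, hm.2.2.le⟩

theorem closedTube_subset_tube {ε ε' : ℝ} (h : ε < ε') : T.closedTube ε ⊆ T.tube ε' :=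
  fun _ hm => ⟨hm.1, hm.2.1.trans_lt h, hm.2.2.trans_lt h⟩

theorem continuousOn_rate₁ : ContinuousOn T.rate₁ T.U := by
  have := T.continuousOn_x; have := T.continuousOn_y; have := T.continuousOn_r₁
  unfold rate₁; fun_prop

theorem continuousOn_rate₂ : ContinuousOn T.rate₂ T.U := by
  have := T.continuousOn_x; have := T.continuousOn_y; have := T.continuousOn_r₂
  unfold rate₂; fun_prop

theorem continuous_orbit (q : M) : Continuous fun t => φ t q :=
  φ.continuous continuous_id continuous_const

theorem x_flow_eq (q : M) {a b : ℝ} (hab : a ≤ b) (h : ∀ t ∈ Set.Icc a b, φ t q ∈ T.U) :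
    T.x (φ b q) = T.x (φ a q) * Real.exp (∫ s in a..b, T.rate₁ (φ s q)) :=
  eq_mul_exp_integral (u := fun t => T.x (φ t q)) (F := fun t => T.rate₁ (φ t q))
    (V := (fun t => φ t q) ⁻¹' T.U) (T.isOpen_U.preimage (continuous_orbit q))
    (T.continuousOn_rate₁.comp (continuous_orbit q).continuousOn fun _ h => h)
    (fun t ht => T.deriv_x q t ht) hab h

theorem y_flow_eq (q : M) {a b : ℝ} (hab : a ≤ b) (h : ∀ t ∈ Set.Icc a b, φ t q ∈ T.U) :
    T.y (φ b q) = T.y (φ a q) * Real.exp (∫ s in a..b, -T.rate₂ (φ s q)) :=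
  eq_mul_exp_integral (u := fun t => T.y (φ t q)) (F := fun t => -T.rate₂ (φ t q))
    (V := (fun t => φ t q) ⁻¹' T.U) (T.isOpen_U.preimage (continuous_orbit q))
    (T.continuousOn_rate₂.neg.comp (continuous_orbit q).continuousOn fun _ h => h)
    (fun t ht => (T.deriv_y q t ht).congr_deriv (by unfold rate₂; ring)) hab h

theorem exists_rate_bound : ∃ C, 0 < C ∧ ∀ m ∈ T.U, |T.rate₁ m| ≤ C ∧ |T.rate₂ m| ≤ C := by
  have hr := T.r_pos
  have hK := T.K_nonneg
  have form : ∀ a b c x y e : ℝ, |x| < r → |y| < r → |e| ≤ T.K * max |x| |y| ^ 3 →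
      |a * x ^ 2 + b * x * y + c * y ^ 2 + e| ≤ (|a| + |b| + |c|) * r ^ 2 + T.K * r ^ 3 := by
    intro a b c x y e hx hy he
    have h1 : |a * x ^ 2| ≤ |a| * r ^ 2 := by
      rw [abs_mul, abs_pow]; gcongr
    have h2 : |b * x * y| ≤ |b| * r ^ 2 := by
      rw [mul_assoc, abs_mul, abs_mul, sq]; gcongr
    have h3 : |c * y ^ 2| ≤ |c| * r ^ 2 := by
      rw [abs_mul, abs_pow]; gcongr
    have h4 : T.K * max |x| |y| ^ 3 ≤ T.K * r ^ 3 := by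
      gcongr; exact max_le hx.le hy.le
    calc _ ≤ |a * x ^ 2| + |b * x * y| + |c * y ^ 2| + |e| :=
          (abs_add_le _ _).trans (add_le_add_left ((abs_add_le _ _).trans
            (add_le_add_left (abs_add_le _ _) _)) _)
      _ ≤ _ := by linarith
  refine ⟨1 + ((|k.a₀| + |k.a₁| + |k.a₂|) * r ^ 2 + T.K * r ^ 3) +
    ((|k.b₀| + |k.b₁| + |k.b₂|) * r ^ 2 + T.K * r ^ 3), by positivity, fun m hm => ?_⟩
  obtain ⟨hx, hy⟩ := T.abs_lt m hm
  have f1 := form k.a₀ k.a₁ k.a₂ _ _ _ hx hy (T.bound₁ m hm)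
  have f2 := form k.b₀ k.b₁ k.b₂ _ _ _ hx hy (T.bound₂ m hm)
  have p1 : 0 ≤ (|k.a₀| + |k.a₁| + |k.a₂|) * r ^ 2 + T.K * r ^ 3 := by positivity
  have p2 : 0 ≤ (|k.b₀| + |k.b₁| + |k.b₂|) * r ^ 2 + T.K * r ^ 3 := by positivity
  unfold rate₁ rate₂
  exact ⟨by linarith, by linarith⟩

/-- Coordinates change at most exponentially fast, forward and backward in time. -/
theorem exists_exp_bound : ∃ C, 0 < C ∧ ∀ (q : M) (a b : ℝ), a ≤ b →
    (∀ t ∈ Set.Icc a b, φ t q ∈ T.U) →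
    |T.x (φ b q)| ≤ |T.x (φ a q)| * Real.exp (C * (b - a)) ∧
    |T.y (φ b q)| ≤ |T.y (φ a q)| * Real.exp (C * (b - a)) ∧
    |T.x (φ a q)| ≤ |T.x (φ b q)| * Real.exp (C * (b - a)) ∧
    |T.y (φ a q)| ≤ |T.y (φ b q)| * Real.exp (C * (b - a)) := by
  obtain ⟨C, hC, h⟩ := T.exists_rate_bound
  refine ⟨C, hC, fun q a b hab hU => ?_⟩
  have gen : ∀ (u v I : ℝ), v = u * Real.exp I → |I| ≤ C * (b - a) →
      |v| ≤ |u| * Real.exp (C * (b - a)) ∧ |u| ≤ |v| * Real.exp (C * (b - a)) := by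
    intro u v I hv hI
    have hI' := abs_le.1 hI
    constructor
    · rw [hv, abs_mul, abs_of_pos (Real.exp_pos _)]
      gcongr; exact hI'.2
    · rw [hv, abs_mul, abs_of_pos (Real.exp_pos _), mul_assoc, ← Real.exp_add]
      refine le_mul_of_one_le_right (abs_nonneg _) (Real.one_le_exp (by linarith))
  have b1 : |∫ s in a..b, T.rate₁ (φ s q)| ≤ C * (b - a) := by
    have := intervalIntegral.norm_integral_le_of_norm_le_const (a := a) (b := b) (C := C)
      (f := fun s => T.rate₁ (φ s q)) fun s hs => (h _ (hU s ?_)).1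
    · rwa [abs_of_nonneg (sub_nonneg.2 hab)] at this
    · rw [Set.uIoc_of_le hab] at hs; exact ⟨hs.1.le, hs.2⟩
  have b2 : |∫ s in a..b, -T.rate₂ (φ s q)| ≤ C * (b - a) := by
    have := intervalIntegral.norm_integral_le_of_norm_le_const (a := a) (b := b) (C := C)
      (f := fun s => -T.rate₂ (φ s q)) fun s hs => by
        rw [norm_neg]; exact (h _ (hU s (by
          rw [Set.uIoc_of_le hab] at hs; exact ⟨hs.1.le, hs.2⟩))).2
    rwa [abs_of_nonneg (sub_nonneg.2 hab)] at this
  obtain ⟨g1, g2⟩ := gen _ _ _ (T.x_flow_eq q hab hU) b1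
  obtain ⟨g3, g4⟩ := gen _ _ _ (T.y_flow_eq q hab hU) b2
  exact ⟨g1, g3, g2, g4⟩

/-- Orbits that pass close to the axis of the tube stay in a given tube for a given time. -/
theorem exists_stay (L ε' : ℝ) (hε' : 0 < ε') (hε'r : ε' < r) : ∃ ε, 0 < ε ∧ ε ≤ ε' ∧
    ∀ q ∈ T.tube ε, ∀ t, |t| ≤ L → φ t q ∈ T.tube ε' := by
  obtain ⟨C, hC, h⟩ := T.exists_exp_bound
  have hexp : 1 ≤ Real.exp (C * |L|) := Real.one_le_exp (by positivity)
  refine ⟨ε' / 2 / Real.exp (C * |L|), by positivity, ?_, fun q hq => ?_⟩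
  · rw [div_le_iff₀ (by positivity)]; nlinarith
  have hq' : q ∈ T.tube ε' := T.tube_mono (by rw [div_le_iff₀ (by positivity)]; nlinarith) hq
  have hclosed : IsClosed (T.closedTube (ε' / 2)) := T.isClosed_tube _ (by linarith)
  have gen : ∀ u a : ℝ, |u| < ε' / 2 / Real.exp (C * |L|) → a ≤ |L| →
      |u| * Real.exp (C * a) ≤ ε' / 2 := by
    intro u a hu ha
    rw [lt_div_iff₀ (by positivity)] at hu
    refine le_trans ?_ hu.le
    gcongr
  have fwd : ∀ t ∈ Set.Icc 0 |L|, φ t q ∈ T.tube ε' := by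
    by_contra hcon
    obtain ⟨t, h0, hL, hV, hlt⟩ := exists_first_exit (continuous_orbit (φ := φ) q)
      (T.isOpen_tube ε') (by rwa [φ.map_zero_apply]) hcon
    refine hV (T.closedTube_subset_tube (half_lt_self hε') (mem_of_forall_lt_mem
      (continuous_orbit q) hclosed h0 fun s hs0 hst => ?_))
    obtain ⟨h1, h2, -, -⟩ := h q 0 s hs0 fun u hu => (hlt u hu.1 (hu.2.trans_lt hst)).1
    rw [φ.map_zero_apply, sub_zero] at h1 h2
    have hsL : s ≤ |L| := by linarith
    exact ⟨(hlt s hs0 hst).1, h1.trans (gen _ _ hq.2.1 hsL), h2.trans (gen _ _ hq.2.2 hsL)⟩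
  have bwd : ∀ t ∈ Set.Icc 0 |L|, φ (-t) q ∈ T.tube ε' := by
    by_contra hcon
    have hc : Continuous fun t => φ (-t) q := (continuous_orbit q).comp continuous_neg
    obtain ⟨t, h0, hL, hV, hlt⟩ := exists_first_exit hc
      (T.isOpen_tube ε') (by rwa [neg_zero, φ.map_zero_apply]) hcon
    refine hV (T.closedTube_subset_tube (half_lt_self hε') (mem_of_forall_lt_mem
      hc hclosed h0 fun s hs0 hst => ?_))
    obtain ⟨-, -, h1, h2⟩ := h q (-s) 0 (by linarith) fun u hu => by
      have := (hlt (-u) (by linarith [hu.2]) (by linarith [hu.1])).1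
      rwa [neg_neg] at this
    rw [φ.map_zero_apply, zero_sub, neg_neg] at h1 h2
    have hsL : s ≤ |L| := by linarith
    exact ⟨(hlt s hs0 hst).1, h1.trans (gen _ _ hq.2.1 hsL), h2.trans (gen _ _ hq.2.2 hsL)⟩
  intro t ht
  have ht' := ht.trans (le_abs_self L)
  rcases le_total 0 t with h0 | h0
  · rw [abs_of_nonneg h0] at ht'
    exact fwd t ⟨h0, ht'⟩
  · rw [abs_of_nonpos h0] at ht'
    have := bwd (-t) ⟨by linarith, ht'⟩
    rwa [neg_neg] at this

/-- The signs of both coordinates are constant along orbits inside the tube, and their absolute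
values solve the saddle equation with twisted coefficients. -/
theorem isOrbitAt_abs (q : M) (e : ℤˣ) {a b : ℝ} (hU : ∀ t ∈ Set.Icc a b, φ t q ∈ T.U)
    (hxy : 0 < (e : ℤ) * (T.x (φ a q) * T.y (φ a q))) :
    ∀ t ∈ Set.Icc a b, (k.twist e).IsOrbitAt T.K (fun t => |T.x (φ t q)|)
      (fun t => |T.y (φ t q)|) t := by
  intro t ht
  have hU' : ∀ s ∈ Set.Icc a t, φ s q ∈ T.U := fun s hs => hU s ⟨hs.1, hs.2.trans ht.2⟩
  have ex := T.x_flow_eq q ht.1 hU'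
  have ey := T.y_flow_eq q ht.1 hU'
  have hpos : 0 < (e : ℤ) * (T.x (φ t q) * T.y (φ t q)) := by
    rw [ex, ey]
    have := mul_pos (mul_pos hxy (Real.exp_pos (∫ s in a..t, T.rate₁ (φ s q))))
      (Real.exp_pos (∫ s in a..t, -T.rate₂ (φ s q)))
    calc 0 < _ := this
      _ = _ := by ring
  have hx0 : T.x (φ t q) ≠ 0 := by rintro h; simp [h] at hpos
  have hy0 : T.y (φ t q) ≠ 0 := by rintro h; simp [h] at hpos
  have he : (e : ℤ) * (|T.x (φ t q)| * |T.y (φ t q)|) = T.x (φ t q) * T.y (φ t q) := by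
    rw [← abs_mul]
    rcases Int.units_eq_one_or e with rfl | rfl
    · simp only [Units.val_one, Int.cast_one, one_mul] at hpos ⊢
      exact abs_of_pos hpos
    · simp only [Units.val_neg, Units.val_one, Int.cast_neg, Int.cast_one] at hpos ⊢
      rw [abs_of_neg (by linarith)]; ring
  have sgn : ∀ u : ℝ, (SignType.sign u : ℝ) * u = |u| := fun u => by rw [sign_mul_self]
  refine ⟨abs_pos.2 hx0, abs_pos.2 hy0, T.r₁ (φ t q), T.r₂ (φ t q), T.bound₁ _ (hU t ht),
    T.bound₂ _ (hU t ht), ?_, ?_⟩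
  · have := (hasDerivAt_abs hx0).comp t (T.deriv_x q t (hU t ht))
    refine this.congr_deriv ?_
    rw [← mul_assoc, sgn]
    simp only [SaddleCoeffs.twist, sq_abs]
    linear_combination (-k.a₁ * |T.x (φ t q)|) * he
  · have := (hasDerivAt_abs hy0).comp t (T.deriv_y q t (hU t ht))
    refine this.congr_deriv ?_
    rw [mul_neg, ← mul_assoc, sgn]
    simp only [SaddleCoeffs.twist, sq_abs]
    linear_combination (k.b₁ * |T.y (φ t q)|) * he

end

end SaddleTube

theorem openSquare_mono {r r' : ℝ} (h : r' ≤ r) : openSquare r' ⊆ openSquare r :=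
  fun _ hp => ⟨hp.1.trans_le h, hp.2.trans_le h⟩

namespace SaddleTube

noncomputable section

variable {k : SaddleCoeffs} {M : Type*} [TopologicalSpace M] {φ : Flow ℝ M} {S : Set M}
  {σ : ℝ × ℝ → M} {r : ℝ} (T : SaddleTube k φ S σ r)

theorem mem_openSquare_axis {y₀ : ℝ} (hy : |y₀| < r) : ((0 : ℝ), y₀) ∈ openSquare r :=
  ⟨by simpa using (abs_nonneg y₀).trans_lt hy, hy⟩

theorem rate₂_ge {ρ : ℝ} (hρK : T.K * ρ ≤ k.b₂ / 2) {m : M} (hm : m ∈ T.tube ρ)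
    (hx : T.x m = 0) : k.b₂ / 2 * T.y m ^ 2 ≤ T.rate₂ m := by
  have h1 := T.bound₂ m hm.1
  rw [hx, abs_zero, max_eq_right (abs_nonneg _)] at h1
  have h2 := (abs_le.1 h1).1
  have h3 : T.K * |T.y m| ^ 3 ≤ k.b₂ / 2 * T.y m ^ 2 := by
    have h4 : T.K * |T.y m| ≤ k.b₂ / 2 :=
      (mul_le_mul_of_nonneg_left hm.2.2.le T.K_nonneg).trans hρK
    calc T.K * |T.y m| ^ 3 = T.K * |T.y m| * |T.y m| ^ 2 := by ring
      _ ≤ k.b₂ / 2 * |T.y m| ^ 2 := by gcongr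
      _ = _ := by rw [sq_abs]
  unfold rate₂
  rw [hx]
  linarith

/-- Points of the local stable manifold stay on it and do not move away from the periodic orbit. -/
theorem base_mem {ρ : ℝ} (hρr : ρ < r) (hρK : T.K * ρ ≤ k.b₂ / 2) {y₀ : ℝ} (hy : |y₀| < ρ) {t : ℝ}
    (ht : 0 ≤ t) : φ t (σ (0, y₀)) ∈ T.tube ρ ∧ T.x (φ t (σ (0, y₀))) = 0 := by
  obtain ⟨-, hU, hx, hyy⟩ := T.σ_mem _ (mem_openSquare_axis (hy.trans hρr))
  set q := σ (0, y₀) with hq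
  have hx0 : ∀ u, 0 ≤ u → (∀ s ∈ Set.Icc 0 u, φ s q ∈ T.tube ρ) → T.x (φ u q) = 0 := by
    intro u hu h
    rw [T.x_flow_eq q hu fun s hs => (h s hs).1, φ.map_zero_apply, hx]
    simp
  have key : ∀ u ∈ Set.Icc 0 t, φ u q ∈ T.tube ρ := by
    by_contra hcon
    have h0 : φ 0 q ∈ T.tube ρ := by
      rw [φ.map_zero_apply]
      refine ⟨hU, ?_, ?_⟩
      · rw [hx, abs_zero]; exact (abs_nonneg _).trans_lt hy
      · rw [hyy]; exact hy
    obtain ⟨u, hu0, -, hV, hlt⟩ := exists_first_exit (continuous_orbit (φ := φ) q)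
      (T.isOpen_tube ρ) h0 hcon
    refine hV (T.closedTube_subset_tube hy (mem_of_forall_lt_mem (continuous_orbit q)
      (T.isClosed_tube _ (hy.trans hρr)) hu0 fun s hs0 hsu => ?_))
    have hin : ∀ v ∈ Set.Icc 0 s, φ v q ∈ T.tube ρ := fun v hv => hlt v hv.1 (hv.2.trans_lt hsu)
    refine ⟨(hlt s hs0 hsu).1, ?_, ?_⟩
    · rw [hx0 s hs0 hin, abs_zero]; exact abs_nonneg _
    · have h1 : T.y (φ s q) ^ 2 ≤ T.y (φ 0 q) ^ 2 := by
        refine le_of_hasDerivAt_nonpos (f := fun t => T.y (φ t q) ^ 2) hs0 fun v hv => ?_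
        refine ⟨_, (T.deriv_y q v (hin v hv).1).pow 2, ?_⟩
        have h2 := T.rate₂_ge hρK (hin v hv)
          (hx0 v hv.1 fun w hw => hin w ⟨hw.1, hw.2.trans hv.2⟩)
        have h3 : 0 ≤ T.rate₂ (φ v q) :=
          le_trans (mul_nonneg (half_pos k.b₂_pos).le (sq_nonneg _)) h2
        have h4 := mul_nonneg h3 (sq_nonneg (T.y (φ v q)))
        unfold rate₂ at h4
        simp only [Nat.cast_ofNat, Nat.add_one_sub_one, pow_one]
        linarith
      rw [φ.map_zero_apply, hyy] at h1
      exact sq_le_sq.1 h1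
  exact ⟨key t ⟨ht, le_rfl⟩, hx0 t ht key⟩

theorem base_y_eq {ρ : ℝ} (hρr : ρ < r) (hρK : T.K * ρ ≤ k.b₂ / 2) {y₀ : ℝ} (hy : |y₀| < ρ) {t : ℝ}
    (ht : 0 ≤ t) : T.y (φ t (σ (0, y₀))) =
      y₀ * Real.exp (∫ s in (0 : ℝ)..t, -T.rate₂ (φ s (σ (0, y₀)))) := by
  obtain ⟨-, hU, hx, hyy⟩ := T.σ_mem _ (mem_openSquare_axis (hy.trans hρr))
  rw [T.y_flow_eq _ ht fun s hs => (T.base_mem hρr hρK hy hs.1).1.1, φ.map_zero_apply, hyy]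

theorem base_y_ne {ρ : ℝ} (hρr : ρ < r) (hρK : T.K * ρ ≤ k.b₂ / 2) {y₀ : ℝ} (hy : |y₀| < ρ)
    (h0 : y₀ ≠ 0) {t : ℝ} (ht : 0 ≤ t) : T.y (φ t (σ (0, y₀))) ≠ 0 := by
  rw [T.base_y_eq hρr hρK hy ht]
  exact mul_ne_zero h0 (Real.exp_pos _).ne'

/-- Quantitative contraction along the local stable manifold. -/
theorem base_inv_sq {ρ : ℝ} (hρr : ρ < r) (hρK : T.K * ρ ≤ k.b₂ / 2) {y₀ : ℝ} (hy : |y₀| < ρ)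
    (h0 : y₀ ≠ 0) {s t : ℝ} (hs : 0 ≤ s) (hst : s ≤ t) :
    (T.y (φ s (σ (0, y₀))) ^ 2)⁻¹ + k.b₂ * (t - s) ≤ (T.y (φ t (σ (0, y₀))) ^ 2)⁻¹ := by
  set q := σ (0, y₀) with hq
  have := le_of_hasDerivAt_nonpos (f := fun t => k.b₂ * t - (T.y (φ t q) ^ 2)⁻¹) hst fun v hv => by
    have hv0 : 0 ≤ v := hs.trans hv.1
    obtain ⟨hm, hx⟩ := T.base_mem hρr hρK hy hv0
    have hne := T.base_y_ne hρr hρK hy h0 hv0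
    have d := ((T.deriv_y q v hm.1).pow 2).inv (pow_ne_zero 2 hne)
    refine ⟨_, ((hasDerivAt_id v).const_mul k.b₂).sub d, ?_⟩
    have h2 := T.rate₂_ge hρK hm hx
    rw [← hq] at h2 hne
    have e : k.b₂ * 1 - -((2 : ℕ) * T.y (φ v q) ^ (2 - 1) * -(T.y (φ v q) * (k.b₀ * T.x (φ v q) ^ 2 +
        k.b₁ * T.x (φ v q) * T.y (φ v q) + k.b₂ * T.y (φ v q) ^ 2 + T.r₂ (φ v q)))) /
        (T.y (φ v q) ^ 2) ^ 2 = k.b₂ - 2 * T.rate₂ (φ v q) / T.y (φ v q) ^ 2 := by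
      unfold rate₂; field_simp; push_cast; ring
    refine e.trans_le ?_
    rw [sub_nonpos, le_div_iff₀ (by positivity)]
    linarith
  linarith

theorem base_abs_lt {ρ : ℝ} (hρr : ρ < r) (hρK : T.K * ρ ≤ k.b₂ / 2) {y₀ : ℝ} (hy : |y₀| < ρ)
    (h0 : y₀ ≠ 0) {s t : ℝ} (hs : 0 ≤ s) (hst : s < t) :
    |T.y (φ t (σ (0, y₀)))| < |T.y (φ s (σ (0, y₀)))| := by
  have h1 := T.base_inv_sq hρr hρK hy h0 hs hst.le
  have n1 := T.base_y_ne hρr hρK hy h0 hs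
  have n2 := T.base_y_ne hρr hρK hy h0 (hs.trans hst.le)
  have h2 := mul_pos k.b₂_pos (sub_pos.2 hst)
  have h3 : (T.y (φ s (σ (0, y₀))) ^ 2)⁻¹ < (T.y (φ t (σ (0, y₀))) ^ 2)⁻¹ := by linarith
  rw [inv_lt_inv₀ (by positivity) (by positivity)] at h3
  exact sq_lt_sq.1 h3

theorem base_tendsto {ρ : ℝ} (hρr : ρ < r) (hρK : T.K * ρ ≤ k.b₂ / 2) {y₀ : ℝ} (hy : |y₀| < ρ)
    (h0 : y₀ ≠ 0) : Tendsto (fun t => |T.y (φ t (σ (0, y₀)))|) atTop (𝓝 0) := by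
  have h1 : Tendsto (fun t => (T.y (φ t (σ (0, y₀))) ^ 2)⁻¹) atTop atTop := by
    refine tendsto_atTop_mono' atTop ?_ (tendsto_id.const_mul_atTop k.b₂_pos)
    filter_upwards [eventually_ge_atTop 0] with t ht
    have h2 := T.base_inv_sq hρr hρK hy h0 le_rfl ht
    have : 0 ≤ (T.y (φ 0 (σ (0, y₀))) ^ 2)⁻¹ := by positivity
    simp only [id]
    linarith
  have h2 := tendsto_inv_atTop_zero.comp h1
  simp only [Function.comp_def, inv_inv] at h2
  have h3 := h2.sqrt
  simpa [Real.sqrt_sq_eq_abs] using h3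

/-- The logarithm of the normalized first integral along an orbit on the local stable manifold. -/
def baseLog (y₀ t : ℝ) : ℝ :=
  (1 - k.alpha) * Real.log (|T.y (φ t (σ (0, y₀)))|) +
    k.alpha * ∫ s in (0 : ℝ)..t, T.rate₁ (φ s (σ (0, y₀)))

theorem exists_baseLog_limit {ρ : ℝ} (hρr : ρ < r) (hρK : T.K * ρ ≤ k.b₂ / 2) {y₀ : ℝ}
    (hy : |y₀| < ρ) (h0 : y₀ ≠ 0) : ∃ H, Tendsto (T.baseLog y₀) atTop (𝓝 H) := by
  set q := σ (0, y₀) with hq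
  obtain ⟨c, hc⟩ : ∃ c, c = 2 * T.K / k.b₂ := ⟨_, rfl⟩
  have hb := k.b₂_pos
  have hK := T.K_nonneg
  have hc0 : 0 ≤ c := by rw [hc]; positivity
  have hcb : c * (k.b₂ / 2) = T.K := by rw [hc]; field_simp
  have ha0 := k.alpha_pos
  have ha1 := k.alpha_le_one
  have der : ∀ t, 0 ≤ t → ∃ d e, HasDerivAt (T.baseLog y₀) d t ∧
      HasDerivAt (fun t => |T.y (φ t q)|) e t ∧ |d| ≤ T.K * |T.y (φ t q)| ^ 3 ∧
      e ≤ -(k.b₂ / 2 * |T.y (φ t q)| ^ 3) := by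
    intro t ht
    obtain ⟨hm, hx⟩ := T.base_mem hρr hρK hy ht
    have hne := T.base_y_ne hρr hρK hy h0 ht
    rw [← hq] at hm hx hne
    have dy := T.deriv_y q t hm.1
    have dabs := (hasDerivAt_abs hne).comp t dy
    have dlog := dabs.log (abs_pos.2 hne).ne'
    have hV : IsOpen ((fun t => φ t q) ⁻¹' T.U) := T.isOpen_U.preimage (continuous_orbit q)
    have hF : ContinuousOn (fun t => T.rate₁ (φ t q)) ((fun t => φ t q) ⁻¹' T.U) :=
      T.continuousOn_rate₁.comp (continuous_orbit q).continuousOn fun _ h => h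
    have dint : HasDerivAt (fun t => ∫ s in (0 : ℝ)..t, T.rate₁ (φ s q)) (T.rate₁ (φ t q)) t := by
      refine intervalIntegral.integral_hasDerivAt_right (ContinuousOn.intervalIntegrable
        (hF.mono ?_)) (hF.stronglyMeasurableAtFilter hV t hm.1)
        (hF.continuousAt (hV.mem_nhds hm.1))
      rw [Set.uIcc_of_le ht]
      exact fun s hs => (T.base_mem hρr hρK hy hs.1).1.1
    have eabs : (SignType.sign (T.y (φ t q)) : ℝ) * -(T.y (φ t q) * (k.b₀ * T.x (φ t q) ^ 2 +
        k.b₁ * T.x (φ t q) * T.y (φ t q) + k.b₂ * T.y (φ t q) ^ 2 + T.r₂ (φ t q))) =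
        -(|T.y (φ t q)| * T.rate₂ (φ t q)) := by
      rw [mul_neg, ← mul_assoc, sign_mul_self]; rfl
    rw [eabs] at dabs dlog
    refine ⟨_, _, (dlog.const_mul (1 - k.alpha)).add (dint.const_mul k.alpha), dabs, ?_, ?_⟩
    · have e1 : (1 - k.alpha) * (-(|T.y (φ t q)| * T.rate₂ (φ t q)) / |T.y (φ t q)|) +
          k.alpha * T.rate₁ (φ t q) = -((1 - k.alpha) * T.r₂ (φ t q)) + k.alpha * T.r₁ (φ t q) := by
        have := (abs_pos.2 hne).ne'
        have h2 := k.alpha_mul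
        field_simp
        unfold rate₁ rate₂
        rw [hx]
        linear_combination T.y (φ t q) ^ 2 * h2
      refine (congrArg abs e1).trans_le ?_
      have b1 := T.bound₁ _ hm.1
      have b2 := T.bound₂ _ hm.1
      rw [hx, abs_zero, max_eq_right (abs_nonneg _)] at b1 b2
      refine (abs_add_le _ _).trans ?_
      rw [abs_neg, abs_mul, abs_mul, abs_of_nonneg (sub_nonneg.2 ha1), abs_of_pos ha0]
      have := mul_le_mul_of_nonneg_left b2 (sub_nonneg.2 ha1)
      have := mul_le_mul_of_nonneg_left b1 ha0.le
      linarith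
    · have h2 := T.rate₂_ge hρK hm hx
      have := mul_le_mul_of_nonneg_left h2 (abs_nonneg (T.y (φ t q)))
      rw [← sq_abs] at this
      linarith
  have hle : ∀ s t, 0 ≤ s → s ≤ t → T.baseLog y₀ s - c * |T.y (φ s q)| ≤
      T.baseLog y₀ t - c * |T.y (φ t q)| ∧ T.baseLog y₀ t + c * |T.y (φ t q)| ≤
      T.baseLog y₀ s + c * |T.y (φ s q)| := by
    intro s t hs hst
    constructor
    · have := le_of_hasDerivAt_nonpos (f := fun t => c * |T.y (φ t q)| - T.baseLog y₀ t) hst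
        fun v hv => by
          obtain ⟨d, e, h1, h2, h3, h4⟩ := der v (hs.trans hv.1)
          refine ⟨_, (h2.const_mul c).sub h1, ?_⟩
          have h5 := mul_le_mul_of_nonneg_left h4 hc0
          rw [mul_neg, ← mul_assoc, hcb] at h5
          linarith [(abs_le.1 h3).1]
      linarith
    · refine le_of_hasDerivAt_nonpos (f := fun t => T.baseLog y₀ t + c * |T.y (φ t q)|) hst
        fun v hv => ?_
      obtain ⟨d, e, h1, h2, h3, h4⟩ := der v (hs.trans hv.1)
      refine ⟨_, h1.add (h2.const_mul c), ?_⟩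
      have h5 := mul_le_mul_of_nonneg_left h4 hc0
      rw [mul_neg, ← mul_assoc, hcb] at h5
      linarith [(abs_le.1 h3).2]
  -- a monotone bounded function converges
  set f : ℝ → ℝ := fun t => T.baseLog y₀ (max t 0) - c * |T.y (φ (max t 0) q)| with hf
  have hmono : Monotone f := fun s t hst =>
    (hle _ _ (le_max_right _ _) (max_le_max_right 0 hst)).1
  have hbdd : BddAbove (Set.range f) := by
    refine ⟨T.baseLog y₀ 0 + c * |T.y (φ 0 q)|, ?_⟩
    rintro _ ⟨t, rfl⟩
    have := (hle 0 (max t 0) le_rfl (le_max_right _ _)).2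
    have h2 : 0 ≤ c * |T.y (φ (max t 0) q)| := by positivity
    simp only [hf]
    linarith
  have h1 := tendsto_atTop_ciSup hmono hbdd
  have h2 := (T.base_tendsto hρr hρK hy h0).const_mul c
  refine ⟨_, (h1.add h2).congr' ?_⟩
  filter_upwards [eventually_ge_atTop 0] with t ht
  simp only [hf, max_eq_left ht, ← hq]
  ring

theorem tendsto_integral_rate₁ {q₀ : M} {t₁ : ℝ} (ht₁ : 0 ≤ t₁)
    (h : ∀ s ∈ Set.Icc 0 t₁, φ s q₀ ∈ T.U) :
    Tendsto (fun q => ∫ s in (0 : ℝ)..t₁, T.rate₁ (φ s q)) (𝓝 q₀)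
      (𝓝 (∫ s in (0 : ℝ)..t₁, T.rate₁ (φ s q₀))) := by
  have cφ : Continuous fun z : M × ℝ => φ z.2 z.1 := φ.continuous continuous_snd continuous_fst
  rw [Metric.tendsto_nhds]
  intro ε hε
  have hη : 0 < ε / (t₁ + 1) := by positivity
  have ev : ∀ᶠ q in 𝓝 q₀, ∀ s ∈ Set.Icc 0 t₁, φ s q ∈ T.U ∧
      |T.rate₁ (φ s q) - T.rate₁ (φ s q₀)| < ε / (t₁ + 1) := by
    refine isCompact_Icc.eventually_forall_of_forall_eventually fun s hs => ?_
    have hU := T.isOpen_U.mem_nhds (h s hs)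
    have c1 : ContinuousAt (fun z : M × ℝ => T.rate₁ (φ z.2 z.1)) (q₀, s) :=
      ContinuousAt.comp (g := T.rate₁) (T.continuousOn_rate₁.continuousAt hU) cφ.continuousAt
    have c2 : ContinuousAt (fun z : M × ℝ => T.rate₁ (φ z.2 q₀)) (q₀, s) :=
      ContinuousAt.comp (g := T.rate₁) (f := fun z : M × ℝ => φ z.2 q₀)
        (T.continuousOn_rate₁.continuousAt hU)
        (φ.continuous continuous_snd continuous_const).continuousAt
    have c3 := (c1.sub c2).abs.eventually_lt_const (u := ε / (t₁ + 1)) (by simpa using hη)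
    filter_upwards [cφ.continuousAt (x := (q₀, s)) |>.eventually hU, c3] with z h1 h2
    exact ⟨h1, h2⟩
  filter_upwards [ev] with q hq
  have int : ∀ q, (∀ s ∈ Set.Icc 0 t₁, φ s q ∈ T.U) →
      IntervalIntegrable (fun s => T.rate₁ (φ s q)) volume 0 t₁ := fun q hq =>
    ContinuousOn.intervalIntegrable (T.continuousOn_rate₁.comp (continuous_orbit q).continuousOn
      (by rw [Set.uIcc_of_le ht₁]; exact hq))
  rw [dist_eq_norm, ← intervalIntegral.integral_sub (int q fun s hs => (hq s hs).1) (int q₀ h)]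
  have := intervalIntegral.norm_integral_le_of_norm_le_const (a := 0) (b := t₁)
    (C := ε / (t₁ + 1)) (f := fun s => T.rate₁ (φ s q) - T.rate₁ (φ s q₀)) fun s hs => by
      rw [Set.uIoc_of_le ht₁] at hs
      exact (hq s ⟨hs.1.le, hs.2⟩).2.le
  refine this.trans_lt ?_
  rw [sub_zero, abs_of_nonneg ht₁, div_mul_eq_mul_div, div_lt_iff₀ (by positivity)]
  nlinarith

end

end SaddleTube

namespace SaddleTube

noncomputable section

variable {k : SaddleCoeffs} {M : Type*} [TopologicalSpace M] {φ : Flow ℝ M} {S : Set M}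
  {σ : ℝ × ℝ → M} {r : ℝ} (T : SaddleTube k φ S σ r)

/-- The point of the section at height `y₀` and horizontal distance `t ^ (-1 / (2 alpha)) ξ` from the
local stable manifold. -/
def scaled (k : SaddleCoeffs) (σ : ℝ × ℝ → M) (ξ y₀ t : ℝ) : M :=
  σ (t ^ (-(2 * k.alpha)⁻¹) * ξ, y₀)

theorem tendsto_scale (k : SaddleCoeffs) (ξ : ℝ) :
    Tendsto (fun t : ℝ => t ^ (-(2 * k.alpha)⁻¹) * ξ) atTop (𝓝 0) := by
  have h1 := (tendsto_rpow_neg_atTop (y := (2 * k.alpha)⁻¹)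
    (by have := k.alpha_pos; positivity)).mul_const ξ
  rwa [zero_mul] at h1

theorem tendsto_scaled (T : SaddleTube k φ S σ r) {y₀ : ℝ} (hy : |y₀| < r) (ξ : ℝ) :
    Tendsto (scaled k σ ξ y₀) atTop (𝓝 (σ (0, y₀))) := by
  have h2 : Tendsto (fun t : ℝ => (t ^ (-(2 * k.alpha)⁻¹) * ξ, y₀)) atTop (𝓝 (0, y₀)) :=
    (tendsto_scale k ξ).prodMk_nhds tendsto_const_nhds
  exact ((T.continuousOn_σ.continuousAt ((isOpen_openSquare r).mem_nhds
    (mem_openSquare_axis hy))).tendsto).comp h2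

theorem eventually_scaled {y₀ : ℝ} (hy : |y₀| < r) (ξ : ℝ) : ∀ᶠ t in atTop,
    T.x (scaled k σ ξ y₀ t) = t ^ (-(2 * k.alpha)⁻¹) * ξ ∧ T.y (scaled k σ ξ y₀ t) = y₀ := by
  have h2 : Tendsto (fun t : ℝ => (t ^ (-(2 * k.alpha)⁻¹) * ξ, y₀)) atTop (𝓝 (0, y₀)) :=
    (tendsto_scale k ξ).prodMk_nhds tendsto_const_nhds
  filter_upwards [h2.eventually ((isOpen_openSquare r).mem_nhds (mem_openSquare_axis hy))] with t ht
  exact (T.σ_mem _ ht).2.2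

theorem eventually_orbit_mem {q₀ : M} {V : Set M} (hV : IsOpen V) {a b : ℝ}
    (h : ∀ s ∈ Set.Icc a b, φ s q₀ ∈ V) : ∀ᶠ q in 𝓝 q₀, ∀ s ∈ Set.Icc a b, φ s q ∈ V := by
  have cφ : Continuous fun z : M × ℝ => φ z.2 z.1 := φ.continuous continuous_snd continuous_fst
  refine isCompact_Icc.eventually_forall_of_forall_eventually fun s hs => ?_
  exact cφ.continuousAt (x := (q₀, s)) |>.eventually (hV.mem_nhds (h s hs))

/-- Limits, at a fixed time `t₁`, of the orbits that start at the scaled points. -/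
theorem scaled_limits {ρ : ℝ} (hρr : ρ < r) (hρK : T.K * ρ ≤ k.b₂ / 2) {y₀ : ℝ} (hy : |y₀| < ρ)
    (h0 : y₀ ≠ 0) (e : ℤˣ) {ξ : ℝ} (hξ : 0 < (e : ℤ) * (ξ * y₀)) {t₁ : ℝ} (ht₁ : 0 ≤ t₁) :
    Tendsto (fun t => T.x (φ t₁ (scaled k σ ξ y₀ t))) atTop (𝓝 0) ∧
    Tendsto (fun t => T.y (φ t₁ (scaled k σ ξ y₀ t))) atTop (𝓝 (T.y (φ t₁ (σ (0, y₀))))) ∧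
    Tendsto (fun t => Real.log |T.x (φ t₁ (scaled k σ ξ y₀ t))| -
      Real.log |T.y (φ t₁ (scaled k σ ξ y₀ t))|) atTop atBot ∧
    Tendsto (fun t => Real.exp (2 * (k.twist e).energy |T.x (φ t₁ (scaled k σ ξ y₀ t))|
      |T.y (φ t₁ (scaled k σ ξ y₀ t))|) * t) atTop
      (𝓝 (Real.exp (2 * (T.baseLog y₀ t₁ + (k.twist e).corr 0 + k.alpha * Real.log |ξ|)))) := by
  have hyr := hy.trans hρr
  have ha := k.alpha_pos
  have hξ0 : ξ ≠ 0 := by rintro rfl; simp at hξ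
  set q₀ := σ (0, y₀) with hq₀
  have hq := T.tendsto_scaled hyr ξ
  rw [← hq₀] at hq
  obtain ⟨hm, hx⟩ := T.base_mem hρr hρK hy ht₁
  have hne := T.base_y_ne hρr hρK hy h0 ht₁
  rw [← hq₀] at hm hx hne
  have cφ : ContinuousAt (fun q => φ t₁ q) q₀ :=
    (φ.continuous continuous_const continuous_id).continuousAt
  have cx : Tendsto (fun q => T.x (φ t₁ q)) (𝓝 q₀) (𝓝 0) := by
    have : ContinuousAt (fun q => T.x (φ t₁ q)) q₀ := ContinuousAt.comp (g := T.x)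
      (T.continuousOn_x.continuousAt (T.isOpen_U.mem_nhds hm.1)) cφ
    rw [← hx]; exact this
  have cy : Tendsto (fun q => T.y (φ t₁ q)) (𝓝 q₀) (𝓝 (T.y (φ t₁ q₀))) :=
    ContinuousAt.comp (g := T.y) (T.continuousOn_y.continuousAt (T.isOpen_U.mem_nhds hm.1)) cφ
  have hx' := cx.comp hq
  have hy' := cy.comp hq
  have hint := (T.tendsto_integral_rate₁ ht₁ fun s hs => (T.base_mem hρr hρK hy hs.1).1.1).comp hq
  have evU := hq.eventually (eventually_orbit_mem (a := 0) (b := t₁) T.isOpen_U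
    fun s hs => (T.base_mem hρr hρK hy hs.1).1.1)
  have hfor : ∀ᶠ t in atTop, T.x (φ t₁ (scaled k σ ξ y₀ t)) = t ^ (-(2 * k.alpha)⁻¹) * ξ *
      Real.exp (∫ s in (0 : ℝ)..t₁, T.rate₁ (φ s (scaled k σ ξ y₀ t))) := by
    filter_upwards [evU, T.eventually_scaled hyr ξ] with t h1 h2
    rw [T.x_flow_eq _ ht₁ h1, φ.map_zero_apply, h2.1]
  have hxne : ∀ᶠ t in atTop, T.x (φ t₁ (scaled k σ ξ y₀ t)) ≠ 0 := by
    filter_upwards [hfor, eventually_gt_atTop 0] with t h1 h2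
    rw [h1]
    exact mul_ne_zero (mul_ne_zero (Real.rpow_pos_of_pos h2 _).ne' hξ0) (Real.exp_pos _).ne'
  have hyl : Tendsto (fun t => Real.log |T.y (φ t₁ (scaled k σ ξ y₀ t))|) atTop
      (𝓝 (Real.log |T.y (φ t₁ q₀)|)) := hy'.abs.log (abs_pos.2 hne).ne'
  have hslope : Tendsto (fun t => Real.log |T.x (φ t₁ (scaled k σ ξ y₀ t))| -
      Real.log |T.y (φ t₁ (scaled k σ ξ y₀ t))|) atTop atBot := by
    refine Tendsto.atBot_add ?_ hyl.neg
    refine Real.tendsto_log_nhdsGT_zero.comp (tendsto_nhdsWithin_iff.2 ⟨?_, ?_⟩)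
    · simpa using hx'.abs
    · filter_upwards [hxne] with t ht using abs_pos.2 ht
  refine ⟨hx', hy', hslope, ?_⟩
  have hcorr : Tendsto (fun t => (k.twist e).corr (Real.exp
      (Real.log |T.x (φ t₁ (scaled k σ ξ y₀ t))| - Real.log |T.y (φ t₁ (scaled k σ ξ y₀ t))|)))
      atTop (𝓝 ((k.twist e).corr 0)) :=
    ((k.twist e).continuous_corr.tendsto 0).comp (Real.tendsto_exp_atBot.comp hslope)
  have hlim := ((((hyl.const_mul (1 - k.alpha)).add (hint.const_mul k.alpha)).add hcorr).add_const
    (k.alpha * Real.log |ξ|)).const_mul 2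
  refine ((Real.continuous_exp.tendsto _).comp hlim).congr' ?_
  filter_upwards [hfor, eventually_gt_atTop 0, hxne] with t h1 h2 h3
  have e1 : Real.log |T.x (φ t₁ (scaled k σ ξ y₀ t))| = -(2 * k.alpha)⁻¹ * Real.log t +
      Real.log |ξ| + ∫ s in (0 : ℝ)..t₁, T.rate₁ (φ s (scaled k σ ξ y₀ t)) := by
    have p1 := Real.rpow_pos_of_pos h2 (-(2 * k.alpha)⁻¹)
    rw [h1, abs_mul, abs_mul, abs_of_pos p1, abs_of_pos (Real.exp_pos _),
      Real.log_mul (mul_ne_zero p1.ne' (abs_pos.2 hξ0).ne') (Real.exp_pos _).ne',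
      Real.log_mul p1.ne' (abs_pos.2 hξ0).ne', Real.log_exp, Real.log_rpow h2]
  simp only [Function.comp]
  refine Eq.trans ?_ (congrArg (Real.exp (2 * (k.twist e).energy
    |T.x (φ t₁ (scaled k σ ξ y₀ t))| |T.y (φ t₁ (scaled k σ ξ y₀ t))|) * ·) (Real.exp_log h2))
  rw [← Real.exp_add]
  congr 1
  unfold SaddleCoeffs.energy SaddleCoeffs.logProfile
  rw [SaddleCoeffs.twist_alpha, e1]
  have : k.alpha * (2 * k.alpha)⁻¹ = 1 / 2 := by field_simp
  linear_combination (2 * Real.log t) * this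

/-- Up to the first exit from the tube of size `δ` the orbit lies in the closed tube. -/
theorem closedTube_of_first_exit {q : M} {δ a t : ℝ} (hδ : δ < r) (hat : a < t)
    (h : ∀ s, a ≤ s → s < t → φ s q ∈ T.tube δ) : ∀ s ∈ Set.Icc a t, φ s q ∈ T.closedTube δ := by
  intro s hs
  rcases hs.2.lt_or_eq with h1 | rfl
  · exact T.tube_subset_closedTube δ (h s hs.1 h1)
  · exact mem_of_forall_lt_mem (continuous_orbit q) (T.isClosed_tube δ hδ) hat
      fun u h1 h2 => T.tube_subset_closedTube δ (h u h1 h2)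

theorem le_max_of_not_mem_tube {m : M} {δ : ℝ} (hm : m ∈ T.U) (h : m ∉ T.tube δ) :
    δ ≤ max |T.x m| |T.y m| := by
  by_contra! hcon
  exact h ⟨hm, (le_max_left _ _).trans_lt hcon, (le_max_right _ _).trans_lt hcon⟩

/-- The sharp threshold for the horizontal distance of the starting point at which an orbit stays near
the periodic orbit for a given long time. -/
theorem exists_threshold (e : ℤˣ) : ∃ ρ₁, 0 < ρ₁ ∧ ∀ ρ, 0 < ρ → ρ ≤ ρ₁ → ρ < r →
    T.K * ρ ≤ k.b₂ / 2 → ∀ y₀, y₀ ≠ 0 → |y₀| < ρ → ∃ c, 0 < c ∧ ∀ ξ, 0 < (e : ℤ) * (ξ * y₀) →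
    (c < |ξ| → ∀ᶠ t in atTop, ¬ ∀ s ∈ Set.Icc 0 t, φ s (scaled k σ ξ y₀ t) ∈ T.tube ρ) ∧
    (|ξ| < c → ∀ δ, 0 < δ → ∃ t₁, 0 ≤ t₁ ∧ ∀ᶠ t in atTop, ∀ s ∈ Set.Icc t₁ (t + 1),
      φ s (scaled k σ ξ y₀ t) ∈ T.tube δ) := by
  obtain ⟨ε₁, C, hε₁, hC, -, hpass⟩ := (k.twist e).exists_passage_estimates T.K T.K_nonneg
  obtain ⟨ε₂, κ, hε₂, hκ, hexit⟩ := (k.twist e).exists_exit_slope T.K T.K_nonneg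
  obtain ⟨ε₃, D, hε₃, hD, hdur⟩ := (k.twist e).exists_duration_bound T.K T.K_nonneg
  obtain ⟨L₀, L₁, -, hL, -, hbot, htop, hL₀, hL₁, -⟩ := (k.twist e).exists_passTime_limits
  refine ⟨ε₃, hε₃, fun ρ hρ hρε hρr hρK y₀ h0 hy => ?_⟩
  obtain ⟨H, hH⟩ := T.exists_baseLog_limit hρr hρK hy h0
  have ha := k.alpha_pos
  obtain ⟨B, hB⟩ : ∃ B, B = H + (k.twist e).corr 0 := ⟨_, rfl⟩
  refine ⟨Real.exp ((Real.log (L₁ - L₀) - 2 * B) / (2 * k.alpha)), Real.exp_pos _, fun ξ hξ => ?_⟩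
  have hξ0 : ξ ≠ 0 := by rintro rfl; simp at hξ
  have hL' := sub_pos.2 hL
  set q := scaled k σ ξ y₀ with hq
  set P : ℝ → ℝ := fun t₁ => Real.exp (2 * (T.baseLog y₀ t₁ + (k.twist e).corr 0 +
    k.alpha * Real.log |ξ|)) with hP
  have hPlim : Tendsto P atTop (𝓝 (Real.exp (2 * (B + k.alpha * Real.log |ξ|)))) := by
    rw [hB]
    exact (Real.continuous_exp.tendsto _).comp (((hH.add_const _).add_const _).const_mul 2)
  set P' := Real.exp (2 * (B + k.alpha * Real.log |ξ|)) with hP'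
  have hsign : ∀ᶠ t in atTop, 0 < (e : ℤ) * (T.x (φ 0 (q t)) * T.y (φ 0 (q t))) := by
    filter_upwards [T.eventually_scaled (hy.trans hρr) ξ, eventually_gt_atTop 0] with t h1 h2
    rw [φ.map_zero_apply, h1.1, h1.2]
    have := mul_pos (Real.rpow_pos_of_pos h2 (-(2 * k.alpha)⁻¹)) hξ
    calc 0 < _ := this
      _ = _ := by ring
  -- everything that holds at a fixed intermediate time
  have hmid : ∀ δ, 0 < δ → ∀ E₀ t₁, 0 ≤ t₁ → |T.y (φ t₁ (σ (0, y₀)))| < min κ 1 * δ →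
      ∀ᶠ t in atTop, (∀ s ∈ Set.Icc 0 t₁, φ s (q t) ∈ T.tube ρ) ∧
        |T.x (φ t₁ (q t))| < min κ 1 * δ ∧ |T.y (φ t₁ (q t))| < min κ 1 * δ ∧
        (k.twist e).energy |T.x (φ t₁ (q t))| |T.y (φ t₁ (q t))| ≤ E₀ := by
    intro δ hδ E₀ t₁ ht₁ hyt
    obtain ⟨l1, l2, -, l4⟩ := T.scaled_limits hρr hρK hy h0 e hξ ht₁
    have e1 := (T.tendsto_scaled (hy.trans hρr) ξ).eventually (eventually_orbit_mem (a := 0)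
      (b := t₁) (T.isOpen_tube ρ) fun s hs => (T.base_mem hρr hρK hy (t := s) hs.1).1)
    have hκ' : 0 < min κ 1 := lt_min hκ one_pos
    have e2 := l1.abs.eventually_lt_const (u := min κ 1 * δ) (by rw [abs_zero]; positivity)
    have e3 := l2.abs.eventually_lt_const hyt
    have e4 := (l4.mul tendsto_inv_atTop_zero).eventually_lt_const (u := Real.exp (2 * E₀))
      (by rw [mul_zero]; exact Real.exp_pos _)
    filter_upwards [e1, e2, e3, e4, eventually_gt_atTop 0] with t h1 h2 h3 h4 h5
    refine ⟨h1, h2, h3, ?_⟩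
    rw [mul_assoc, mul_inv_cancel₀ h5.ne', mul_one, Real.exp_lt_exp] at h4
    linarith
  have hloglt : ∀ u, Real.log (L₁ - L₀) < u → L₁ - L₀ < Real.exp u := fun u h => by
    rwa [Real.log_lt_iff_lt_exp hL'] at h
  have hltlog : ∀ u, u < Real.log (L₁ - L₀) → Real.exp u < L₁ - L₀ := fun u h => by
    rwa [Real.lt_log_iff_exp_lt hL'] at h
  have hκδ : ∀ δ, 0 < δ → min κ 1 * δ ≤ δ ∧ min κ 1 * δ ≤ κ * δ := fun δ hδ =>
    ⟨mul_le_of_le_one_left hδ.le (min_le_right _ _),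
      mul_le_mul_of_nonneg_right (min_le_left _ _) hδ.le⟩
  have hsmall : ∀ᶠ δ : ℝ in 𝓝[>] 0, 0 < δ ∧ δ ≤ ε₁ ∧ δ ≤ ε₂ ∧ δ < r := by
    filter_upwards [self_mem_nhdsWithin, mem_nhdsWithin_of_mem_nhds (gt_mem_nhds hε₁),
      mem_nhdsWithin_of_mem_nhds (gt_mem_nhds hε₂), mem_nhdsWithin_of_mem_nhds (gt_mem_nhds T.r_pos)]
      with δ h1 h2 h3 h4 using ⟨h1, h2.le, h3.le, h4⟩
  have hyto := T.base_tendsto hρr hρK hy h0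
  constructor
  · intro hcξ
    have hΘ : L₁ - L₀ < P' := by
      apply hloglt
      have h1 := (Real.lt_log_iff_exp_lt (abs_pos.2 hξ0)).2 hcξ
      rw [div_lt_iff₀ (by positivity)] at h1
      linarith
    obtain ⟨δ, ⟨hδ, hδ1, hδ2, hδr⟩, hδP⟩ : ∃ δ : ℝ, (0 < δ ∧ δ ≤ ε₁ ∧ δ ≤ ε₂ ∧ δ < r) ∧
        L₁ - L₀ < (1 - C * δ) * P' := by
      have c1 : Tendsto (fun δ : ℝ => (1 - C * δ) * P') (𝓝[>] 0) (𝓝 ((1 - C * 0) * P')) :=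
        (Continuous.tendsto (by fun_prop) 0).mono_left nhdsWithin_le_nhds
      exact (hsmall.and (c1.eventually_const_lt (by simpa using hΘ))).exists
    obtain ⟨E₀, hE₀⟩ := hexit δ hδ hδ2 0
    have hκ' : 0 < min κ 1 := lt_min hκ one_pos
    obtain ⟨t₁, ht₁, hyt, hPt⟩ : ∃ t₁, 0 ≤ t₁ ∧ |T.y (φ t₁ (σ (0, y₀)))| < min κ 1 * δ ∧
        L₁ - L₀ < (1 - C * δ) * P t₁ :=
      ((eventually_ge_atTop 0).and ((hyto.eventually_lt_const (by positivity)).and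
        ((hPlim.const_mul (1 - C * δ)).eventually_const_lt hδP))).exists
    obtain ⟨-, -, -, l4⟩ := T.scaled_limits hρr hρK hy h0 e hξ ht₁
    have lim : Tendsto (fun t => (1 - C * δ) * Real.exp (2 * (k.twist e).energy
        |T.x (φ t₁ (q t))| |T.y (φ t₁ (q t))|) * (t - t₁ - D / δ ^ 2)) atTop
        (𝓝 ((1 - C * δ) * P t₁)) := by
      have l5 := (l4.mul (tendsto_const_nhds.sub
        (tendsto_inv_atTop_zero.const_mul (t₁ + D / δ ^ 2)) :
        Tendsto (fun t : ℝ => 1 - (t₁ + D / δ ^ 2) * t⁻¹) atTop _)).const_mul (1 - C * δ)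
      rw [mul_zero, sub_zero, mul_one] at l5
      refine l5.congr' ?_
      filter_upwards [eventually_gt_atTop 0] with t ht
      field_simp
      ring
    filter_upwards [lim.eventually_const_lt hPt, hmid δ hδ E₀ t₁ ht₁ hyt, hsign,
      eventually_ge_atTop t₁] with t c1 c234 c5 c6 hstay
    obtain ⟨-, c2, c3, c4⟩ := c234
    have horb := T.isOrbitAt_abs (q t) e (fun s hs => (hstay s hs).1) c5
    have hfin : ∀ t₂, t₁ ≤ t₂ → t₂ ≤ t → (∀ s ∈ Set.Icc t₁ t₂, φ s (q t) ∈ T.closedTube δ) →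
        t - t₂ ≤ D / δ ^ 2 → False := by
      intro t₂ h1 h2 h3 h4
      obtain ⟨-, -, b1, -⟩ := hpass δ t₁ t₂ _ _ hδ1 h1 fun s hs =>
        ⟨horb s ⟨ht₁.trans hs.1, hs.2.trans h2⟩, (h3 s hs).2.1, (h3 s hs).2.2⟩
      have b2 := hL₁ (Real.log |T.x (φ t₂ (q t))| - Real.log |T.y (φ t₂ (q t))|)
      have b3 := hL₀ (Real.log |T.x (φ t₁ (q t))| - Real.log |T.y (φ t₁ (q t))|)
      have hpos : 0 ≤ 1 - C * δ := by
        by_contra! hneg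
        have := mul_neg_of_neg_of_pos hneg (Real.exp_pos (2 * (B + k.alpha * Real.log |ξ|)))
        linarith
      have b4 : (1 - C * δ) * Real.exp (2 * (k.twist e).energy |T.x (φ t₁ (q t))|
          |T.y (φ t₁ (q t))|) * (t - t₁ - D / δ ^ 2) ≤ (1 - C * δ) * Real.exp (2 *
          (k.twist e).energy |T.x (φ t₁ (q t))| |T.y (φ t₁ (q t))|) * (t₂ - t₁) :=
        mul_le_mul_of_nonneg_left (by linarith) (mul_nonneg hpos (Real.exp_pos _).le)
      linarith
    have hin : φ t₁ (q t) ∈ T.tube δ :=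
      ⟨(hstay t₁ ⟨ht₁, c6⟩).1, c2.trans_le (hκδ δ hδ).1, c3.trans_le (hκδ δ hδ).1⟩
    by_cases hall : ∀ s ∈ Set.Icc t₁ t, φ s (q t) ∈ T.tube δ
    · exact hfin t c6 le_rfl (fun s hs => T.tube_subset_closedTube δ (hall s hs))
        (by rw [sub_self]; positivity)
    · obtain ⟨t₂, h1, h2, h3, h4⟩ := exists_first_exit (continuous_orbit (φ := φ) (q t))
        (T.isOpen_tube δ) hin hall
      have hcl := T.closedTube_of_first_exit hδr h1 h4
      have hmax := T.le_max_of_not_mem_tube (hcl t₂ ⟨h1.le, le_rfl⟩).1 h3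
      have hs := hE₀ t₁ t₂ _ _ h1.le (fun s hs => ⟨horb s ⟨ht₁.trans hs.1, hs.2.trans h2⟩,
        (hcl s hs).2.1, (hcl s hs).2.2⟩)
        (max_le (c2.le.trans (hκδ δ hδ).2) (c3.le.trans (hκδ δ hδ).2)) hmax c4
      obtain ⟨px, py, -⟩ := horb t₂ ⟨ht₁.trans h1.le, h2⟩
      have hxy : |T.y (φ t₂ (q t))| ≤ |T.x (φ t₂ (q t))| :=
        (Real.log_le_log_iff py px).1 (sub_nonneg.1 hs)
      rw [max_eq_left hxy] at hmax
      have hd := (hdur t₂ t _ _ h2 fun s hs => ⟨horb s ⟨(ht₁.trans h1.le).trans hs.1, hs.2⟩,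
        (hstay s ⟨(ht₁.trans h1.le).trans hs.1, hs.2⟩).2.1.le.trans hρε,
        (hstay s ⟨(ht₁.trans h1.le).trans hs.1, hs.2⟩).2.2.le.trans hρε⟩).1 hxy
      refine hfin t₂ h1.le h2 hcl ?_
      rw [le_div_iff₀ (by positivity)]
      refine le_trans ?_ hd
      have := sub_nonneg.2 h2
      gcongr
  · intro hcξ δ₀ hδ₀
    have hΘ : P' < L₁ - L₀ := by
      apply hltlog
      have h1 := (Real.log_lt_iff_lt_exp (abs_pos.2 hξ0)).2 hcξ
      rw [lt_div_iff₀ (by positivity)] at h1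
      linarith
    obtain ⟨δ, ⟨⟨hδ, hδ1, hδ2, hδr⟩, hδ₀δ⟩, hδP⟩ : ∃ δ : ℝ, ((0 < δ ∧ δ ≤ ε₁ ∧ δ ≤ ε₂ ∧ δ < r) ∧
        δ < δ₀) ∧ (1 + C * δ) * P' < L₁ - L₀ := by
      have c1 : Tendsto (fun δ : ℝ => (1 + C * δ) * P') (𝓝[>] 0) (𝓝 ((1 + C * 0) * P')) :=
        (Continuous.tendsto (by fun_prop) 0).mono_left nhdsWithin_le_nhds
      exact ((hsmall.and (mem_nhdsWithin_of_mem_nhds (gt_mem_nhds hδ₀))).and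
        (c1.eventually_lt_const (by simpa using hΘ))).exists
    have hκ' : 0 < min κ 1 := lt_min hκ one_pos
    obtain ⟨t₁, ht₁, hyt, hPt⟩ : ∃ t₁, 0 ≤ t₁ ∧ |T.y (φ t₁ (σ (0, y₀)))| < min κ 1 * δ ∧
        (1 + C * δ) * P t₁ < L₁ - L₀ :=
      ((eventually_ge_atTop 0).and ((hyto.eventually_lt_const (by positivity)).and
        ((hPlim.const_mul (1 + C * δ)).eventually_lt_const hδP))).exists
    obtain ⟨η, hη⟩ : ∃ η, η = (L₁ - L₀ - (1 + C * δ) * P t₁) / 3 := ⟨_, rfl⟩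
    have hη0 : 0 < η := by rw [hη]; linarith
    obtain ⟨s₀, hs₀⟩ := (htop.eventually_const_lt (show L₁ - η < L₁ by linarith)).exists
    obtain ⟨E₀, hE₀⟩ := hexit δ hδ hδ2 s₀
    obtain ⟨-, -, l3, l4⟩ := T.scaled_limits hρr hρK hy h0 e hξ ht₁
    have lim : Tendsto (fun t => (1 + C * δ) * Real.exp (2 * (k.twist e).energy
        |T.x (φ t₁ (q t))| |T.y (φ t₁ (q t))|) * (t + 1)) atTop
        (𝓝 ((1 + C * δ) * P t₁)) := by
      have l5 := (l4.mul (tendsto_const_nhds.add tendsto_inv_atTop_zero :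
        Tendsto (fun t : ℝ => 1 + t⁻¹) atTop _)).const_mul (1 + C * δ)
      rw [add_zero, mul_one] at l5
      refine l5.congr' ?_
      filter_upwards [eventually_gt_atTop 0] with t ht
      field_simp
      ring
    refine ⟨t₁, ht₁, ?_⟩
    filter_upwards [lim.eventually_lt_const (show _ < L₁ - L₀ - 2 * η by rw [hη]; linarith),
      hmid δ hδ E₀ t₁ ht₁ hyt, hsign, (hbot.comp l3).eventually_lt_const
      (show L₀ < L₀ + η by linarith)] with t c1 c234 c5 c6
    obtain ⟨c0, c2, c3, c4⟩ := c234
    have hin : φ t₁ (q t) ∈ T.tube δ :=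
      ⟨(c0 t₁ ⟨ht₁, le_rfl⟩).1, c2.trans_le (hκδ δ hδ).1, c3.trans_le (hκδ δ hδ).1⟩
    by_contra hcon
    have hcon' : ¬ ∀ s ∈ Set.Icc t₁ (t + 1), φ s (q t) ∈ T.tube δ := fun h =>
      hcon fun s hs => T.tube_mono hδ₀δ.le (h s hs)
    obtain ⟨t₂, h1, h2, h3, h4⟩ := exists_first_exit (continuous_orbit (φ := φ) (q t))
      (T.isOpen_tube δ) hin hcon'
    have hcl := T.closedTube_of_first_exit hδr h1 h4
    have hmax := T.le_max_of_not_mem_tube (hcl t₂ ⟨h1.le, le_rfl⟩).1 h3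
    have horb := T.isOrbitAt_abs (q t) e (a := 0) (b := t₂) (fun s hs => by
      rcases le_total s t₁ with h | h
      · exact (c0 s ⟨hs.1, h⟩).1
      · exact (hcl s ⟨h, hs.2⟩).1) c5
    have horb' : ∀ s ∈ Set.Icc t₁ t₂, (k.twist e).IsOrbitAt T.K (fun t' => |T.x (φ t' (q t))|)
        (fun t' => |T.y (φ t' (q t))|) s ∧ |T.x (φ s (q t))| ≤ δ ∧ |T.y (φ s (q t))| ≤ δ :=
      fun s hs => ⟨horb s ⟨ht₁.trans hs.1, hs.2⟩, (hcl s hs).2.1, (hcl s hs).2.2⟩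
    have hs := hE₀ t₁ t₂ _ _ h1.le horb'
      (max_le (c2.le.trans (hκδ δ hδ).2) (c3.le.trans (hκδ δ hδ).2)) hmax c4
    obtain ⟨-, -, -, b1⟩ := hpass δ t₁ t₂ _ _ hδ1 h1.le horb'
    have b2 := (k.twist e).strictMono_passTime.monotone hs
    simp only [Function.comp] at c6
    have b4 : (1 + C * δ) * Real.exp (2 * (k.twist e).energy |T.x (φ t₁ (q t))|
        |T.y (φ t₁ (q t))|) * (t₂ - t₁) ≤ (1 + C * δ) * Real.exp (2 *
        (k.twist e).energy |T.x (φ t₁ (q t))| |T.y (φ t₁ (q t))|) * (t + 1) :=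
      mul_le_mul_of_nonneg_left (by linarith) (by positivity)
    linarith

/-- A uniform bound for the time an orbit can spend in a small tube. -/
theorem exists_uniform_bound : ∃ ρ₂ D, 0 < ρ₂ ∧ 0 < D ∧ ∀ (q : M) (t : ℝ), 0 ≤ t →
    (∀ s ∈ Set.Icc 0 t, φ s q ∈ T.tube ρ₂) → T.x q ≠ 0 → T.y q ≠ 0 →
    (|T.y q| ≤ |T.x q| → t * |T.x q| ^ 2 ≤ D) ∧
    (|T.x q| ≤ |T.y q| → t * |T.y q| ^ 2 * (|T.x q| / |T.y q|) ^ (2 * k.alpha) ≤ D) := by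
  have hdur := fun e => (k.twist e).exists_duration_bound T.K T.K_nonneg
  choose ε D hε hD hdur using hdur
  refine ⟨min (ε 1) (ε (-1)), max (D 1) (D (-1)), lt_min (hε 1) (hε (-1)),
    lt_max_of_lt_left (hD 1), fun q t ht hin hx hy => ?_⟩
  obtain ⟨e, he⟩ : ∃ e : ℤˣ, 0 < (e : ℤ) * (T.x q * T.y q) := by
    rcases lt_or_gt_of_ne (mul_ne_zero hx hy) with h | h
    · exact ⟨-1, by simpa using h⟩
    · exact ⟨1, by simpa using h⟩
  have hε' : min (ε 1) (ε (-1)) ≤ ε e := by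
    rcases Int.units_eq_one_or e with rfl | rfl
    · exact min_le_left _ _
    · exact min_le_right _ _
  have hD' : D e ≤ max (D 1) (D (-1)) := by
    rcases Int.units_eq_one_or e with rfl | rfl
    · exact le_max_left _ _
    · exact le_max_right _ _
  have horb := T.isOrbitAt_abs q e (fun s hs => (hin s hs).1)
    (by rw [φ.map_zero_apply]; exact he)
  have := hdur e 0 t _ _ ht fun s hs => ⟨horb s hs, (hin s hs).2.1.le.trans hε',
    (hin s hs).2.2.le.trans hε'⟩
  simp only [φ.map_zero_apply, sub_zero, SaddleCoeffs.twist_alpha] at this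
  exact ⟨fun h => (this.1 h).trans hD', fun h => (this.2 h).trans hD'⟩

end

end SaddleTube

section FirstHit

variable {M : Type*} [TopologicalSpace M] {φ : Flow ℝ M} {A : Set M} {q : M}

theorem firstHit_le_of_mem {s : ℝ} (hs : 0 < s) (h : φ s q ∈ A) :
    firstHit φ A q ≤ ENNReal.ofReal s :=
  iInf_le_of_le s (iInf_le_of_le hs (iInf_le_of_le h le_rfl))

theorem not_mem_of_lt_firstHit {t s : ℝ} (h : ENNReal.ofReal t < firstHit φ A q) (hs : 0 < s)
    (hst : s ≤ t) : φ s q ∉ A := fun hA =>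
  absurd (h.trans_le (firstHit_le_of_mem hs hA)) (not_lt.2 (ENNReal.ofReal_le_ofReal hst))

theorem le_firstHit_of_forall {t : ℝ} (h : ∀ s, 0 < s → s ≤ t → φ s q ∉ A) :
    ENNReal.ofReal t ≤ firstHit φ A q := by
  refine le_iInf fun s => le_iInf fun hs => le_iInf fun hA => ENNReal.ofReal_le_ofReal ?_
  by_contra! hst
  exact h s hs hst.le hA

theorem exists_hit_of_firstHit_lt {c : ℝ≥0∞} (h : firstHit φ A q < c) :
    ∃ s, 0 < s ∧ ENNReal.ofReal s < c ∧ φ s q ∈ A := by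
  simp only [firstHit, iInf_lt_iff] at h
  obtain ⟨s, hs, hA, hc⟩ := h
  exact ⟨s, hs, hc, hA⟩

end FirstHit

namespace SaddleTube

noncomputable section

variable {k : SaddleCoeffs} {M : Type*} [TopologicalSpace M] {φ : Flow ℝ M} {S : Set M}
  {σ : ℝ × ℝ → M} {r : ℝ} (T : SaddleTube k φ S σ r)

/-- A time within which every orbit returns to the section. -/
def gap : ℝ := |T.hmax| + 1

theorem exists_next_hit {q : M} (hq : q ∈ S) : ∃ s, 0 < s ∧ s < T.gap ∧ φ s q ∈ S := by
  have h1 : firstHit φ S q < ENNReal.ofReal T.gap := by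
    refine (T.firstHit_le q hq).trans_lt ((ENNReal.ofReal_lt_ofReal_iff ?_).2 ?_)
    · unfold gap; positivity
    · unfold gap; linarith [le_abs_self T.hmax]
  obtain ⟨s, hs, hs2, hA⟩ := exists_hit_of_firstHit_lt h1
  exact ⟨s, hs, (ENNReal.ofReal_lt_ofReal_iff_of_nonneg hs.le).1 hs2, hA⟩

theorem hmin_le_of_hit {q : M} (hq : q ∈ S) {s : ℝ} (hs : 0 < s) (h : φ s q ∈ S) :
    T.hmin ≤ s :=
  (ENNReal.ofReal_le_ofReal_iff hs.le).1 ((T.le_firstHit q hq).trans (firstHit_le_of_mem hs h))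

theorem countable_hits (T : SaddleTube k φ S σ r) (m : M) : {s : ℝ | φ s m ∈ S}.Countable := by
  refine Set.PairwiseDisjoint.countable_of_Ioo (y := fun s => s + T.hmin) ?_
    fun s _ => by linarith [T.hmin_pos]
  have key : ∀ s s', φ s m ∈ S → φ s' m ∈ S → s < s' → s + T.hmin ≤ s' := by
    intro s s' h h' hlt
    have := T.hmin_le_of_hit h (sub_pos.2 hlt) (by rw [← φ.map_add]; simpa using h')
    linarith
  intro s hs s' hs' hne
  rw [Function.onFun, Set.disjoint_left]
  rintro u ⟨h1, h2⟩ ⟨h3, h4⟩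
  rcases lt_or_gt_of_ne hne with hlt | hlt
  · linarith [key s s' hs hs' hlt]
  · linarith [key s' s hs' hs hlt]

theorem σ_inj {p p' : ℝ × ℝ} (T : SaddleTube k φ S σ r) (hp : p ∈ openSquare r)
    (hp' : p' ∈ openSquare r) (h : σ p = σ p') : p = p' := by
  obtain ⟨-, -, h1, h2⟩ := T.σ_mem p hp
  obtain ⟨-, -, h3, h4⟩ := T.σ_mem p' hp'
  rw [h] at h1 h2
  exact Prod.ext (h1.symm.trans h3) (h2.symm.trans h4)

theorem mem_of_σ_mem_image {p : ℝ × ℝ} (T : SaddleTube k φ S σ r) (hp : p ∈ openSquare r)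
    {P : Set (ℝ × ℝ)} (hP : P ⊆ openSquare r) (h : σ p ∈ σ '' P) : p ∈ P := by
  obtain ⟨p', hp', he⟩ := h
  rwa [← T.σ_inj (hP hp') hp he]

/-- An orbit that meets the section only inside a small set stays in a tube. -/
theorem stays_of_no_hit {ρ ε : ℝ} (hεr : ε ≤ r)
    (hstay : ∀ q ∈ T.tube ε, ∀ t, |t| ≤ T.gap → φ t q ∈ T.tube ρ) {P : Set (ℝ × ℝ)}
    (hP : P ⊆ openSquare ε) {q : M} {t : ℝ} (hq : q ∈ S) (ht : T.gap ≤ t)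
    (hno : ∀ s, 0 < s → s ≤ t → φ s q ∉ S \ σ '' P) : ∀ s ∈ Set.Icc 0 t, φ s q ∈ T.tube ρ := by
  have hPt : ∀ s, 0 < s → s ≤ t → φ s q ∈ S → φ s q ∈ T.tube ε := by
    intro s h1 h2 h3
    have h4 : φ s q ∈ σ '' P := by
      by_contra h
      exact hno s h1 h2 ⟨h3, h⟩
    obtain ⟨p, hp, he⟩ := h4
    obtain ⟨-, h5, h6, h7⟩ := T.σ_mem p (openSquare_mono hεr (hP hp))
    rw [he] at h5 h6 h7
    exact ⟨h5, h6 ▸ (hP hp).1, h7 ▸ (hP hp).2⟩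
  have shift : ∀ u s, φ s q = φ (s - u) (φ u q) := fun u s => by
    rw [← φ.map_add, sub_add_cancel]
  obtain ⟨s₁, h1, h2, h3⟩ := T.exists_next_hit hq
  intro s hs
  rcases le_total s s₁ with h | h
  · rw [shift s₁ s]
    refine hstay _ (hPt s₁ h1 (h2.le.trans ht) h3) _ ?_
    rw [abs_le]; constructor <;> linarith [hs.1]
  · set A := Set.Icc s₁ s ∩ (fun u => φ u q) ⁻¹' S with hA
    have hc : IsCompact A := isCompact_Icc.inter_right
      (T.isClosed_S.preimage (continuous_orbit q))
    obtain ⟨u, hu, hmax⟩ := hc.exists_isMaxOn (f := id) ⟨s₁, ⟨le_rfl, h⟩, h3⟩ continuousOn_id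
    obtain ⟨v, hv1, hv2, hv3⟩ := T.exists_next_hit (q := φ u q) hu.2
    have hus : s < u + v := by
      by_contra! hcon
      have : u + v ∈ A := ⟨⟨by linarith [hu.1.1], hcon⟩, by
        simp only [Set.mem_preimage]; rw [add_comm, φ.map_add]; exact hv3⟩
      have h5 := hmax this
      simp only [id, Set.mem_ofPred_eq] at h5
      linarith
    rw [shift u s]
    refine hstay _ (hPt u (h1.trans_le hu.1.1) (hu.1.2.trans hs.2) hu.2) _ ?_
    rw [abs_le]; constructor <;> linarith [hu.1.2]

/-- The coordinates of the points of the induced section with large return time. -/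
def slowSet (φ : Flow ℝ M) (S : Set M) (σ : ℝ × ℝ → M) (P : Set (ℝ × ℝ)) (ρ t : ℝ) :
    Set (ℝ × ℝ) :=
  {p ∈ openSquare ρ | σ p ∈ S \ σ '' P ∧ ENNReal.ofReal t < firstHit φ (S \ σ '' P) (σ p)}

/-- The point `(0, y₀)` lies outside `P`, and its orbit meets the section only in `P` later on. -/
def IsEntry (φ : Flow ℝ M) (S : Set M) (σ : ℝ × ℝ → M) (P : Set (ℝ × ℝ)) (y₀ : ℝ) : Prop :=
  (0, y₀) ∉ P ∧ ∀ s, 0 < s → φ s (σ (0, y₀)) ∉ S \ σ '' P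

/-- The orbit of `(0, y₀)` meets the boundary of `P`. -/
def IsExceptional (φ : Flow ℝ M) (σ : ℝ × ℝ → M) (P : Set (ℝ × ℝ)) (y₀ : ℝ) : Prop :=
  ∃ s, 0 ≤ s ∧ φ s (σ (0, y₀)) ∈ σ '' (frontier P ∩ {p | p.1 = 0})

theorem countable_exceptional (T : SaddleTube k φ S σ r) {P : Set (ℝ × ℝ)}
    (hfin : (frontier P ∩ {p | p.1 = 0}).Finite) :
    {y₀ : ℝ | |y₀| < r ∧ IsExceptional φ σ P y₀}.Countable := by
  have h1 : {y₀ : ℝ | |y₀| < r ∧ IsExceptional φ σ P y₀} ⊆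
      ⋃ p ∈ frontier P ∩ {p | p.1 = 0}, (fun s => T.y (φ s (σ p))) '' {s | φ s (σ p) ∈ S} := by
    rintro y₀ ⟨hy, s, hs, p, hp, he⟩
    have h2 := T.σ_mem _ (mem_openSquare_axis hy)
    have h3 : φ (-s) (σ p) = σ (0, y₀) := by
      rw [he, ← φ.map_add, neg_add_cancel, φ.map_zero_apply]
    refine Set.mem_biUnion hp ⟨-s, ?_, ?_⟩
    · simp only [Set.mem_ofPred_eq]; rw [h3]; exact h2.1
    · simp only; rw [h3]; exact h2.2.2.2
  exact (hfin.countable.biUnion fun p _ => (T.countable_hits (σ p)).image _).mono h1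

theorem isClosed_image [T2Space M] {P : Set (ℝ × ℝ)} (T : SaddleTube k φ S σ r) (hP : IsCompact P)
    (hPr : P ⊆ openSquare r) : IsClosed (σ '' P) :=
  (hP.image_of_continuousOn (T.continuousOn_σ.mono hPr)).isClosed

theorem tendsto_scaled_point (k : SaddleCoeffs) (ξ y₀ : ℝ) :
    Tendsto (fun t : ℝ => (t ^ (-(2 * k.alpha)⁻¹) * ξ, y₀)) atTop (𝓝 (0, y₀)) :=
  (tendsto_scale k ξ).prodMk_nhds tendsto_const_nhds

/-- Away from entry points and exceptional points, scaled points are eventually not slow. -/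
theorem eventually_not_slow [T2Space M] {ρ : ℝ} (hρr : ρ < r)
    (hρK : T.K * ρ ≤ k.b₂ / 2) {P : Set (ℝ × ℝ)} (hP : IsCompact P) (hPr : P ⊆ openSquare r)
    {y₀ : ℝ} (hy : |y₀| < ρ) (hexc : ¬ IsExceptional φ σ P y₀)
    (hent : ¬ IsEntry φ S σ P y₀) (ξ : ℝ) :
    ∀ᶠ t in atTop, (t ^ (-(2 * k.alpha)⁻¹) * ξ, y₀) ∉ slowSet φ S σ P ρ t := by
  by_cases h0 : (0, y₀) ∈ P
  · have hint : (0, y₀) ∈ interior P := by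
      by_contra hcon
      refine hexc ⟨0, le_rfl, (0, y₀), ⟨⟨subset_closure h0, hcon⟩, rfl⟩, ?_⟩
      rw [φ.map_zero_apply]
    filter_upwards [(tendsto_scaled_point k ξ y₀).eventually (isOpen_interior.mem_nhds hint)]
      with t ht hslow
    exact hslow.2.1.2 ⟨_, interior_subset ht, rfl⟩
  · simp only [IsEntry, not_and, not_forall, not_not] at hent
    obtain ⟨s, hs, hhit⟩ := hent h0
    have hN := (T.isClosed_image hP hPr).isOpen_compl.mem_nhds hhit.2
    have h1 := T.persist _ s hs hhit.1 (T.base_mem hρr hρK hy hs.le).1.1 _ hN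
    filter_upwards [(T.tendsto_scaled (hy.trans hρr) ξ).eventually h1, eventually_ge_atTop (s + 1)]
      with t ht hts hslow
    obtain ⟨s', hs', hs'2, hS', hN'⟩ := ht
    exact not_mem_of_lt_firstHit hslow.2.2 hs' (hs'2.trans hts) ⟨hS', hN'⟩

/-- Scaled points above an entry point are slow as soon as they stay close to the periodic orbit from
some time on. -/
theorem eventually_slow {ρ : ℝ} (hρr : ρ < r)
    (hρK : T.K * ρ ≤ k.b₂ / 2) {P : Set (ℝ × ℝ)} (hP : IsCompact P) (hPr : P ⊆ openSquare r)
    {y₀ : ℝ} (hy : |y₀| < ρ) (hexc : ¬ IsExceptional φ σ P y₀)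
    (hent : IsEntry φ S σ P y₀) (ξ : ℝ) {δ t₁ : ℝ} (hδP : openSquare δ ⊆ P)
    (hnear : ∀ᶠ t in atTop, ∀ s ∈ Set.Icc t₁ (t + 1), φ s (scaled k σ ξ y₀ t) ∈ T.tube δ) :
    ∀ᶠ t in atTop, (t ^ (-(2 * k.alpha)⁻¹) * ξ, y₀) ∈ slowSet φ S σ P ρ t := by
  set O : Set M := T.U ∩ (fun m => (T.x m, T.y m)) ⁻¹' interior P with hO
  have hOo : IsOpen O := (T.continuousOn_x.prodMk T.continuousOn_y).isOpen_inter_preimage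
    T.isOpen_U isOpen_interior
  have hV : IsOpen (Sᶜ ∪ O) := T.isClosed_S.isOpen_compl.union hOo
  have hh := half_pos T.hmin_pos
  have hbase : ∀ s ∈ Set.Icc (T.hmin / 2) t₁, φ s (σ (0, y₀)) ∈ Sᶜ ∪ O := by
    intro s hs
    by_cases hS : φ s (σ (0, y₀)) ∈ S
    · right
      have hs0 : 0 < s := hh.trans_le hs.1
      obtain ⟨hm, hx⟩ := T.base_mem hρr hρK hy hs0.le
      have himg : φ s (σ (0, y₀)) ∈ σ '' P := by
        by_contra h
        exact hent.2 s hs0 ⟨hS, h⟩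
      obtain ⟨p, hp, he⟩ := himg
      obtain ⟨-, -, h1, h2⟩ := T.σ_mem p (hPr hp)
      rw [he] at h1 h2
      refine ⟨hm.1, ?_⟩
      simp only [Set.mem_preimage]
      rw [h1, h2]
      by_contra hcon
      exact hexc ⟨s, hs0.le, p, ⟨⟨subset_closure hp, hcon⟩, h1.symm.trans hx⟩, he⟩
    · exact Or.inl hS
  have hyr := hy.trans hρr
  have sq : ∀ᶠ t in atTop, (t ^ (-(2 * k.alpha)⁻¹) * ξ, y₀) ∈ openSquare ρ :=
    (tendsto_scaled_point k ξ y₀).eventually ((isOpen_openSquare ρ).mem_nhds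
      (mem_openSquare_axis hy))
  have outP : ∀ᶠ t in atTop, (t ^ (-(2 * k.alpha)⁻¹) * ξ, y₀) ∉ P :=
    (tendsto_scaled_point k ξ y₀).eventually (hP.isClosed.isOpen_compl.mem_nhds hent.1)
  filter_upwards [(T.tendsto_scaled hyr ξ).eventually (eventually_orbit_mem hV hbase), hnear, sq,
    outP, eventually_ge_atTop 0] with t h1 h2 h3 h4 h5
  have h3' := openSquare_mono hρr.le h3
  have hS := (T.σ_mem _ h3').1
  refine ⟨h3, ⟨hS, fun h => h4 (T.mem_of_σ_mem_image h3' hPr h)⟩, ?_⟩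
  have hlt : ENNReal.ofReal t < ENNReal.ofReal (t + 1) :=
    (ENNReal.ofReal_lt_ofReal_iff (by linarith)).2 (by linarith)
  refine hlt.trans_le (le_firstHit_of_forall fun s hs hst hhit => ?_)
  have hcoord : ∀ m ∈ S, m ∈ T.U → (T.x m, T.y m) ∈ P → m ∈ σ '' P := fun m a b c =>
    ⟨_, c, T.σ_coord m a b⟩
  rcases le_total t₁ s with h | h
  · have h6 := h2 s ⟨h, hst⟩
    exact hhit.2 (hcoord _ hhit.1 h6.1 (hδP ⟨h6.2.1, h6.2.2⟩))
  · have h6 := T.hmin_le_of_hit hS hs hhit.1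
    rcases h1 s ⟨by linarith, h⟩ with h7 | h7
    · exact h7 hhit.1
    · exact hhit.2 (hcoord _ hhit.1 h7.1 (interior_subset h7.2))

/-- There is an interval of entry points on the positive side of the local stable manifold. -/
theorem exists_entry_interval {ρ ε : ℝ} (hρr : ρ < r) (hερ : ε ≤ ρ)
    (hρK : T.K * ρ ≤ k.b₂ / 2) {P : Set (ℝ × ℝ)} (hP : IsCompact P) (hPε : P ⊆ openSquare ε)
    (h0 : (0, 0) ∈ interior P) (hfin : (frontier P ∩ {p | p.1 = 0}).Finite) :
    ∃ a b, 0 < a ∧ a < b ∧ b ≤ ρ ∧ ∀ y ∈ Set.Ioo a b, IsEntry φ S σ P y := by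
  set Z := {y : ℝ | 0 < y ∧ (0, y) ∉ P} with hZ
  have hε : 0 < ε := by
    have := (hPε (interior_subset h0)).1
    exact (abs_nonneg _).trans_lt this
  have hZne : Z.Nonempty := ⟨ε, hε, fun h => by
    have := (hPε h).2
    simp only [abs_of_pos hε, lt_irrefl] at this⟩
  have hZb : BddBelow Z := ⟨0, fun y hy => hy.1.le⟩
  have axis : Continuous fun y : ℝ => ((0 : ℝ), y) := by fun_prop
  obtain ⟨η, hη, hηP⟩ : ∃ η > 0, ∀ y : ℝ, |y| < η → (0, y) ∈ P := by
    have h1 : ∀ᶠ y : ℝ in 𝓝 0, (0, y) ∈ interior P :=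
      axis.continuousAt.eventually (isOpen_interior.mem_nhds h0)
    obtain ⟨η, hη, h2⟩ := Metric.eventually_nhds_iff.1 h1
    exact ⟨η, hη, fun y hy => interior_subset (h2 (by rwa [Real.dist_eq, sub_zero]))⟩
  set a := sInf Z with ha
  have ha0 : 0 < a := hη.trans_le (le_csInf hZne fun y hy => by
    by_contra! hlt
    exact hy.2 (hηP y (by rwa [abs_of_pos hy.1])))
  have hbelow : ∀ y, 0 < y → y < a → (0, y) ∈ P := fun y h1 h2 => by
    by_contra h3
    exact absurd (csInf_le hZb ⟨h1, h3⟩) (not_le.2 h2)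
  have haP : (0, a) ∈ P := mem_of_forall_lt_mem (c := fun y => (0, y)) axis hP.isClosed
    (half_lt_self ha0) fun s h1 h2 => hbelow s (by linarith) h2
  have haε : a < ε := by
    have := (hPε haP).2
    simpa [abs_of_pos ha0] using this
  have haρ : |a| < ρ := by rw [abs_of_pos ha0]; linarith
  -- points just above `a` come below `a` before they return to the section
  have hdrop : ∀ᶠ y in 𝓝 a, |T.y (φ T.hmin (σ (0, y)))| < a := by
    have h1 := T.base_abs_lt hρr hρK haρ ha0.ne' le_rfl T.hmin_pos
    have har := mem_openSquare_axis (haρ.trans hρr)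
    rw [φ.map_zero_apply, (T.σ_mem _ har).2.2.2, abs_of_pos ha0] at h1
    have c1 : ContinuousAt (fun y => σ (0, y)) a := ContinuousAt.comp (g := σ)
      (T.continuousOn_σ.continuousAt ((isOpen_openSquare r).mem_nhds har)) axis.continuousAt
    have c2 : ContinuousAt (fun y => φ T.hmin (σ (0, y))) a :=
      ContinuousAt.comp (g := fun q => φ T.hmin q)
        (φ.continuous continuous_const continuous_id).continuousAt c1
    have c3 : ContinuousAt (fun y => T.y (φ T.hmin (σ (0, y)))) a := ContinuousAt.comp (g := T.y)
      (T.continuousOn_y.continuousAt (T.isOpen_U.mem_nhds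
        (T.base_mem hρr hρK haρ T.hmin_pos.le).1.1)) c2
    exact c3.abs.eventually_lt_const h1
  have hfr : ∀ᶠ y in 𝓝[>] a, (0, y) ∉ frontier P := by
    have hf : {y : ℝ | (0, y) ∈ frontier P}.Finite := by
      refine (hfin.image Prod.snd).subset fun y hy => ⟨(0, y), ⟨hy, rfl⟩, rfl⟩
    have h1 : ∀ᶠ y in 𝓝[≠] a, y ∉ {y : ℝ | (0, y) ∈ frontier P} := by
      have := (hf.subset Set.sdiff_subset : ({y : ℝ | (0, y) ∈ frontier P} \ {a}).Finite)
      filter_upwards [mem_nhdsWithin_of_mem_nhds (this.isClosed.isOpen_compl.mem_nhds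
        (by simp : a ∈ ({y : ℝ | (0, y) ∈ frontier P} \ {a})ᶜ)), self_mem_nhdsWithin] with y h1 h2 h3
      exact h1 ⟨h3, h2⟩
    exact h1.filter_mono (nhdsWithin_mono _ fun y hy => ne_of_gt hy)
  obtain ⟨b, hab, hb⟩ := mem_nhdsGT_iff_exists_Ioo_subset.1
    ((hfr.and (nhdsWithin_le_nhds hdrop)).and
      (nhdsWithin_le_nhds (gt_mem_nhds (show a < ρ by linarith))))
  obtain ⟨z, hzZ, hzb⟩ := exists_lt_of_csInf_lt hZne hab
  have hza : a < z := lt_of_le_of_ne (csInf_le hZb hzZ) fun h => hzZ.2 (h ▸ haP)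
  refine ⟨a, min b ρ, ha0, lt_min hab (by linarith), min_le_right _ _, fun y hy => ?_⟩
  have hya : 0 < y := ha0.trans hy.1
  have hyb : y < b := hy.2.trans_le (min_le_left _ _)
  have hyρ : |y| < ρ := by rw [abs_of_pos hya]; exact hy.2.trans_le (min_le_right _ _)
  refine ⟨fun hyP => ?_, fun s hs hhit => ?_⟩
  · have hpre : IsPreconnected ((fun y : ℝ => ((0 : ℝ), y)) '' Set.Ioo a b) :=
      isPreconnected_Ioo.image _ axis.continuousOn
    have hout : ∀ u ∈ Set.Ioo a b, (0, u) ∈ P → (0, u) ∈ interior P := fun u hu h1 => by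
      by_contra h2
      exact (hb hu).1.1 ⟨subset_closure h1, h2⟩
    obtain ⟨_, ⟨u, hu, rfl⟩, hf1, hf2⟩ := hpre (interior P) Pᶜ isOpen_interior
      hP.isClosed.isOpen_compl
      (by
        rintro _ ⟨u, hu, rfl⟩
        by_cases h : (0, u) ∈ P
        exacts [Or.inl (hout u hu h), Or.inr h])
      ⟨(0, y), ⟨y, ⟨hy.1, hyb⟩, rfl⟩, hout y ⟨hy.1, hyb⟩ hyP⟩ ⟨(0, z), ⟨z, ⟨hza, hzb⟩, rfl⟩, hzZ.2⟩
    exact hf2 (interior_subset hf1)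
  · obtain ⟨hm, hx⟩ := T.base_mem hρr hρK hyρ hs.le
    have hyr := mem_openSquare_axis (hyρ.trans hρr)
    have h1 := T.hmin_le_of_hit (T.σ_mem _ hyr).1 hs hhit.1
    have h2 : |T.y (φ s (σ (0, y)))| < a := by
      refine lt_of_le_of_lt ?_ (hb ⟨hy.1, hyb⟩).1.2
      rcases h1.eq_or_lt with h | h
      · rw [h]
      · exact (T.base_abs_lt hρr hρK hyρ hya.ne' T.hmin_pos.le h).le
    have h3 : 0 < T.y (φ s (σ (0, y))) := by
      rw [T.base_y_eq hρr hρK hyρ hs.le]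
      positivity
    rw [abs_of_pos h3] at h2
    refine hhit.2 ⟨_, ?_, T.σ_coord _ hhit.1 hm.1⟩
    rw [hx]
    exact hbelow _ h3 h2

end

end SaddleTube

namespace SaddleTube

noncomputable section

variable {k : SaddleCoeffs} {M : Type*} [TopologicalSpace M] {φ : Flow ℝ M} {S : Set M}
  {σ : ℝ × ℝ → M} {r : ℝ} (T : SaddleTube k φ S σ r)

/-- The radius `ρ` is so small that the passage estimates hold in the tube of radius `ρ`, and orbits
starting in the tube of radius `ε` stay in the tube of radius `ρ` for one return time. -/
structure IsAdmissible (ρ ε : ℝ) : Prop where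
  pos : 0 < ε
  le : ε ≤ ρ
  lt : ρ < r
  small : T.K * ρ ≤ k.b₂ / 2
  stay : ∀ q ∈ T.tube ε, ∀ t, |t| ≤ T.gap → φ t q ∈ T.tube ρ
  threshold : ∀ (e : ℤˣ) (y₀ : ℝ), y₀ ≠ 0 → |y₀| < ρ →
    ∃ c, 0 < c ∧ ∀ ξ, 0 < (e : ℤ) * (ξ * y₀) →
    (c < |ξ| → ∀ᶠ t in atTop, ¬ ∀ s ∈ Set.Icc 0 t, φ s (scaled k σ ξ y₀ t) ∈ T.tube ρ) ∧
    (|ξ| < c → ∀ δ, 0 < δ → ∃ t₁, 0 ≤ t₁ ∧ ∀ᶠ t in atTop, ∀ s ∈ Set.Icc t₁ (t + 1),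
      φ s (scaled k σ ξ y₀ t) ∈ T.tube δ)
  bound : ∃ D, 0 < D ∧ ∀ (q : M) (t : ℝ), 0 ≤ t →
    (∀ s ∈ Set.Icc 0 t, φ s q ∈ T.tube ρ) → T.x q ≠ 0 → T.y q ≠ 0 →
    (|T.y q| ≤ |T.x q| → t * |T.x q| ^ 2 ≤ D) ∧
    (|T.x q| ≤ |T.y q| → t * |T.y q| ^ 2 * (|T.x q| / |T.y q|) ^ (2 * k.alpha) ≤ D)

theorem exists_isAdmissible : ∃ ρ ε, T.IsAdmissible ρ ε := by
  obtain ⟨ρ₁, h1, hth1⟩ := T.exists_threshold 1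
  obtain ⟨ρ₂, h2, hth2⟩ := T.exists_threshold (-1)
  obtain ⟨ρ₃, D, h3, hD, hbd⟩ := T.exists_uniform_bound
  have hr := T.r_pos
  have hK := T.K_nonneg
  have hb := k.b₂_pos
  set ρ := min (min ρ₁ ρ₂) (min ρ₃ (min (r / 2) (k.b₂ / 2 / (T.K + 1)))) with hρ
  have hρ0 : 0 < ρ := by simp only [hρ, lt_min_iff]; refine ⟨⟨h1, h2⟩, h3, ?_, ?_⟩ <;> positivity
  have l1 : ρ ≤ ρ₁ := (min_le_left _ _).trans (min_le_left _ _)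
  have l2 : ρ ≤ ρ₂ := (min_le_left _ _).trans (min_le_right _ _)
  have l3 : ρ ≤ ρ₃ := (min_le_right _ _).trans (min_le_left _ _)
  have l4 : ρ ≤ r / 2 := (min_le_right _ _).trans ((min_le_right _ _).trans (min_le_left _ _))
  have l5 : ρ ≤ k.b₂ / 2 / (T.K + 1) :=
    (min_le_right _ _).trans ((min_le_right _ _).trans (min_le_right _ _))
  have hlt : ρ < r := by linarith
  have hsm : T.K * ρ ≤ k.b₂ / 2 := by
    rw [le_div_iff₀ (by positivity)] at l5
    nlinarith
  obtain ⟨ε, hε, hερ, hstay⟩ := T.exists_stay T.gap ρ hρ0 hlt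
  refine ⟨ρ, ε, hε, hερ, hlt, hsm, hstay, fun e y₀ hy0 hy => ?_, D, hD, fun q t ht hin => ?_⟩
  · rcases Int.units_eq_one_or e with rfl | rfl
    · exact hth1 ρ hρ0 l1 hlt hsm y₀ hy0 hy
    · exact hth2 ρ hρ0 l2 hlt hsm y₀ hy0 hy
  · exact hbd q t ht fun s hs => T.tube_mono l3 (hin s hs)

variable {T} {ρ ε : ℝ} {P : Set (ℝ × ℝ)}

theorem exists_openSquare_subset (h0 : (0, 0) ∈ interior P) : ∃ δ, 0 < δ ∧ openSquare δ ⊆ P := by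
  obtain ⟨δ, hδ, h⟩ := Metric.mem_nhds_iff.1 (isOpen_interior.mem_nhds h0)
  refine ⟨δ, hδ, fun p hp => interior_subset (h ?_)⟩
  rw [Metric.mem_ball, Prod.dist_eq, max_lt_iff, Real.dist_eq, Real.dist_eq]
  simpa [openSquare] using hp

theorem IsAdmissible.stays (hA : T.IsAdmissible ρ ε) (hP : P ⊆ openSquare ε) {q : M} {t : ℝ}
    (hq : q ∈ S) (ht : T.gap ≤ t) (hslow : ENNReal.ofReal t < firstHit φ (S \ σ '' P) q) :
    ∀ s ∈ Set.Icc 0 t, φ s q ∈ T.tube ρ :=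
  T.stays_of_no_hit (hA.le.trans hA.lt.le) hA.stay hP hq ht
    fun _ hs hst => not_mem_of_lt_firstHit hslow hs hst

/-- On the side `e ξ y₀ > 0` of an entry point, scaled points are slow up to a sharp threshold. -/
theorem IsAdmissible.exists_side_threshold (hA : T.IsAdmissible ρ ε) (hP : IsCompact P)
    (hPε : P ⊆ openSquare ε) (h0 : (0, 0) ∈ interior P) {y₀ : ℝ} (hy0 : y₀ ≠ 0) (hy : |y₀| < ρ)
    (hexc : ¬ IsExceptional φ σ P y₀) (hent : IsEntry φ S σ P y₀) (e : ℤˣ) :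
    ∃ c, 0 < c ∧ ∀ ξ, 0 < (e : ℤ) * (ξ * y₀) →
      (c < |ξ| → ∀ᶠ t in atTop, (t ^ (-(2 * k.alpha)⁻¹) * ξ, y₀) ∉ slowSet φ S σ P ρ t) ∧
      (|ξ| < c → ∀ᶠ t in atTop, (t ^ (-(2 * k.alpha)⁻¹) * ξ, y₀) ∈ slowSet φ S σ P ρ t) := by
  obtain ⟨c, hc, hth⟩ := hA.threshold e y₀ hy0 hy
  obtain ⟨δ, hδ, hδP⟩ := exists_openSquare_subset h0
  have hPr := hPε.trans (openSquare_mono (hA.le.trans hA.lt.le))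
  refine ⟨c, hc, fun ξ hξ => ⟨fun h => ?_, fun h => ?_⟩⟩
  · filter_upwards [(hth ξ hξ).1 h, eventually_ge_atTop T.gap] with t h1 h2 hslow
    exact h1 (hA.stays hPε hslow.2.1.1 h2 hslow.2.2)
  · obtain ⟨t₁, -, hnear⟩ := (hth ξ hξ).2 h δ hδ
    exact T.eventually_slow hA.lt hA.small hP hPr hy hexc hent ξ hδP hnear

/-- Apart from exceptional heights, the scaled slow sets converge to intervals. -/
theorem IsAdmissible.exists_slow_interval [T2Space M] (hA : T.IsAdmissible ρ ε) (hP : IsCompact P)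
    (hPε : P ⊆ openSquare ε) (h0 : (0, 0) ∈ interior P) {y₀ : ℝ} (hy0 : y₀ ≠ 0) (hy : |y₀| < ρ)
    (hexc : ¬ IsExceptional φ σ P y₀) :
    ∃ c₁ c₂ : ℝ, 0 ≤ c₁ ∧ 0 ≤ c₂ ∧ (IsEntry φ S σ P y₀ → 0 < c₁) ∧
      ∀ ξ, ξ ≠ 0 → ξ ≠ c₁ → ξ ≠ -c₂ → ∀ᶠ t in atTop,
        ((t ^ (-(2 * k.alpha)⁻¹) * ξ, y₀) ∈ slowSet φ S σ P ρ t ↔ ξ ∈ Set.Ioo (-c₂) c₁) := by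
  by_cases hent : IsEntry φ S σ P y₀
  · obtain ⟨e, he⟩ : ∃ e : ℤˣ, 0 < ((e : ℤ) : ℝ) * y₀ := by
      rcases lt_or_gt_of_ne hy0 with h | h
      · exact ⟨-1, by simpa using h⟩
      · exact ⟨1, by simpa using h⟩
    obtain ⟨c₁, hc₁, h1⟩ := hA.exists_side_threshold hP hPε h0 hy0 hy hexc hent e
    obtain ⟨c₂, hc₂, h2⟩ := hA.exists_side_threshold hP hPε h0 hy0 hy hexc hent (-e)
    refine ⟨c₁, c₂, hc₁.le, hc₂.le, fun _ => hc₁, fun ξ hξ hξ1 hξ2 => ?_⟩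
    rcases lt_or_gt_of_ne hξ with h | h
    · have h3 := h2 ξ (by push_cast; nlinarith)
      rw [abs_of_neg h] at h3
      rcases lt_or_gt_of_ne hξ2 with h4 | h4
      · filter_upwards [h3.1 (by linarith)] with t ht
        exact iff_of_false ht fun h5 => by linarith [h5.1]
      · filter_upwards [h3.2 (by linarith)] with t ht
        exact iff_of_true ht ⟨h4, by linarith⟩
    · have h3 := h1 ξ (by nlinarith)
      rw [abs_of_pos h] at h3
      rcases lt_or_gt_of_ne hξ1 with h4 | h4
      · filter_upwards [h3.2 h4] with t ht
        exact iff_of_true ht ⟨by linarith, h4⟩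
      · filter_upwards [h3.1 h4] with t ht
        exact iff_of_false ht fun h5 => by linarith [h5.2]
  · refine ⟨0, 0, le_rfl, le_rfl, fun h => absurd h hent, fun ξ _ _ _ => ?_⟩
    filter_upwards [T.eventually_not_slow hA.lt hA.small hP
      (hPε.trans (openSquare_mono (hA.le.trans hA.lt.le))) hy hexc hent ξ] with t ht
    exact iff_of_false ht (by simp)

/-- Off the coordinate axes, slow points are close to the local stable manifold. -/
theorem IsAdmissible.exists_slow_bound (hA : T.IsAdmissible ρ ε) (hPε : P ⊆ openSquare ε)
    (h0 : (0, 0) ∈ interior P) :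
    ∃ C, 0 < C ∧ ∀ᶠ t in atTop, ∀ p ∈ slowSet φ S σ P ρ t, p.1 ≠ 0 → p.2 ≠ 0 →
      |p.1| ≤ t ^ (-(2 * k.alpha)⁻¹) * C := by
  obtain ⟨D, hD, hbd⟩ := hA.bound
  obtain ⟨δ, hδ, hδP⟩ := exists_openSquare_subset h0
  have ha := k.alpha_pos
  have hρ : 0 < ρ := hA.pos.trans_le hA.le
  set β := (2 * k.alpha)⁻¹ with hβ
  have hβ0 : 0 < β := by positivity
  refine ⟨ρ * (D / δ ^ 2) ^ β, by positivity, ?_⟩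
  filter_upwards [eventually_ge_atTop T.gap, eventually_gt_atTop (D / δ ^ 2),
    eventually_gt_atTop 0] with t ht ht2 ht0 p hp hp1 hp2
  have hpr := openSquare_mono hA.lt.le hp.1
  obtain ⟨hS, -, hx, hy⟩ := T.σ_mem p hpr
  have h1 := hbd (σ p) t ht0.le (hA.stays hPε hS ht hp.2.2) (by rwa [hx]) (by rwa [hy])
  rw [hx, hy] at h1
  rw [div_lt_iff₀ (by positivity)] at ht2
  have hout : δ ≤ |p.1| ∨ δ ≤ |p.2| := by
    by_contra! hcon
    exact hp.2.1.2 ⟨p, hδP hcon, rfl⟩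
  have hx0 := abs_pos.2 hp1
  have hy0 := abs_pos.2 hp2
  rcases le_total |p.2| |p.1| with h | h
  · have h2 := h1.1 h
    have h3 : δ ≤ |p.1| := hout.elim id (fun h3 => h3.trans h)
    have h4 : δ ^ 2 ≤ |p.1| ^ 2 := by gcongr
    nlinarith
  · have h2 := h1.2 h
    have h3 : δ ≤ |p.2| := hout.elim (fun h3 => h3.trans h) id
    set u := |p.1| / |p.2| with hu
    have hu0 : 0 < u := by positivity
    have h4 : u ^ (2 * k.alpha) ≤ D / δ ^ 2 * t⁻¹ := by
      rw [← div_eq_mul_inv, le_div_iff₀ ht0, le_div_iff₀ (by positivity)]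
      have : t * δ ^ 2 * u ^ (2 * k.alpha) ≤ t * |p.2| ^ 2 * u ^ (2 * k.alpha) := by gcongr
      linarith
    have h5 : u ≤ (D / δ ^ 2) ^ β * t ^ (-β) := by
      have h6 := Real.rpow_le_rpow (by positivity) h4 hβ0.le
      rw [← Real.rpow_mul hu0.le, hβ, mul_inv_cancel₀ (by positivity), Real.rpow_one,
        Real.mul_rpow (by positivity) (by positivity)] at h6
      rwa [Real.rpow_neg ht0.le, ← Real.inv_rpow ht0.le]
    calc |p.1| = u * |p.2| := by rw [hu]; field_simp
      _ ≤ (D / δ ^ 2) ^ β * t ^ (-β) * ρ := by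
        gcongr
        exact hp.1.2.le
      _ = _ := by ring

end

end SaddleTube

section Scaling

theorem lintegral_eq_mul_comp_mul_left {a : ℝ} (ha : 0 < a) {f : ℝ → ℝ≥0∞} (hf : Measurable f) :
    ∫⁻ x, f x = ENNReal.ofReal a * ∫⁻ x, f (a * x) := by
  have h1 : ∫⁻ x, f (a * x) = ∫⁻ x, f x ∂(Measure.map (a * ·) volume) :=
    (lintegral_map hf (measurable_const_mul a)).symm
  rw [h1, Real.map_volume_mul_left ha.ne', lintegral_smul_measure, smul_eq_mul, ← mul_assoc,
    ← ENNReal.ofReal_mul ha.le, abs_of_pos (inv_pos.2 ha), mul_inv_cancel₀ ha.ne',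
    ENNReal.ofReal_one, one_mul]

/-- Let planar sets `B t` concentrate on the vertical axis, and suppose that their horizontal slices,
rescaled by `t ^ β`, converge to the intervals `(-c₂ y, c₁ y)`.  Then the mass of `B t` with respect to
a positive continuous density is asymptotic to a multiple of `t ^ (-β)`. -/
theorem exists_tendsto_rpow_mul_lintegral {β ρ r : ℝ} (hρr : ρ < r)
    {w : ℝ × ℝ → ℝ} (hw : ContinuousOn w (openSquare r)) (hwpos : ∀ p ∈ openSquare r, 0 < w p)
    {B : ℝ → Set (ℝ × ℝ)} (hB : ∀ᶠ t in atTop, MeasurableSet (B t))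
    (hBρ : ∀ t, B t ⊆ openSquare ρ) {C₀ : ℝ}
    (hC₀ : ∀ᶠ t in atTop, ∀ p ∈ B t, p.1 ≠ 0 → p.2 ≠ 0 → |p.1| ≤ t ^ (-β) * C₀)
    {E : Set ℝ} (hE : volume E = 0) {c₁ c₂ : ℝ → ℝ}
    (hc : ∀ y, |y| < ρ → y ≠ 0 → y ∉ E → 0 ≤ c₁ y ∧ 0 ≤ c₂ y ∧ ∀ ξ, ξ ≠ 0 → ξ ≠ c₁ y → ξ ≠ -c₂ y →
      ∀ᶠ t in atTop, ((t ^ (-β) * ξ, y) ∈ B t ↔ ξ ∈ Set.Ioo (-c₂ y) (c₁ y)))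
    (hβ : 0 < β) {a b : ℝ} (ha : 0 < a) (hab : a < b) (hbρ : b ≤ ρ)
    (hpos : ∀ y ∈ Set.Ioo a b, y ∉ E → 0 < c₁ y) :
    ∃ C, 0 < C ∧ Tendsto (fun t : ℝ => t ^ β * (∫⁻ p in B t, ENNReal.ofReal (w p)).toReal) atTop
      (𝓝 C) := by
  obtain ⟨W, hW⟩ : ∃ W, ∀ p ∈ openSquare ρ, w p ≤ W := by
    have hcpt : IsCompact (Set.Icc (-ρ) ρ ×ˢ Set.Icc (-ρ) ρ) := isCompact_Icc.prod isCompact_Icc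
    obtain ⟨W, hW⟩ := hcpt.bddAbove_image (f := w) (hw.mono fun p hp => by
      exact ⟨(abs_le.2 hp.1).trans_lt hρr, (abs_le.2 hp.2).trans_lt hρr⟩)
    exact ⟨W, fun p hp => hW ⟨p, ⟨abs_le.1 hp.1.le, abs_le.1 hp.2.le⟩, rfl⟩⟩
  set g : ℝ × ℝ → ℝ≥0∞ := (openSquare ρ).indicator fun p => ENNReal.ofReal (w p) with hg
  have hsub : openSquare ρ ⊆ openSquare r := openSquare_mono hρr.le
  have hgm : Measurable g := by
    refine measurable_of_restrict_of_restrict_compl (isOpen_openSquare ρ).measurableSet ?_ ?_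
    · have h1 : (openSquare ρ).domRestrict g = fun p => ENNReal.ofReal ((openSquare ρ).domRestrict w p) :=
        funext fun p => by simp [hg]
      rw [h1]
      exact ENNReal.measurable_ofReal.comp (hw.mono hsub).domRestrict.measurable
    · have h1 : (openSquare ρ)ᶜ.domRestrict g = fun _ => 0 :=
        funext fun p => by
          rw [Set.domRestrict_apply, hg, Set.indicator_of_notMem p.2]
      rw [h1]
      exact measurable_const
  set G : ℝ → ℝ → ℝ → ℝ≥0∞ := fun t y ξ => (B t).indicator g (t ^ (-β) * ξ, y) with hG
  set J : ℝ → ℝ → ℝ≥0∞ := fun t y => ∫⁻ ξ, G t y ξ with hJ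
  set j : ℝ → ℝ≥0∞ := fun y => if |y| < ρ then
    ENNReal.ofReal (w (0, y)) * ENNReal.ofReal (c₁ y + c₂ y) else 0 with hj
  set bd : ℝ → ℝ≥0∞ := (Set.Icc (-ρ) ρ).indicator fun _ =>
    ENNReal.ofReal W * ENNReal.ofReal (2 * C₀) with hbd
  have hbdfin : ∫⁻ y, bd y ≠ ⊤ := by
    rw [hbd, lintegral_indicator measurableSet_Icc, setLIntegral_const]
    exact ENNReal.mul_ne_top (ENNReal.mul_ne_top ENNReal.ofReal_ne_top ENNReal.ofReal_ne_top)
      (by simp)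
  have hind : ∀ t, MeasurableSet (B t) → Measurable ((B t).indicator g) := fun t ht =>
    hgm.indicator ht
  have hGm : ∀ t, MeasurableSet (B t) → Measurable fun p : ℝ × ℝ => G t p.1 p.2 := fun t ht =>
    (hind t ht).comp ((measurable_snd.const_mul _).prodMk measurable_fst)
  have hout : ∀ t y ξ, ρ ≤ |y| → G t y ξ = 0 := fun t y ξ hy =>
    Set.indicator_of_notMem (fun h => absurd (hBρ t h).2 (not_lt.2 hy)) _
  have hJ0 : ∀ t y, ρ ≤ |y| → J t y = 0 := fun t y hy => by simp [hJ, hout t y _ hy]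
  have hGle : ∀ t, 0 < t → (∀ p ∈ B t, p.1 ≠ 0 → p.2 ≠ 0 → |p.1| ≤ t ^ (-β) * C₀) →
      ∀ y ξ, y ≠ 0 → ξ ≠ 0 →
      G t y ξ ≤ (Set.Icc (-C₀) C₀).indicator (fun _ => ENNReal.ofReal W) ξ := by
    intro t ht hb y ξ hy hξ
    by_cases hm : (t ^ (-β) * ξ, y) ∈ B t
    · have hp : 0 < t ^ (-β) := Real.rpow_pos_of_pos ht _
      have h1 := hb _ hm (mul_ne_zero hp.ne' hξ) hy
      simp only [abs_mul, abs_of_pos hp] at h1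
      rw [Set.indicator_of_mem (Set.mem_Icc.2 (abs_le.1 (le_of_mul_le_mul_left h1 hp))), hG]
      simp only
      rw [Set.indicator_of_mem hm, hg, Set.indicator_of_mem (hBρ t hm)]
      exact ENNReal.ofReal_le_ofReal (hW _ (hBρ t hm))
    · rw [hG]
      simp only
      rw [Set.indicator_of_notMem hm]
      exact zero_le
  have hne : ∀ z : ℝ, ∀ᵐ y : ℝ, y ≠ z := fun z => by
    simp [ae_iff]
  have hslab : ∫⁻ ξ, (Set.Icc (-C₀) C₀).indicator (fun _ => ENNReal.ofReal W) ξ =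
      ENNReal.ofReal W * ENNReal.ofReal (2 * C₀) := by
    rw [lintegral_indicator measurableSet_Icc, setLIntegral_const, Real.volume_Icc]
    ring_nf
  have hJle : ∀ t, 0 < t → (∀ p ∈ B t, p.1 ≠ 0 → p.2 ≠ 0 → |p.1| ≤ t ^ (-β) * C₀) →
      ∀ y, y ≠ 0 → J t y ≤ bd y := by
    intro t ht hb y hy
    by_cases hyρ : |y| ≤ ρ
    · rw [hbd, Set.indicator_of_mem (Set.mem_Icc.2 (abs_le.1 hyρ)), ← hslab]
      refine lintegral_mono_ae ?_
      filter_upwards [hne 0] with ξ hξ using hGle t ht hb y ξ hy hξ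
    · rw [hJ0 t y (not_le.1 hyρ).le]
      exact zero_le
  have hJlim : ∀ y, y ≠ 0 → y ∉ E → Tendsto (fun t => J t y) atTop (𝓝 (j y)) := by
    intro y hy hyE
    by_cases hyρ : |y| < ρ
    · obtain ⟨p1, p2, hiff⟩ := hc y hyρ hy hyE
      have hlim : ∫⁻ ξ, (Set.Ioo (-c₂ y) (c₁ y)).indicator
          (fun _ => ENNReal.ofReal (w (0, y))) ξ = j y := by
        rw [lintegral_indicator measurableSet_Ioo, setLIntegral_const, Real.volume_Ioo, hj]
        simp only [if_pos hyρ, sub_neg_eq_add]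
      rw [← hlim]
      refine tendsto_lintegral_filter_of_dominated_convergence
        ((Set.Icc (-C₀) C₀).indicator fun _ => ENNReal.ofReal W) ?_ ?_ ?_ ?_
      · filter_upwards [hB] with t ht using (hGm t ht).comp measurable_prodMk_left
      · filter_upwards [hC₀, eventually_gt_atTop 0] with t hb ht
        filter_upwards [hne 0] with ξ hξ using hGle t ht hb y ξ hy hξ
      · rw [hslab]
        exact ENNReal.mul_ne_top ENNReal.ofReal_ne_top ENNReal.ofReal_ne_top
      · filter_upwards [hne 0, hne (c₁ y), hne (-c₂ y)] with ξ h1 h2 h3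
        have hsc : Tendsto (fun t : ℝ => (t ^ (-β) * ξ, y)) atTop (𝓝 (0, y)) := by
          have := (tendsto_rpow_neg_atTop hβ).mul_const ξ
          rw [zero_mul] at this
          exact this.prodMk_nhds tendsto_const_nhds
        have h0r : ((0 : ℝ), y) ∈ openSquare r :=
          ⟨by simpa using (abs_nonneg y).trans_lt (hyρ.trans hρr), hyρ.trans hρr⟩
        by_cases hξ : ξ ∈ Set.Ioo (-c₂ y) (c₁ y)
        · rw [Set.indicator_of_mem hξ]
          have h4 : Tendsto (fun t : ℝ => ENNReal.ofReal (w (t ^ (-β) * ξ, y))) atTop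
              (𝓝 (ENNReal.ofReal (w (0, y)))) :=
            ENNReal.tendsto_ofReal ((hw.continuousAt
              ((isOpen_openSquare r).mem_nhds h0r)).tendsto.comp hsc)
          refine h4.congr' ?_
          filter_upwards [hiff ξ h1 h2 h3] with t ht
          have hm := ht.2 hξ
          rw [hG]
          simp only
          rw [Set.indicator_of_mem hm, hg, Set.indicator_of_mem (hBρ t hm)]
        · rw [Set.indicator_of_notMem hξ]
          refine tendsto_const_nhds.congr' ?_
          filter_upwards [hiff ξ h1 h2 h3] with t ht
          exact (Set.indicator_of_notMem (fun hm => hξ (ht.1 hm)) _).symm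
    · have h1 : j y = 0 := if_neg hyρ
      simp only [h1, hJ0 _ y (not_lt.1 hyρ)]
      exact tendsto_const_nhds
  have hJm : ∀ t, MeasurableSet (B t) → Measurable (J t) := fun t ht =>
    (hGm t ht).lintegral_prod_right'
  have hEae : ∀ᵐ y : ℝ, y ∉ E := measure_eq_zero_iff_ae_notMem.1 hE
  have hae : ∀ᵐ y : ℝ, Tendsto (fun t => J t y) atTop (𝓝 (j y)) := by
    filter_upwards [hne 0, hEae] with y h1 h2 using hJlim y h1 h2
  have hlim : Tendsto (fun t => ∫⁻ y, J t y) atTop (𝓝 (∫⁻ y, j y)) := by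
    refine tendsto_lintegral_filter_of_dominated_convergence bd ?_ ?_ hbdfin hae
    · filter_upwards [hB] with t ht using hJm t ht
    · filter_upwards [hC₀, eventually_gt_atTop 0] with t hb ht
      filter_upwards [hne 0] with y hy using hJle t ht hb y hy
  have hfin : ∫⁻ y, j y ≠ ⊤ := by
    refine ne_top_of_le_ne_top hbdfin (lintegral_mono_ae ?_)
    filter_upwards [hae, hne 0] with y h1 hy
    refine le_of_tendsto h1 ?_
    filter_upwards [hC₀, eventually_gt_atTop 0] with t hb ht using hJle t ht hb y hy
  have hjm : AEMeasurable j := by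
    obtain ⟨N, hN⟩ := eventually_atTop.1 hB
    refine aemeasurable_of_tendsto_metrizable_ae (atTop : Filter ℕ)
      (f := fun n : ℕ => J (N + n)) (fun n => (hJm _ (hN _ (by simp))).aemeasurable) ?_
    filter_upwards [hae] with y hy
    exact hy.comp (tendsto_atTop_add_const_left _ N tendsto_natCast_atTop_atTop)
  have hne0 : ∫⁻ y, j y ≠ 0 := by
    intro h
    have h1 := (lintegral_eq_zero_iff' hjm).1 h
    have h2 : ∀ᵐ y : ℝ, y ∉ Set.Ioo a b := by
      filter_upwards [h1, hEae] with y hy1 hyE hy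
      have hy0 : 0 < y := ha.trans hy.1
      have hyρ : |y| < ρ := by rw [abs_of_pos hy0]; exact hy.2.trans_le hbρ
      have h0r : ((0 : ℝ), y) ∈ openSquare r :=
        ⟨by simpa using (abs_nonneg y).trans_lt (hyρ.trans hρr), hyρ.trans hρr⟩
      have hp := hpos y hy hyE
      have hc2 := (hc y hyρ hy0.ne' hyE).2.1
      simp only [hj, if_pos hyρ, Pi.zero_apply, mul_eq_zero, ENNReal.ofReal_eq_zero] at hy1
      rcases hy1 with h3 | h3
      · linarith [hwpos _ h0r]
      · linarith
    have h3 := measure_eq_zero_iff_ae_notMem.2 h2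
    rw [Real.volume_Ioo, ENNReal.ofReal_eq_zero] at h3
    linarith
  refine ⟨(∫⁻ y, j y).toReal, ENNReal.toReal_pos hne0 hfin,
    ((ENNReal.tendsto_toReal hfin).comp hlim).congr' ?_⟩
  filter_upwards [hB, eventually_gt_atTop 0] with t ht ht0
  have e1 : ∫⁻ p in B t, ENNReal.ofReal (w p) = ∫⁻ p, (B t).indicator g p := by
    rw [lintegral_indicator ht]
    refine setLIntegral_congr_fun ht fun p hp => ?_
    rw [hg, Set.indicator_of_mem (hBρ t hp)]
  have e2 : ∫⁻ p, (B t).indicator g p = ENNReal.ofReal (t ^ (-β)) * ∫⁻ y, J t y := by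
    rw [Measure.volume_eq_prod, lintegral_prod_symm _ (hind t ht).aemeasurable,
      ← lintegral_const_mul _ (hJm t ht)]
    refine lintegral_congr fun y => ?_
    exact lintegral_eq_mul_comp_mul_left (Real.rpow_pos_of_pos ht0 _)
      ((hind t ht).comp measurable_prodMk_right)
  have hp := Real.rpow_pos_of_pos ht0 (-β)
  rw [e1, e2, ENNReal.toReal_mul, ENNReal.toReal_ofReal hp.le, ← mul_assoc, ← Real.rpow_add ht0,
    add_neg_cancel, Real.rpow_zero, one_mul]
  rfl

end Scaling

section Measurability

variable {M : Type*} [TopologicalSpace M] {φ : Flow ℝ M}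

theorem isClosed_setOf_exists_hit {C : Set M} (hC : IsClosed C) (a b : ℝ) :
    IsClosed {q | ∃ s ∈ Set.Icc a b, φ s q ∈ C} := by
  have h1 : {q | ∃ s ∈ Set.Icc a b, φ s q ∈ C} =
      Prod.snd '' {p : Set.Icc a b × M | φ p.1 p.2 ∈ C} := by
    ext q
    constructor
    · rintro ⟨s, hs, h⟩
      exact ⟨(⟨s, hs⟩, q), h, rfl⟩
    · rintro ⟨⟨s, q'⟩, h, rfl⟩
      exact ⟨s, s.2, h⟩
  rw [h1]
  exact isClosedMap_snd_of_compactSpace _ (hC.preimage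
    (φ.continuous (continuous_subtype_val.comp continuous_fst) continuous_snd))

/-- The first hitting time of an `Fσ` set is Borel measurable on every superlevel set. -/
theorem measurableSet_lt_firstHit [MeasurableSpace M] [BorelSpace M] {A : Set M} {F : ℕ → Set M}
    (hF : ∀ n, IsClosed (F n)) (hA : A = ⋃ n, F n) {t : ℝ} (ht : 0 ≤ t) :
    MeasurableSet {q | ENNReal.ofReal t < firstHit φ A q} := by
  have h1 : {q | ENNReal.ofReal t < firstHit φ A q} =
      ⋃ m : ℕ, (⋃ n : ℕ, ⋃ i : ℕ, {q | ∃ s ∈ Set.Icc (1 / (i + 1 : ℝ)) (t + 1 / (m + 1 : ℝ)),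
        φ s q ∈ F n})ᶜ := by
    ext q
    simp only [Set.mem_iUnion, Set.mem_compl_iff, Set.mem_ofPred_eq, not_exists]
    constructor
    · intro h
      obtain ⟨c, hc0, hc1, hc2⟩ := ENNReal.lt_iff_exists_real_btwn.1 h
      have hct : t < c := (ENNReal.ofReal_lt_ofReal_iff_of_nonneg ht).1 hc1
      obtain ⟨m, hm⟩ := exists_nat_one_div_lt (sub_pos.2 hct)
      refine ⟨m, fun n i s => ?_⟩
      rintro ⟨⟨hs1, hs2⟩, hs3⟩
      have hi : (0 : ℝ) < 1 / (i + 1) := by positivity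
      refine not_mem_of_lt_firstHit hc2 (hi.trans_le hs1) (by linarith) ?_
      rw [hA]
      exact Set.mem_iUnion.2 ⟨n, hs3⟩
    · rintro ⟨m, hm⟩
      have h0 : (0 : ℝ) < 1 / (m + 1) := by positivity
      refine ((ENNReal.ofReal_lt_ofReal_iff (by linarith)).2 (by linarith :
        t < t + 1 / (m + 1))).trans_le (le_firstHit_of_forall fun s hs hst hhit => ?_)
      rw [hA] at hhit
      obtain ⟨n, hn⟩ := Set.mem_iUnion.1 hhit
      obtain ⟨i, hi⟩ := exists_nat_one_div_lt hs
      exact hm n i s ⟨⟨hi.le, hst⟩, hn⟩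
  rw [h1]
  exact MeasurableSet.iUnion fun m => (MeasurableSet.iUnion fun n => MeasurableSet.iUnion fun i =>
    (isClosed_setOf_exists_hit (hF n) _ _).measurableSet).compl

theorem measurableSet_inter_preimage_of_continuousOn {X Y : Type*} [TopologicalSpace X]
    [MeasurableSpace X] [BorelSpace X] [TopologicalSpace Y] [MeasurableSpace Y] [BorelSpace Y]
    {f : X → Y} {s : Set X} (hs : MeasurableSet s) (hf : ContinuousOn f s) {A : Set Y}
    (hA : MeasurableSet A) : MeasurableSet (s ∩ f ⁻¹' A) := by
  rw [← Subtype.image_preimage_coe]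
  exact hs.subtype_image (hf.domRestrict.measurable hA)

end Measurability

namespace SaddleTube

variable {k : SaddleCoeffs} {M : Type*} [TopologicalSpace M] {φ : Flow ℝ M} {S : Set M}
  {σ : ℝ × ℝ → M} {r : ℝ} {T : SaddleTube k φ S σ r} {ρ ε : ℝ} {P : Set (ℝ × ℝ)}

theorem measurableSet_slowSet [T2Space M] [TopologicalSpace.MetrizableSpace M] [MeasurableSpace M]
    [BorelSpace M] (T : SaddleTube k φ S σ r) (hρr : ρ ≤ r) (hP : IsCompact P)
    (hPr : P ⊆ openSquare r) {t : ℝ} (ht : 0 ≤ t) : MeasurableSet (slowSet φ S σ P ρ t) := by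
  let _ := TopologicalSpace.metrizableSpaceMetric M
  obtain ⟨F, hF, -, hU, -⟩ := (T.isClosed_image hP hPr).isOpen_compl.exists_iUnion_isClosed
  have hA : S \ σ '' P = ⋃ n, S ∩ F n := by
    rw [← Set.inter_iUnion, hU, Set.sdiff_eq]
  have hm := measurableSet_lt_firstHit (φ := φ) (fun n => T.isClosed_S.inter (hF n)) hA ht
  have hY : MeasurableSet (S \ σ '' P) :=
    T.isClosed_S.measurableSet.diff (T.isClosed_image hP hPr).measurableSet
  exact measurableSet_inter_preimage_of_continuousOn (isOpen_openSquare ρ).measurableSet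
    (T.continuousOn_σ.mono (openSquare_mono hρr)) (hY.inter hm)

/-- For large times, all slow points of the section lie in the coordinate square. -/
theorem IsAdmissible.setOf_slow_eq_image (hA : T.IsAdmissible ρ ε) (hPε : P ⊆ openSquare ε) {t : ℝ}
    (ht : T.gap ≤ t) :
    {q ∈ S \ σ '' P | ENNReal.ofReal t < firstHit φ (S \ σ '' P) q} =
      σ '' slowSet φ S σ P ρ t := by
  have hgap : 0 < T.gap := by unfold gap; positivity
  ext q
  constructor
  · rintro ⟨hq, hslow⟩
    have h1 := hA.stays hPε hq.1 ht hslow 0 ⟨le_rfl, (hgap.trans_le ht).le⟩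
    rw [φ.map_zero_apply] at h1
    have h2 := T.σ_coord q hq.1 h1.1
    exact ⟨_, ⟨h1.2, by rwa [h2], by rwa [h2]⟩, h2⟩
  · rintro ⟨p, ⟨-, h1, h2⟩, rfl⟩
    exact ⟨h1, h2⟩

/-- The mass of the slow points decays like `t ^ (-1 / (2 alpha))`. -/
theorem IsAdmissible.exists_tendsto_slow [T2Space M] [TopologicalSpace.MetrizableSpace M]
    [MeasurableSpace M] [BorelSpace M] (hA : T.IsAdmissible ρ ε) (hP : IsCompact P)
    (hPε : P ⊆ openSquare ε) (h0 : (0, 0) ∈ interior P)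
    (hfin : (frontier P ∩ {p | p.1 = 0}).Finite) {w : ℝ × ℝ → ℝ}
    (hw : ContinuousOn w (openSquare r)) (hwpos : ∀ p ∈ openSquare r, 0 < w p) :
    ∃ C, 0 < C ∧ Tendsto (fun t : ℝ => t ^ (2 * k.alpha)⁻¹ *
      (∫⁻ p in slowSet φ S σ P ρ t, ENNReal.ofReal (w p)).toReal) atTop (𝓝 C) := by
  have hPr := hPε.trans (openSquare_mono (hA.le.trans hA.lt.le))
  have ha := k.alpha_pos
  obtain ⟨C₀, -, hC₀⟩ := hA.exists_slow_bound hPε h0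
  obtain ⟨a, b, ha0, hab, hb, hent⟩ :=
    T.exists_entry_interval hA.lt hA.le hA.small hP hPε h0 hfin
  set E := {y₀ : ℝ | |y₀| < r ∧ IsExceptional φ σ P y₀} with hE
  have hex : ∀ y, ∃ c₁ c₂ : ℝ, |y| < ρ → y ≠ 0 → y ∉ E → 0 ≤ c₁ ∧ 0 ≤ c₂ ∧
      (IsEntry φ S σ P y → 0 < c₁) ∧ ∀ ξ, ξ ≠ 0 → ξ ≠ c₁ → ξ ≠ -c₂ → ∀ᶠ t in atTop,
        ((t ^ (-(2 * k.alpha)⁻¹) * ξ, y) ∈ slowSet φ S σ P ρ t ↔ ξ ∈ Set.Ioo (-c₂) c₁) := by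
    intro y
    by_cases h : |y| < ρ ∧ y ≠ 0 ∧ y ∉ E
    · obtain ⟨c₁, c₂, hc⟩ := hA.exists_slow_interval hP hPε h0 h.2.1 h.1
        fun h4 => h.2.2 ⟨h.1.trans hA.lt, h4⟩
      exact ⟨c₁, c₂, fun _ _ _ => hc⟩
    · exact ⟨0, 0, fun h1 h2 h3 => absurd ⟨h1, h2, h3⟩ h⟩
  choose c₁ c₂ hc using hex
  refine exists_tendsto_rpow_mul_lintegral hA.lt hw hwpos ?_ (fun t p hp => hp.1) hC₀
    ((T.countable_exceptional hfin).measure_zero volume) (c₁ := c₁) (c₂ := c₂)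
    (fun y h1 h2 h3 => ?_) (by positivity) ha0 hab hb fun y hy h3 => ?_
  · filter_upwards [eventually_ge_atTop 0] with t ht
      using T.measurableSet_slowSet hA.lt.le hP hPr ht
  · obtain ⟨h4, h5, -, h6⟩ := hc y h1 h2 h3
    exact ⟨h4, h5, h6⟩
  · have hy0 : 0 < y := ha0.trans hy.1
    exact (hc y (by rw [abs_of_pos hy0]; exact hy.2.trans_le hb) hy0.ne' h3).2.2.1 (hent y hy)

end SaddleTube

theorem isEquivalent_of_tendsto_rpow_mul {f : ℝ → ℝ} {β C : ℝ} (hC : C ≠ 0)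
    (h : Tendsto (fun t => t ^ β * f t) atTop (𝓝 C)) :
    f ~[atTop] fun t => C * t ^ (-β) := by
  refine isEquivalent_of_tendsto_one ?_
  have h1 := h.div_const C
  rw [div_self hC] at h1
  refine h1.congr' ?_
  filter_upwards [eventually_gt_atTop 0] with t ht
  have hp := Real.rpow_pos_of_pos ht β
  simp only [Pi.div_apply, Real.rpow_neg ht.le]
  field_simp

theorem proposition4p3 {M : Type*} [TopologicalSpace M] [T2Space M] [CompactSpace M]
    [ChartedSpace (EuclideanSpace ℝ (Fin 3)) M] [IsManifold (𝓡 3) ∞ M]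
    [MeasurableSpace M] [BorelSpace M]
    (X : ∀ q : M, TangentSpace (𝓡 3) q)
    (hX : ContMDiff (𝓡 3) (𝓡 3).tangent 1 (fun q => (⟨q, X q⟩ : TangentBundle (𝓡 3) M)))
    (φ : Flow ℝ M) (hφ : ∀ q : M, IsMIntegralCurve (fun t => φ t q) X)
    (a₀ a₁ a₂ b₀ b₁ b₂ : ℝ) (ha₀ : 0 < a₀) (ha₂ : 0 ≤ a₂) (hb₀ : 0 ≤ b₀) (hb₂ : 0 < b₂)
    (hc : (a₁ + b₁) ^ 2 < 4 * (a₀ + b₀) * (a₂ + b₂))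
    (r ℓ : ℝ) (Ψ : ℝ × ℝ × ℝ → M) (hΨ : IsCubicSaddleChart X a₀ a₁ a₂ b₀ b₁ b₂ r ℓ Ψ)
    (S : Set M) (hS : IsFlowSection φ Ψ r ℓ S)
    (μ : Measure M) (hμ : HasContinuousPositiveDensity μ Ψ r) :
    ∃ ε : ℝ, 0 < ε ∧ ε ≤ r ∧
      ∀ P₀ : Set (ℝ × ℝ), IsCompact P₀ → P₀ ⊆ openSquare ε → (0, 0) ∈ interior P₀ →
        (frontier P₀ ∩ {p | p.1 = 0}).Finite →
        ∃ C : ℝ, 0 < C ∧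
          (fun t : ℝ => (μ {q ∈ S \ sectionImage Ψ P₀ |
              ENNReal.ofReal t < firstHit φ (S \ sectionImage Ψ P₀) q}).toReal)
            ~[atTop] (fun t : ℝ => C * t ^ (-((a₂ + b₂) / (2 * b₂)))) := by
  have _ := Manifold.metrizableSpace (𝓡 3) M
  let k : SaddleCoeffs := ⟨a₀, a₁, a₂, b₀, b₁, b₂, ha₀, ha₂, hb₀, hb₂, hc⟩
  obtain ⟨r', hr', ⟨T⟩⟩ := exists_saddleTube hφ k hΨ hS
  obtain ⟨ρ, ε, hA⟩ := T.exists_isAdmissible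
  obtain ⟨w, hw, hwpos, hμ⟩ := hμ
  refine ⟨ε, hA.pos, (hA.le.trans hA.lt.le).trans hr', fun P₀ hP hPε h0 hfin => ?_⟩
  have hsub := openSquare_mono hr'
  have hPr := hPε.trans (openSquare_mono (hA.le.trans hA.lt.le))
  obtain ⟨C, hC, hlim⟩ := hA.exists_tendsto_slow hP hPε h0 hfin (hw.mono hsub)
    fun p hp => hwpos p (hsub hp)
  refine ⟨C, hC, ?_⟩
  have hexp : (2 * k.alpha)⁻¹ = (a₂ + b₂) / (2 * b₂) := by
    have h1 := k.tail_pos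
    simp only [SaddleCoeffs.alpha, k] at h1 ⊢
    field_simp
  rw [hexp] at hlim
  refine isEquivalent_of_tendsto_rpow_mul hC.ne' (hlim.congr' ?_)
  filter_upwards [eventually_ge_atTop T.gap, eventually_ge_atTop 0] with t ht ht0
  have hB := T.measurableSet_slowSet hA.lt.le hP hPr ht0
  rw [← hμ _ (fun p hp => hsub (openSquare_mono hA.lt.le hp.1)) hB]
  have himg := hA.setOf_slow_eq_image hPε ht
  simp only [sectionImage]
  rw [himg]
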